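/- For a commutative ring $R$ and $a,b\in R$ let $E_{a,b}$ denote the curve $y^2=x^3+ax+b$, with discriminant $\Delta_{a,b}=-16(4a^3+27b^2)$. For a prime $p$ let $\mathfrak{A}_p$ be the set of pairs $(A,B)\in(\mathbb{Z}/p^2)^2$ such that $\Delta_{A,B}$ is a unit and the abelian group $M=E_{A,B}(\mathbb{Z}/p^2)$ satisfies $\dim_{\mathbb{F}_p}(M\otimes\mathbb{F}_p)=2$. For $Y>0$ put $$P(Y)=\sum_{p\le Y}\frac{\#\mathfrak{A}_p}{p^4}\qquad(\text{sum over primes}).$$ For a Weierstrass curve $E$ over $\mathbb{Q}$ let $\Pi_{lt,E}$ be the set of local torsion primes of $E$, that is, the primes $p$ at which $E$ has good reduction and for which $E(\mathbb{Q}_p)$ contains a point of order $p$, and let $\Pi_{lt,E}(Y)=\{p\in\Pi_{lt,E}: p\le Y\}$. (If $\Delta_{a,b}=0$, then $E_{a,b}$ has good reduction at no prime, so $\Pi_{lt,E_{a,b}}=\emptyset$.) Every elliptic curve over $\mathbb{Q}$ is isomorphic to $E_{a,b}$ for a unique pair of integers $(a,b)$ with $\Delta_{a,b}\ne0$ such that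 for no prime $\ell$ both $\ell^4\mid a$ and $\ell^6\mid b$; its height is $H(E)=\max\{|a|^3,b^2\}$. The lower density of a set $\mathcal{S}$ of isomorphism classes of elliptic curves over $\mathbb{Q}$ is $$\liminf_{x\to\infty}\frac{\#\{E\in\mathcal{S}: H(E)<x\}}{\#\{E: H(E)<x\}}.$$ For real $C,D>0$ let $\mathcal{S}_{C,D}$ be the set of pairs $(a,b)\in\mathbb{Z}^2$ with $|a|<C$ and $|b|<D$, and for $\beta>0$ let $\mathcal{Q}^{\beta}_{C,D}$ be the set of $(a,b)\in\mathcal{S}_{C,D}$ for which the inequality $$|\#\Pi_{lt,E_{a,b}}(Y)-P(Y)|<\beta\sqrt{P(Y)}$$ fails. **Theorem 5.3.** There is an absolute constant $c>0$ such that for every $Y>0$ with $P(Y)>0$ (equivalently, $Y\ge5$) and every $\beta>0$ the following hold. 1. The set of elliptic curves $E$ over $\mathbb{Q}$ with $|\#\Pi_{lt,E}(Y)-P(Y)|<\beta\sqrt{P(Y)}$ has lower density at least $1-\dfrac{c}{\beta^2}$. 2. For all real $C,D>Y^4$, $$\frac{\#\mathcal{Q}^{\beta}_{C,D}}{\#\mathcal{S}_{C,D}}<\frac{c}{\beta^2}.$$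 -/

import Mathlib

namespace LocalTorsion

section PointsOverLocalRings

open WeierstrassCurve WeierstrassCurve.Projective

/-- The Weierstrass curve `y² = x³ + a x + b`. -/
def shortCurve {R : Type*} [CommRing R] (a b : R) : WeierstrassCurve R := ⟨0, 0, 0, a, b⟩

/-- A triple with an invertible coordinate. -/
def IsPrimitive {R : Type*} [CommRing R] (v : Fin 3 → R) : Prop := ∃ i, IsUnit (v i)

/-- The set `E_{a,b}(R)`, for a local ring `R`: the `R`-points of the projective plane (triples with
an invertible coordinate, up to units) that satisfy `Y² Z = X³ + a X Z² + b Z³`. -/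
def Point {R : Type*} [CommRing R] (a b : R) : Type _ :=
  {P : PointClass R // ∃ v : Fin 3 → R, (⟦v⟧ : PointClass R) = P ∧ IsPrimitive v ∧
    (shortCurve a b).toProjective.Equation v}

/-- The point at infinity `[0 : 1 : 0]`. -/
def infinity {R : Type*} [CommRing R] (a b : R) : Point a b :=
  ⟨⟦![0, 1, 0]⟧, ![0, 1, 0], rfl, ⟨1, by simp⟩, equation_zero⟩

/-- A bihomogeneous addition law of bidegree `(2, 2)` on `E_{a,b}`. Together with Mathlib's law
`addXYZ` (the chord construction) it forms a complete system: over a local ring, for any two points,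
at least one of the two laws gives a triple with an invertible coordinate, and every such triple
represents the sum. -/
def secondLaw {R : Type*} [CommRing R] (a b : R) (v w : Fin 3 → R) : Fin 3 → R :=
  ![(v 0 * w 1 + w 0 * v 1) * (v 1 * w 1 - a * (v 0 * w 2 + w 0 * v 2) - 3 * b * v 2 * w 2)
      - (v 1 * w 2 + w 1 * v 2)
        * (a * v 0 * w 0 + 3 * b * (v 0 * w 2 + w 0 * v 2) - a ^ 2 * v 2 * w 2),
    (3 * v 0 * w 0 + a * v 2 * w 2)
        * (a * v 0 * w 0 + 3 * b * (v 0 * w 2 + w 0 * v 2) - a ^ 2 * v 2 * w 2)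
      + (v 1 * w 1 + a * (v 0 * w 2 + w 0 * v 2) + 3 * b * v 2 * w 2)
        * (v 1 * w 1 - a * (v 0 * w 2 + w 0 * v 2) - 3 * b * v 2 * w 2),
    (v 1 * w 2 + w 1 * v 2) * (v 1 * w 1 + a * (v 0 * w 2 + w 0 * v 2) + 3 * b * v 2 * w 2)
      + (v 0 * w 1 + w 0 * v 1) * (3 * v 0 * w 0 + a * v 2 * w 2)]

open Classical in
/-- Addition on representatives: the chord law where it gives a primitive triple, and the second
law otherwise. -/
noncomputable def addRep {R : Type*} [CommRing R] (a b : R) (v w : Fin 3 → R) : Fin 3 → R :=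
  if IsPrimitive ((shortCurve a b).toProjective.addXYZ v w)
  then (shortCurve a b).toProjective.addXYZ v w else secondLaw a b v w

lemma isPrimitive_smul {R : Type*} [CommRing R] {u : R} (hu : IsUnit u) (v : Fin 3 → R) :
    IsPrimitive (u • v) ↔ IsPrimitive v := by
  simp only [IsPrimitive, Pi.smul_apply, smul_eq_mul]
  exact exists_congr fun i => ⟨fun h => isUnit_of_mul_isUnit_right h, fun h => hu.mul h⟩

lemma secondLaw_smul {R : Type*} [CommRing R] (a b : R) (v w : Fin 3 → R) (s t : R) :
    secondLaw a b (s • v) (t • w) = (s * t) ^ 2 • secondLaw a b v w := by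
  funext i
  fin_cases i <;> simp [secondLaw] <;> ring

lemma addRep_smul {R : Type*} [CommRing R] (a b : R) (v w : Fin 3 → R) {s t : R} (hs : IsUnit s)
    (ht : IsUnit t) : addRep a b (s • v) (t • w) = (s * t) ^ 2 • addRep a b v w := by
  have hu : IsUnit ((s * t) ^ 2) := (hs.mul ht).pow 2
  by_cases h : IsPrimitive ((shortCurve a b).toProjective.addXYZ v w)
  · rw [addRep, addRep, addXYZ_smul, if_pos h, if_pos ((isPrimitive_smul hu _).mpr h)]
  · rw [addRep, addRep, addXYZ_smul, if_neg h, if_neg (mt (isPrimitive_smul hu _).mp h),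
      secondLaw_smul]

lemma addRep_equiv {R : Type*} [CommRing R] (a b : R) ⦃v v' : Fin 3 → R⦄ (hv : v ≈ v')
    ⦃w w' : Fin 3 → R⦄ (hw : w ≈ w') : addRep a b v w ≈ addRep a b v' w' := by
  rcases hv, hw with ⟨⟨s, rfl⟩, ⟨t, rfl⟩⟩
  have := addRep_smul a b v' w' s.isUnit t.isUnit
  refine ⟨(s * t) ^ 2, ?_⟩
  exact this.symm

/-- Addition of classes of triples. -/
noncomputable def addClass {R : Type*} [CommRing R] (a b : R) (P Q : PointClass R) :
    PointClass R :=
  Quotient.map₂ (addRep a b) (addRep_equiv a b) P Q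

/-! ### Reduction of points of `E(ℚ_p)`, and the group `E(ℤ/p²)` -/

lemma equation_short {R : Type*} [CommRing R] {a b : R} {v : Fin 3 → R} :
    (shortCurve a b).toProjective.Equation v ↔
      v 1 ^ 2 * v 2 = v 0 ^ 3 + a * v 0 * v 2 ^ 2 + b * v 2 ^ 3 := by
  rw [equation_iff]
  simp [shortCurve, sub_eq_zero]

lemma shortCurve_map {R S : Type*} [CommRing R] [CommRing S] (f : R →+* S) (a b : R) :
    (shortCurve a b).map f = shortCurve (f a) (f b) := by
  simp [shortCurve, WeierstrassCurve.map]

lemma secondLaw_map {R S : Type*} [CommRing R] [CommRing S] (f : R →+* S) (a b : R)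
    (v w : Fin 3 → R) :
    secondLaw (f a) (f b) (f ∘ v) (f ∘ w) = f ∘ secondLaw a b v w := by
  funext i
  fin_cases i <;> simp [secondLaw, map_ofNat f 3]

lemma isPrimitive_map {R S : Type*} [CommRing R] [CommRing S] (f : R →+* S) [IsLocalHom f]
    (v : Fin 3 → R) : IsPrimitive (f ∘ v) ↔ IsPrimitive v := by
  simp [IsPrimitive]

lemma addRep_map {R S : Type*} [CommRing R] [CommRing S] (f : R →+* S) [IsLocalHom f] (a b : R)
    (v w : Fin 3 → R) : addRep (f a) (f b) (f ∘ v) (f ∘ w) = f ∘ addRep a b v w := by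
  have h : (shortCurve (f a) (f b)).toProjective.addXYZ (f ∘ v) (f ∘ w)
      = f ∘ (shortCurve a b).toProjective.addXYZ v w := by
    rw [← shortCurve_map]; exact map_addXYZ f v w
  by_cases hp : IsPrimitive ((shortCurve a b).toProjective.addXYZ v w)
  · rw [addRep, addRep, h, if_pos hp, if_pos ((isPrimitive_map f _).mpr hp)]
  · rw [addRep, addRep, h, if_neg hp, if_neg (mt (isPrimitive_map f _).mp hp), secondLaw_map]

section Field

variable {F : Type*} [Field F] {a b : F}

lemma nonsingular_short [hE : (shortCurve a b).IsElliptic] {v : Fin 3 → F}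
    (hv : (shortCurve a b).toProjective.Equation v) (h0 : v ≠ 0) :
    (shortCurve a b).toProjective.Nonsingular v := by
  by_cases hz : v 2 = 0
  · rw [nonsingular_of_Z_eq_zero hz]
    refine ⟨hv, Or.inr ?_⟩
    have hx : v 0 = 0 := X_eq_zero_of_Z_eq_zero hv hz
    simp only [hx, shortCurve]
    intro h
    apply h0
    funext i
    fin_cases i
    · exact hx
    · simpa using h
    · exact hz
  · rw [nonsingular_of_Z_ne_zero hz]
    exact Affine.equation_iff_nonsingular.mp ((equation_of_Z_ne_zero hz).mp hv)

lemma ne_zero_of_nonsingular {W : Projective F} {v : Fin 3 → F} (h : W.Nonsingular v) : v ≠ 0 := by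
  rintro rfl
  simp [nonsingular_iff] at h

lemma equiv_of_cross {v w : Fin 3 → F} (hv : v ≠ 0) (hw : w ≠ 0)
    (h : ∀ i j, v i * w j = v j * w i) : v ≈ w := by
  obtain ⟨i, hi⟩ := Function.ne_iff.mp hv
  obtain ⟨k, hk⟩ := Function.ne_iff.mp hw
  have hi' : v i ≠ 0 := hi
  have hk' : w k ≠ 0 := hk
  have hwi : w i ≠ 0 := by
    intro h0
    have := h i k
    rw [h0, mul_zero] at this
    exact (mul_ne_zero hi' hk') this
  refine ⟨Units.mk0 (v i / w i) (div_ne_zero hi' hwi), ?_⟩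
  funext j
  have := h i j
  simp only [Units.smul_def, Units.val_mk0, Pi.smul_apply, smul_eq_mul]
  field_simp
  linear_combination this

lemma secondLaw_self {v : Fin 3 → F} (hv : (shortCurve a b).toProjective.Equation v) :
    secondLaw a b v v = (shortCurve a b).toProjective.dblXYZ v := by
  have h := equation_short.mp hv
  funext i
  fin_cases i
  · simp [secondLaw, dblXYZ, dblX, shortCurve]; ring
  · simp [secondLaw, dblXYZ, dblX, dblY, dblZ, negDblY, negY, shortCurve]
    linear_combination (9 * v 2 * b - 3 * v 0 * a) * h
  · simp [secondLaw, dblXYZ, dblZ, negY, shortCurve]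
    linear_combination (-6 * v 1) * h

lemma secondLaw_cross {v w : Fin 3 → F} (hv : (shortCurve a b).toProjective.Equation v)
    (hw : (shortCurve a b).toProjective.Equation w) (i j : Fin 3) :
    secondLaw a b v w i * (shortCurve a b).toProjective.addXYZ v w j
      = secondLaw a b v w j * (shortCurve a b).toProjective.addXYZ v w i := by
  have h := equation_short.mp hv
  have k := equation_short.mp hw
  have h01 : secondLaw a b v w 0 * (shortCurve a b).toProjective.addXYZ v w 1
      = secondLaw a b v w 1 * (shortCurve a b).toProjective.addXYZ v w 0 := by
    simp [secondLaw, addXYZ, addX, addY, addZ, negAddY, negY, shortCurve]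
    linear_combination ( (-6*v 2*w 2^4*a^2*b) + (3*v 2*w 1^2*w 2^2*a^2) + (27*v 2*w 0*w 2^3*b^2)
      + (-4*v 2*w 0*w 2^3*a^3) + (9*v 2*w 0*w 1^2*w 2*b) + (18*v 2*w 0^2*w 2^2*a*b)
      + (3*v 2*w 0^2*w 1^2*a) + (v 1*w 1*w 2^3*a^2) + (-9*v 1*w 0*w 1*w 2^2*b)
      + (-3*v 1*w 0*w 1^3) + (-3*v 1*w 0^2*w 1*w 2*a) + (-1*v 0*w 2^4*a^3)
      + (9*v 0*w 0*w 2^3*a*b) + (3*v 0*w 0*w 1^2*w 2*a) + (3*v 0*w 0^2*w 2^2*a^2) ) * h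
      + ( (6*v 2^4*w 2*a^2*b) + (v 2^4*w 0*a^3) + (-1*v 1*v 2^3*w 1*a^2)
      + (-3*v 1^2*v 2^2*w 2*a^2) + (-27*v 0*v 2^3*w 2*b^2) + (4*v 0*v 2^3*w 2*a^3)
      + (-9*v 0*v 2^3*w 0*a*b) + (9*v 0*v 1*v 2^2*w 1*b) + (-9*v 0*v 1^2*v 2*w 2*b)
      + (-3*v 0*v 1^2*v 2*w 0*a) + (3*v 0*v 1^3*w 1) + (-18*v 0^2*v 2^2*w 2*a*b)
      + (-3*v 0^2*v 2^2*w 0*a^2) + (3*v 0^2*v 1*v 2*w 1*a) + (-3*v 0^2*v 1^2*w 2*a) ) * k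
  have h02 : secondLaw a b v w 0 * (shortCurve a b).toProjective.addXYZ v w 2
      = secondLaw a b v w 2 * (shortCurve a b).toProjective.addXYZ v w 0 := by
    simp [secondLaw, addXYZ, addX, addZ, shortCurve]
    linear_combination ( (v 2*w 1*w 2^3*a^2) + (-9*v 2*w 0*w 1*w 2^2*b) + (-3*v 2*w 0*w 1^3)
      + (-3*v 2*w 0^2*w 1*w 2*a) + (v 1*w 2^4*a^2) + (-9*v 1*w 0*w 2^3*b)
      + (-3*v 1*w 0*w 1^2*w 2) + (-3*v 1*w 0^2*w 2^2*a) ) * h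
      + ( (-1*v 2^4*w 1*a^2) + (-1*v 1*v 2^3*w 2*a^2) + (9*v 0*v 2^3*w 1*b)
      + (9*v 0*v 1*v 2^2*w 2*b) + (3*v 0*v 1^2*v 2*w 1) + (3*v 0*v 1^3*w 2)
      + (3*v 0^2*v 2^2*w 1*a) + (3*v 0^2*v 1*v 2*w 2*a) ) * k
  have h12 : secondLaw a b v w 1 * (shortCurve a b).toProjective.addXYZ v w 2
      = secondLaw a b v w 2 * (shortCurve a b).toProjective.addXYZ v w 1 := by
    simp [secondLaw, addXYZ, addY, addX, addZ, negAddY, negY, shortCurve]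
    linear_combination ( (-1*v 2*w 2^4*a^3) + (12*v 2*w 0*w 1^2*w 2*a) + (-6*v 2*w 0^2*w 2^2*a^2)
      + (-9*v 2*w 0^4*a) + (-3*v 0*w 0*w 2^3*a^2) + (27*v 0*w 0^2*w 2^2*b) + (9*v 0*w 0^2*w 1^2)
      + (9*v 0*w 0^3*w 2*a) ) * h
      + ( (v 2^4*w 2*a^3) + (9*v 2^4*w 0*a*b) + (-9*v 1^2*v 2^2*w 0*a) + (-9*v 0*v 2^3*w 2*a*b)
      + (12*v 0*v 2^3*w 0*a^2) + (-3*v 0*v 1^2*v 2*w 2*a) + (-3*v 0^2*v 2^2*w 2*a^2)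
      + (-27*v 0^2*v 2^2*w 0*b) + (-9*v 0^2*v 1^2*w 0) ) * k
  fin_cases i <;> fin_cases j <;>
    first
    | rfl
    | exact h01
    | exact h01.symm
    | exact h02
    | exact h02.symm
    | exact h12
    | exact h12.symm

lemma addXYZ_ne_zero {W : Projective F} {v w : Fin 3 → F} (hv : W.Nonsingular v)
    (hw : W.Nonsingular w) (h : ¬ v ≈ w) : W.addXYZ v w ≠ 0 := by
  have := ne_zero_of_nonsingular (nonsingular_add hv hw)
  rwa [add_of_not_equiv h] at this

lemma secondLaw_of_equiv {v w : Fin 3 → F} (hw : (shortCurve a b).toProjective.Equation w)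
    (h : v ≈ w) : ∃ u : Fˣ, secondLaw a b v w
      = (u : F) • (shortCurve a b).toProjective.add v w := by
  obtain ⟨s, rfl⟩ := h
  refine ⟨s⁻¹ ^ 2, ?_⟩
  have h1 : secondLaw a b ((s : F) • w) ((1 : F) • w) = _ := secondLaw_smul a b w w s 1
  have h2 : (shortCurve a b).toProjective.add ((s : F) • w) ((1 : F) • w) = _ :=
    add_smul_of_equiv (Setoid.refl w) s.isUnit isUnit_one
  rw [one_smul] at h1 h2
  rw [add_self, ← secondLaw_self hw] at h2
  change secondLaw a b ((s : F) • w) w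
    = _ • (shortCurve a b).toProjective.add ((s : F) • w) w
  rw [h1, h2, smul_smul]
  congr 1
  have := s.ne_zero
  simp
  field_simp

/-- Over a field, one of the two laws is nonzero at every pair of points. -/
lemma secondLaw_ne_zero [(shortCurve a b).IsElliptic] {v w : Fin 3 → F}
    (hv : (shortCurve a b).toProjective.Nonsingular v)
    (hw : (shortCurve a b).toProjective.Nonsingular w)
    (h : (shortCurve a b).toProjective.addXYZ v w = 0) : secondLaw a b v w ≠ 0 := by
  have he : v ≈ w := by
    by_contra hne
    exact addXYZ_ne_zero hv hw hne h
  obtain ⟨u, hu⟩ := secondLaw_of_equiv hw.1 he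
  rw [hu]
  exact smul_ne_zero u.ne_zero (ne_zero_of_nonsingular (nonsingular_add hv hw))

/-- Over a field, the second law represents the sum wherever it is nonzero. -/
lemma secondLaw_equiv_add {v w : Fin 3 → F}
    (hv : (shortCurve a b).toProjective.Nonsingular v)
    (hw : (shortCurve a b).toProjective.Nonsingular w)
    (h : secondLaw a b v w ≠ 0) :
    secondLaw a b v w ≈ (shortCurve a b).toProjective.add v w := by
  by_cases he : v ≈ w
  · obtain ⟨u, hu⟩ := secondLaw_of_equiv hw.1 he
    exact ⟨u, hu.symm⟩
  · rw [add_of_not_equiv he]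
    exact equiv_of_cross h (addXYZ_ne_zero hv hw he) (secondLaw_cross hv.1 hw.1)

end Field

section Padic

variable {p : ℕ} [Fact p.Prime]

lemma isUnit_iff_toZMod (x : ℤ_[p]) : IsUnit x ↔ PadicInt.toZMod x ≠ 0 := by
  rw [ne_eq, ← RingHom.mem_ker, PadicInt.ker_toZMod, IsLocalRing.mem_maximalIdeal, mem_nonunits_iff,
    not_not]

lemma toZModPow_eq_zero_iff (x : ℤ_[p]) (n : ℕ) : PadicInt.toZModPow n x = 0 ↔ (p : ℤ_[p]) ^ n ∣ x := by
  rw [← RingHom.mem_ker, PadicInt.ker_toZModPow, Ideal.mem_span_singleton]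

lemma toZModPow_surjective (n : ℕ) : Function.Surjective (PadicInt.toZModPow n : ℤ_[p] →+* ZMod (p ^ n)) :=
  ZMod.ringHom_surjective _

lemma dvd_not_isUnit {x : ℤ_[p]} (h : (p : ℤ_[p]) ^ 2 ∣ x) : ¬ IsUnit x := by
  intro hx
  have h2 : IsUnit (p : ℤ_[p]) := isUnit_of_dvd_unit ((dvd_pow_self _ two_ne_zero).trans h) hx
  exact PadicInt.p_nonunit h2

instance isLocalHom_toZModPow_two : IsLocalHom (PadicInt.toZModPow 2 : ℤ_[p] →+* ZMod (p ^ 2)) := by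
  constructor
  intro x hx
  obtain ⟨y, hy⟩ := toZModPow_surjective 2 (hx.unit⁻¹ : (ZMod (p ^ 2))ˣ).val
  have h : PadicInt.toZModPow 2 (x * y - 1) = 0 := by
    rw [map_sub, map_mul, hy, map_one, sub_eq_zero]
    exact hx.mul_val_inv
  rw [toZModPow_eq_zero_iff] at h
  by_contra hn
  have hxy : x * y ∈ IsLocalRing.maximalIdeal ℤ_[p] :=
    Ideal.mul_mem_right _ _ ((IsLocalRing.mem_maximalIdeal x).mpr hn)
  have h1 : x * y - 1 ∈ IsLocalRing.maximalIdeal ℤ_[p] :=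
    (IsLocalRing.mem_maximalIdeal _).mpr (dvd_not_isUnit h)
  have : (1 : ℤ_[p]) ∈ IsLocalRing.maximalIdeal ℤ_[p] := by
    have := sub_mem hxy h1
    rwa [sub_sub_cancel] at this
  exact (IsLocalRing.mem_maximalIdeal _).mp this isUnit_one

/-- A root modulo `p²` at which the derivative is a unit lifts to `ℤ_p`. -/
lemma hensel_two (f : Polynomial ℤ_[p]) (t : ℤ_[p]) (h0 : PadicInt.toZModPow 2 (f.eval t) = 0)
    (h1 : IsUnit (f.derivative.eval t)) :
    ∃ s, f.eval s = 0 ∧ PadicInt.toZModPow 2 s = PadicInt.toZModPow 2 t := by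
  rw [toZModPow_eq_zero_iff] at h0
  have hu : ‖f.derivative.eval t‖ = 1 := PadicInt.isUnit_iff.mp h1
  have hlt : ‖f.eval t‖ < 1 := PadicInt.mem_nonunits.mp (dvd_not_isUnit h0)
  obtain ⟨z, hz, hzt, -, -⟩ := hensels_lemma (F := f) (a := t) (by
    simpa [Polynomial.coe_aeval_eq_eval, hu] using hlt)
  simp only [Polynomial.coe_aeval_eq_eval, hu] at hz hzt
  refine ⟨z, hz, ?_⟩
  obtain ⟨k, hk⟩ := Polynomial.binomExpansion f t (z - t)
  rw [add_sub_cancel, hz] at hk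
  have hun : IsUnit (f.derivative.eval t + k * (z - t)) := by
    by_contra hn
    have hm : k * (z - t) ∈ IsLocalRing.maximalIdeal ℤ_[p] :=
      Ideal.mul_mem_left _ _ ((IsLocalRing.mem_maximalIdeal _).mpr (PadicInt.mem_nonunits.mpr hzt))
    have := sub_mem ((IsLocalRing.mem_maximalIdeal _).mpr hn) hm
    rw [add_sub_cancel_right] at this
    exact (IsLocalRing.mem_maximalIdeal _).mp this h1
  have hd : (p : ℤ_[p]) ^ 2 ∣ z - t := by
    have : (p : ℤ_[p]) ^ 2 ∣ (z - t) * (f.derivative.eval t + k * (z - t)) := by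
      have he : (z - t) * (f.derivative.eval t + k * (z - t)) = - f.eval t := by
        linear_combination -hk
      rw [he]
      exact (dvd_neg).mpr h0
    exact hun.dvd_mul_right.mp this
  rw [← sub_eq_zero, ← map_sub, toZModPow_eq_zero_iff]
  exact hd

variable {a b : ℤ_[p]}

lemma isElliptic_map {R S : Type*} [CommRing R] [CommRing S] (f : R →+* S) {a b : R}
    (h : (shortCurve a b).IsElliptic) : (shortCurve (f a) (f b)).IsElliptic := by
  rw [← shortCurve_map]
  infer_instance

lemma exists_lift (hE : (shortCurve a b).IsElliptic) (w : Fin 3 → ZMod (p ^ 2))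
    (hw : IsPrimitive w)
    (he : (shortCurve (PadicInt.toZModPow 2 a) (PadicInt.toZModPow 2 b)).toProjective.Equation w) :
    ∃ v : Fin 3 → ℤ_[p], IsPrimitive v ∧ (shortCurve a b).toProjective.Equation v ∧
      PadicInt.toZModPow 2 ∘ v = w := by
  choose v hv using fun i => toZModPow_surjective (p := p) 2 (w i)
  obtain rfl : PadicInt.toZModPow 2 ∘ v = w := funext hv
  clear hv
  rw [isPrimitive_map] at hw
  have he' := equation_short.mp he
  simp only [Function.comp_apply, ← map_pow, ← map_mul, ← map_add] at he'
  rw [← sub_eq_zero, ← map_sub] at he'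
  -- modulo `p` the point is nonsingular
  have hE' := isElliptic_map (PadicInt.toZMod : ℤ_[p] →+* ZMod p) hE
  have hp : (shortCurve (PadicInt.toZMod a) (PadicInt.toZMod b)).toProjective.Nonsingular
      ((PadicInt.toZMod : ℤ_[p] →+* ZMod p) ∘ v) := by
    refine nonsingular_short ?_ ?_
    · rw [equation_short]
      simp only [Function.comp_apply, ← map_pow, ← map_mul, ← map_add]
      rw [← sub_eq_zero, ← map_sub]
      by_contra hn
      exact dvd_not_isUnit ((toZModPow_eq_zero_iff _ _).mp he') ((isUnit_iff_toZMod _).mpr hn)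
    · obtain ⟨i, hi⟩ := hw
      exact fun h => (isUnit_iff_toZMod _).mp hi (congrFun h i)
  have key : ∃ v' : Fin 3 → ℤ_[p], (shortCurve a b).toProjective.Equation v' ∧
      PadicInt.toZModPow 2 ∘ v' = PadicInt.toZModPow 2 ∘ v := by
    rcases ((nonsingular_iff _).mp hp).2 with h | h | h
    · obtain ⟨s, hs, hs'⟩ := hensel_two (.C (v 1 ^ 2 * v 2) - (.X ^ 3 + .C (a * v 2 ^ 2) * .X
        + .C (b * v 2 ^ 3))) (v 0) (by
          rw [← he']; congr 1; simp; ring) (by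
          rw [isUnit_iff_toZMod]
          convert! h using 1
          simp [Polynomial.derivative_pow, shortCurve, map_ofNat])
      refine ⟨![s, v 1, v 2], ?_, ?_⟩
      · rw [equation_short]
        simp at hs ⊢
        linear_combination hs
      · funext i; fin_cases i <;> simp [hs']
    · obtain ⟨s, hs, hs'⟩ := hensel_two (.C (v 2) * .X ^ 2 - .C (v 0 ^ 3 + a * v 0 * v 2 ^ 2
        + b * v 2 ^ 3)) (v 1) (by
          rw [← he']; congr 1; simp; ring) (by
          rw [isUnit_iff_toZMod]
          convert! h using 1
          simp [Polynomial.derivative_pow, shortCurve, map_ofNat]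
          ring)
      refine ⟨![v 0, s, v 2], ?_, ?_⟩
      · rw [equation_short]
        simp at hs ⊢
        linear_combination hs
      · funext i; fin_cases i <;> simp [hs']
    · obtain ⟨s, hs, hs'⟩ := hensel_two (.C (v 1 ^ 2) * .X - (.C (v 0 ^ 3) + .C (a * v 0) * .X ^ 2
        + .C b * .X ^ 3)) (v 2) (by
          rw [← he']; congr 1; simp) (by
          rw [isUnit_iff_toZMod]
          convert! h using 1
          simp [Polynomial.derivative_pow, shortCurve, map_ofNat]
          ring)
      refine ⟨![v 0, v 1, s], ?_, ?_⟩
      · rw [equation_short]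
        simp at hs ⊢
        linear_combination hs
      · funext i; fin_cases i <;> simp [hs']
  obtain ⟨v', hv', hvv⟩ := key
  refine ⟨v', ?_, hv', hvv⟩
  rw [← isPrimitive_map (PadicInt.toZModPow 2 : ℤ_[p] →+* ZMod (p ^ 2)), hvv, isPrimitive_map]
  exact hw

/-- `v` is a primitive integral representative of the point `P` of `E(ℚ_p)`. -/
def Rep (a b : ℤ_[p])
    (P : (shortCurve (algebraMap ℤ_[p] ℚ_[p] a) (algebraMap ℤ_[p] ℚ_[p] b)).toProjective.Point)
    (v : Fin 3 → ℤ_[p]) : Prop :=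
  P.point = ⟦algebraMap ℤ_[p] ℚ_[p] ∘ v⟧ ∧ IsPrimitive v

/-- The class `c` of triples over `ℤ/p²` is the reduction of the point `P` of `E(ℚ_p)`. -/
def Reduces (a b : ℤ_[p])
    (P : (shortCurve (algebraMap ℤ_[p] ℚ_[p] a) (algebraMap ℤ_[p] ℚ_[p] b)).toProjective.Point)
    (c : PointClass (ZMod (p ^ 2))) : Prop :=
  ∃ v, Rep a b P v ∧ c = ⟦PadicInt.toZModPow 2 ∘ v⟧

lemma algebraMap_inj : Function.Injective (algebraMap ℤ_[p] ℚ_[p]) :=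
  IsFractionRing.injective ℤ_[p] ℚ_[p]

variable {P Q : (shortCurve (algebraMap ℤ_[p] ℚ_[p] a) (algebraMap ℤ_[p] ℚ_[p] b)).toProjective.Point}

lemma Rep.nonsingular {v : Fin 3 → ℤ_[p]} (h : Rep a b P v) :
    (shortCurve (algebraMap ℤ_[p] ℚ_[p] a) (algebraMap ℤ_[p] ℚ_[p] b)).toProjective.Nonsingular
      (algebraMap ℤ_[p] ℚ_[p] ∘ v) := by
  have := P.nonsingular
  rw [h.1] at this
  exact this

lemma Rep.equation {v : Fin 3 → ℤ_[p]} (h : Rep a b P v) :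
    (shortCurve a b).toProjective.Equation v := by
  have := h.nonsingular.1
  rw [← shortCurve_map] at this
  exact (map_equation (W' := (shortCurve a b).toProjective) algebraMap_inj v).mp this

lemma exists_rep (P : (shortCurve (algebraMap ℤ_[p] ℚ_[p] a)
    (algebraMap ℤ_[p] ℚ_[p] b)).toProjective.Point) : ∃ v, Rep a b P v := by
  obtain ⟨x, hx⟩ := Quotient.exists_rep P.point
  have hns := P.nonsingular
  rw [← hx] at hns
  have h0 : x ≠ 0 := ne_zero_of_nonsingular hns
  obtain ⟨i, -, hi⟩ := Finset.exists_max_image Finset.univ (fun j => ‖x j‖) ⟨0, Finset.mem_univ _⟩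
  have hxi : x i ≠ 0 := by
    intro hxi
    apply h0
    funext j
    have := hi j (Finset.mem_univ j)
    rw [hxi, norm_zero] at this
    exact norm_le_zero_iff.mp this
  have hle : ∀ j, ‖x j / x i‖ ≤ 1 := fun j => by
    rw [norm_div]
    exact div_le_one_of_le₀ (hi j (Finset.mem_univ j)) (norm_nonneg _)
  refine ⟨fun j => ⟨x j / x i, hle j⟩, ?_, i, ?_⟩
  · rw [← hx]
    refine Quotient.sound ⟨Units.mk0 (x i) hxi, ?_⟩
    funext j
    change x i * (x j / x i) = x j
    field_simp
  · exact PadicInt.isUnit_iff.mpr (by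
      change ‖x i / x i‖ = 1
      rw [div_self hxi, norm_one])

lemma norm_le_of_primitive {v w : Fin 3 → ℤ_[p]} {u : ℚ_[p]} (hw : IsPrimitive w)
    (h : ∀ i, u * (w i : ℚ_[p]) = v i) : ‖u‖ ≤ 1 := by
  obtain ⟨i, hi⟩ := hw
  have h1 := congrArg norm (h i)
  have h2 : ‖(w i : ℚ_[p])‖ = 1 := PadicInt.isUnit_iff.mp hi
  rw [norm_mul, h2, mul_one] at h1
  rw [h1]
  exact (v i).2

lemma Rep.unique {v w : Fin 3 → ℤ_[p]} (hv : Rep a b P v) (hw : Rep a b P w) :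
    ∃ u : ℤ_[p]ˣ, u • w = v := by
  have h := hv.1.symm.trans hw.1
  obtain ⟨u, hu⟩ := Quotient.exact h
  have hu' : ∀ i, (u : ℚ_[p]) * (w i : ℚ_[p]) = v i := fun i => congrFun hu i
  have hu'' : ∀ i, ((u⁻¹ : ℚ_[p]ˣ) : ℚ_[p]) * (v i : ℚ_[p]) = w i := fun i => by
    rw [← hu' i, Units.inv_mul_cancel_left]
  have h1 : ‖(u : ℚ_[p])‖ ≤ 1 := norm_le_of_primitive hw.2 hu'
  have h2 : ‖((u⁻¹ : ℚ_[p]ˣ) : ℚ_[p])‖ ≤ 1 := norm_le_of_primitive hv.2 hu''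
  refine ⟨⟨⟨u, h1⟩, ⟨(u⁻¹ : ℚ_[p]ˣ), h2⟩, Subtype.ext (Units.mul_inv u),
    Subtype.ext (Units.inv_mul u)⟩, ?_⟩
  funext i
  exact Subtype.ext (hu' i)

lemma Reduces.unique {c d : PointClass (ZMod (p ^ 2))} (hc : Reduces a b P c)
    (hd : Reduces a b P d) : c = d := by
  obtain ⟨v, hv, rfl⟩ := hc
  obtain ⟨w, hw, rfl⟩ := hd
  obtain ⟨u, rfl⟩ := hv.unique hw
  refine Quotient.sound ⟨Units.map (PadicInt.toZModPow 2 : ℤ_[p] →+* ZMod (p ^ 2)) u, ?_⟩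
  funext i
  exact (map_mul (PadicInt.toZModPow 2 : ℤ_[p] →+* ZMod (p ^ 2)) (u : ℤ_[p]) (w i)).symm

lemma Rep.add (hE : (shortCurve a b).IsElliptic) {v w : Fin 3 → ℤ_[p]} (hv : Rep a b P v)
    (hw : Rep a b Q w) : Rep a b (P + Q) (addRep a b v w) := by
  have hmap : (shortCurve (algebraMap ℤ_[p] ℚ_[p] a) (algebraMap ℤ_[p] ℚ_[p] b)).toProjective.addXYZ
      (algebraMap ℤ_[p] ℚ_[p] ∘ v) (algebraMap ℤ_[p] ℚ_[p] ∘ w)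
      = algebraMap ℤ_[p] ℚ_[p] ∘ (shortCurve a b).toProjective.addXYZ v w := by
    rw [← shortCurve_map]; exact map_addXYZ _ v w
  have hsum : (P + Q).point = ⟦(shortCurve (algebraMap ℤ_[p] ℚ_[p] a)
      (algebraMap ℤ_[p] ℚ_[p] b)).toProjective.add (algebraMap ℤ_[p] ℚ_[p] ∘ v)
        (algebraMap ℤ_[p] ℚ_[p] ∘ w)⟧ := by
    rw [Projective.Point.add_point, hv.1, hw.1]; rfl
  have hne : ∀ x : Fin 3 → ℤ_[p], IsPrimitive x → algebraMap ℤ_[p] ℚ_[p] ∘ x ≠ 0 := by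
    rintro x ⟨i, hi⟩ h
    have h1 := congrFun h i
    simp only [Function.comp_apply, Pi.zero_apply, map_eq_zero_iff _ algebraMap_inj] at h1
    rw [h1] at hi
    exact not_isUnit_zero hi
  by_cases h : IsPrimitive ((shortCurve a b).toProjective.addXYZ v w)
  · rw [addRep, if_pos h]
    refine ⟨?_, h⟩
    rw [hsum, ← hmap, add_of_not_equiv]
    rintro ⟨s, hs⟩
    apply hne _ h
    rw [← hmap]
    have h1 : (algebraMap ℤ_[p] ℚ_[p] ∘ v) = (s : ℚ_[p]) • (algebraMap ℤ_[p] ℚ_[p] ∘ w) := hs.symm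
    have h2 := addXYZ_smul (W' := (shortCurve (algebraMap ℤ_[p] ℚ_[p] a)
      (algebraMap ℤ_[p] ℚ_[p] b)).toProjective) (algebraMap ℤ_[p] ℚ_[p] ∘ w)
      (algebraMap ℤ_[p] ℚ_[p] ∘ w) s 1
    rw [one_smul, ← h1, addXYZ_self] at h2
    rw [h2]
    simp
  · rw [addRep, if_neg h]
    have hprim : IsPrimitive (secondLaw a b v w) := by
      have hE' := isElliptic_map (PadicInt.toZMod : ℤ_[p] →+* ZMod p) hE
      have hns : ∀ x : Fin 3 → ℤ_[p], IsPrimitive x → (shortCurve a b).toProjective.Equation x →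
          (shortCurve (PadicInt.toZMod a) (PadicInt.toZMod b)).toProjective.Nonsingular
            ((PadicInt.toZMod : ℤ_[p] →+* ZMod p) ∘ x) := by
        rintro x ⟨i, hi⟩ hx
        refine nonsingular_short ?_ fun h0 => (isUnit_iff_toZMod _).mp hi (congrFun h0 i)
        rw [← shortCurve_map]
        exact hx.map _
      have h0 : (shortCurve (PadicInt.toZMod a) (PadicInt.toZMod b)).toProjective.addXYZ
          ((PadicInt.toZMod : ℤ_[p] →+* ZMod p) ∘ v) (PadicInt.toZMod ∘ w) = 0 := by
        rw [← shortCurve_map]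
        refine (map_addXYZ _ v w).trans ?_
        funext i
        by_contra hn
        exact h ⟨i, (isUnit_iff_toZMod _).mpr hn⟩
      have := secondLaw_ne_zero (hns v hv.2 hv.equation) (hns w hw.2 hw.equation) h0
      rw [secondLaw_map] at this
      obtain ⟨i, hi⟩ := Function.ne_iff.mp this
      exact ⟨i, (isUnit_iff_toZMod _).mpr hi⟩
    refine ⟨?_, hprim⟩
    rw [hsum, ← secondLaw_map]
    refine (Quotient.sound (secondLaw_equiv_add hv.nonsingular hw.nonsingular ?_)).symm
    rw [secondLaw_map]
    exact hne _ hprim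

variable {c d : PointClass (ZMod (p ^ 2))}

lemma Reduces.add (hE : (shortCurve a b).IsElliptic) (hc : Reduces a b P c)
    (hd : Reduces a b Q d) :
    Reduces a b (P + Q) (addClass (PadicInt.toZModPow 2 a) (PadicInt.toZModPow 2 b) c d) := by
  obtain ⟨v, hv, rfl⟩ := hc
  obtain ⟨w, hw, rfl⟩ := hd
  refine ⟨_, hv.add hE hw, ?_⟩
  rw [← addRep_map]
  rfl

lemma Reduces.zero : Reduces a b 0 ⟦![0, 1, 0]⟧ := by
  refine ⟨![0, 1, 0], ⟨?_, 1, by simp⟩, ?_⟩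
  · rw [Projective.Point.zero_point, comp_fin3]; simp
  · rw [comp_fin3]; simp

lemma Reduces.neg (hc : Reduces a b P c) :
    Reduces a b (-P)
      ((shortCurve (PadicInt.toZModPow 2 a) (PadicInt.toZModPow 2 b)).toProjective.negMap c) := by
  obtain ⟨v, hv, rfl⟩ := hc
  refine ⟨(shortCurve a b).toProjective.neg v, ⟨?_, ?_⟩, ?_⟩
  · rw [Projective.Point.neg_point, hv.1, negMap_eq, ← shortCurve_map]
    exact congrArg _ (Projective.map_neg _ v)
  · obtain ⟨i, hi⟩ := hv.2
    refine ⟨i, ?_⟩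
    fin_cases i
    · exact hi
    · simpa [Projective.neg, negY, shortCurve] using hi
    · exact hi
  · rw [negMap_eq, ← shortCurve_map]
    exact congrArg _ (Projective.map_neg _ v)

lemma Reduces.mem (hc : Reduces a b P c) :
    ∃ v : Fin 3 → ZMod (p ^ 2), (⟦v⟧ : PointClass _) = c ∧ IsPrimitive v ∧
      (shortCurve (PadicInt.toZModPow 2 a) (PadicInt.toZModPow 2 b)).toProjective.Equation v := by
  obtain ⟨v, hv, rfl⟩ := hc
  refine ⟨_, rfl, (isPrimitive_map _ v).mpr hv.2, ?_⟩
  rw [← shortCurve_map]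
  exact hv.equation.map _

lemma exists_reduces (hE : (shortCurve a b).IsElliptic)
    (c : Point (PadicInt.toZModPow 2 a) (PadicInt.toZModPow 2 b)) :
    ∃ P, Reduces a b P c.1 := by
  obtain ⟨w, hw, hwp, hwe⟩ := c.2
  obtain ⟨v, hv, hve, rfl⟩ := exists_lift hE w hwp hwe
  have hE' := isElliptic_map (algebraMap ℤ_[p] ℚ_[p]) hE
  have hns : (shortCurve (algebraMap ℤ_[p] ℚ_[p] a)
      (algebraMap ℤ_[p] ℚ_[p] b)).toProjective.Nonsingular (algebraMap ℤ_[p] ℚ_[p] ∘ v) := by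
    refine nonsingular_short ?_ ?_
    · rw [← shortCurve_map]
      exact hve.map _
    · obtain ⟨i, hi⟩ := hv
      intro h
      have h1 := congrFun h i
      simp only [Function.comp_apply, Pi.zero_apply, map_eq_zero_iff _ algebraMap_inj] at h1
      rw [h1] at hi
      exact not_isUnit_zero hi
  exact ⟨⟨(nonsingularLift_iff _).mpr hns⟩, v, ⟨rfl, hv⟩, hw.symm⟩

/-- Every smooth curve over `ℤ/p²` lifts to `ℤ_p`. -/
lemma exists_curve_lift {A B : ZMod (p ^ 2)} (hE : (shortCurve A B).IsElliptic) :
    ∃ a b : ℤ_[p], PadicInt.toZModPow 2 a = A ∧ PadicInt.toZModPow 2 b = B ∧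
      (shortCurve a b).IsElliptic := by
  obtain ⟨a, rfl⟩ := toZModPow_surjective 2 A
  obtain ⟨b, rfl⟩ := toZModPow_surjective 2 B
  refine ⟨a, b, rfl, rfl, ⟨?_⟩⟩
  have := hE.isUnit
  rw [← shortCurve_map, map_Δ] at this
  exact isUnit_of_map_unit _ _ this

lemma exists_reduction {A B : ZMod (p ^ 2)} (hE : (shortCurve A B).IsElliptic) :
    ∃ a b : ℤ_[p], PadicInt.toZModPow 2 a = A ∧ PadicInt.toZModPow 2 b = B ∧
      (shortCurve a b).IsElliptic ∧
      (∀ c : Point A B, ∃ P, Reduces a b P c.1) := by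
  obtain ⟨a, b, rfl, rfl, h⟩ := exists_curve_lift hE
  exact ⟨a, b, rfl, rfl, h, exists_reduces h⟩

/-- Addition in `E_{A,B}(ℤ/p²)`, for a unit discriminant, given by the complete system of addition
laws. -/
noncomputable instance instAddPoint {A B : ZMod (p ^ 2)} [hE : (shortCurve A B).IsElliptic] :
    Add (Point A B) where
  add P Q := ⟨addClass A B P.1 Q.1, by
    obtain ⟨a, b, rfl, rfl, h, hs⟩ := exists_reduction hE
    obtain ⟨P', hP⟩ := hs P
    obtain ⟨Q', hQ⟩ := hs Q
    exact (hP.add h hQ).mem⟩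

/-- The zero of `E_{A,B}(ℤ/p²)` is the point at infinity. -/
instance instZeroPoint {A B : ZMod (p ^ 2)} : Zero (Point A B) := ⟨infinity A B⟩

/-- Negation in `E_{A,B}(ℤ/p²)` is `[X : Y : Z] ↦ [X : -Y : Z]`. -/
instance instNegPoint {A B : ZMod (p ^ 2)} [hE : (shortCurve A B).IsElliptic] :
    Neg (Point A B) where
  neg P := ⟨(shortCurve A B).toProjective.negMap P.1, by
    obtain ⟨a, b, rfl, rfl, h, hs⟩ := exists_reduction hE
    obtain ⟨P', hP⟩ := hs P
    exact hP.neg.mem⟩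

/-- The group `E_{A,B}(ℤ/p²)`, for a unit discriminant. -/
noncomputable instance instAddCommGroupPoint {A B : ZMod (p ^ 2)}
    [hE : (shortCurve A B).IsElliptic] : AddCommGroup (Point A B) where
  nsmul := nsmulRec
  zsmul := zsmulRec
  add_assoc P Q S := by
    obtain ⟨a, b, rfl, rfl, h, hs⟩ := exists_reduction hE
    obtain ⟨P', hP⟩ := hs P
    obtain ⟨Q', hQ⟩ := hs Q
    obtain ⟨S', hS⟩ := hs S
    have h1 := (hP.add h hQ).add h hS
    rw [add_assoc] at h1
    exact Subtype.ext (h1.unique (hP.add h (hQ.add h hS)))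
  zero_add P := by
    obtain ⟨a, b, rfl, rfl, h, hs⟩ := exists_reduction hE
    obtain ⟨P', hP⟩ := hs P
    have h1 := Reduces.zero.add h hP
    rw [zero_add] at h1
    exact Subtype.ext (h1.unique hP)
  add_zero P := by
    obtain ⟨a, b, rfl, rfl, h, hs⟩ := exists_reduction hE
    obtain ⟨P', hP⟩ := hs P
    have h1 := hP.add h Reduces.zero
    rw [add_zero] at h1
    exact Subtype.ext (h1.unique hP)
  neg_add_cancel P := by
    obtain ⟨a, b, rfl, rfl, h, hs⟩ := exists_reduction hE
    obtain ⟨P', hP⟩ := hs P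
    have h1 := hP.neg.add h hP
    rw [neg_add_cancel] at h1
    exact Subtype.ext (h1.unique Reduces.zero)
  add_comm P Q := by
    obtain ⟨a, b, rfl, rfl, h, hs⟩ := exists_reduction hE
    obtain ⟨P', hP⟩ := hs P
    obtain ⟨Q', hQ⟩ := hs Q
    have h1 := hP.add h hQ
    rw [add_comm] at h1
    exact Subtype.ext (h1.unique (hQ.add h hP))

end Padic

end PointsOverLocalRings

open scoped TensorProduct in
/-- The `p`-rank `dim_{𝔽_p} (M ⊗ 𝔽_p)` of an abelian group `M`. -/
noncomputable def pRank (p : ℕ) [Fact p.Prime] (M : Type*) [AddCommGroup M] : ℕ :=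
  Module.finrank (ZMod p) (ZMod p ⊗[ℤ] M)

/-- The set `𝔄_p` of pairs `(A, B)` modulo `p²` whose discriminant is a unit and for which the group
`E_{A,B}(ℤ/p²)` has `p`-rank `2`. (It is empty if `p` is not prime.) -/
def frakA (p : ℕ) : Set (ZMod (p ^ 2) × ZMod (p ^ 2)) :=
  {m | ∃ (_ : Fact p.Prime) (_ : (shortCurve m.1 m.2).IsElliptic), pRank p (Point m.1 m.2) = 2}

/-- `P(Y) = ∑_{p ≤ Y} #𝔄_p / p⁴`, the sum over primes. -/
noncomputable def mainTerm (Y : ℝ) : ℝ :=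
  ∑ p ∈ (Finset.range (⌊Y⌋₊ + 1)).filter Nat.Prime, ((frakA p).ncard : ℝ) / (p : ℝ) ^ 4

open WeierstrassCurve in
/-- Good reduction at `p`: some Weierstrass model over `ℚ_p` of the curve is minimal with unit
discriminant. A singular cubic has good reduction at no prime. -/
def HasGoodReductionAt (E : WeierstrassCurve ℚ) (p : ℕ) [Fact p.Prime] : Prop :=
  ∃ C : VariableChange ℚ_[p], HasGoodReduction ℤ_[p] (C • (E.baseChange ℚ_[p]))

/-- The set `Π_{lt,E}` of local torsion primes: the primes `p` of good reduction such that `E(ℚ_p)`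
contains a point of order `p`. -/
def localTorsionPrimes (E : WeierstrassCurve ℚ) : Set ℕ :=
  {p | ∃ _ : Fact p.Prime, HasGoodReductionAt E p ∧
    ∃ P : (E.baseChange ℚ_[p]).toProjective.Point, P ≠ 0 ∧ p • P = 0}

/-- `#Π_{lt,E}(Y)`. -/
noncomputable def localTorsionCount (E : WeierstrassCurve ℚ) (Y : ℝ) : ℕ :=
  {p ∈ localTorsionPrimes E | (p : ℝ) ≤ Y}.ncard

/-- The curve `E_{a,b} : y² = x³ + a x + b` over `ℚ`, for a pair of integers `m = (a, b)`. -/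
def curve (m : ℤ × ℤ) : WeierstrassCurve ℚ := shortCurve (m.1 : ℚ) (m.2 : ℚ)

/-- The inequality `|#Π_{lt,E_{a,b}}(Y) - P(Y)| < β √P(Y)`, for `m = (a, b)`. -/
def IsTypical (Y β : ℝ) (m : ℤ × ℤ) : Prop :=
  |(localTorsionCount (curve m) Y : ℝ) - mainTerm Y| < β * √(mainTerm Y)

/-- The set `𝓢_{C,D}` of pairs of integers `(a, b)` with `|a| < C` and `|b| < D`. -/
def box (C D : ℝ) : Set (ℤ × ℤ) := {m | |(m.1 : ℝ)| < C ∧ |(m.2 : ℝ)| < D}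

/-- The set `𝓠^β_{C,D}` of exceptional pairs in the box. -/
def exceptional (Y β C D : ℝ) : Set (ℤ × ℤ) := {m ∈ box C D | ¬ IsTypical Y β m}

/-- The set `𝓔` of isomorphism classes of elliptic curves over `ℚ`, each represented by its unique
minimal equation `y² = x³ + a x + b`: the integers `a`, `b` are such that the discriminant is nonzero
and there is no prime `ℓ` with `ℓ⁴ ∣ a` and `ℓ⁶ ∣ b`. -/
def ellipticCurves : Set (ℤ × ℤ) :=
  {m | (curve m).Δ ≠ 0 ∧ ∀ l : ℕ, l.Prime → ¬ ((l : ℤ) ^ 4 ∣ m.1 ∧ (l : ℤ) ^ 6 ∣ m.2)}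

/-- The height `max (|a|³, b²)`. -/
def height (m : ℤ × ℤ) : ℤ := max (|m.1| ^ 3) (m.2 ^ 2)

/-- The lower density of a set of elliptic curves over `ℚ`, ordered by height. -/
noncomputable def lowerDensity (S : Set (ℤ × ℤ)) : ℝ :=
  Filter.liminf (fun x : ℝ =>
    ({m ∈ S ∩ ellipticCurves | (height m : ℝ) < x}.ncard : ℝ)
      / ({m ∈ ellipticCurves | (height m : ℝ) < x}.ncard : ℝ)) Filter.atTop

end LocalTorsion

/-! The theorem is a second moment (Turán, Chebyshev) argument. Write `δ_p = #𝔄_p / p⁴`. For `p ≥ 5`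
not dividing both `a` and `b`, the prime `p` is a local torsion prime of `E_{a,b}` exactly when `(a,
b)` modulo `p²` lies in `𝔄_p` (`mem_localTorsionPrimes_iff`). In a box with sides beyond `Y⁴` the
conditions at two primes `p, q ≤ Y` are nearly independent by the Chinese remainder theorem, because
`p²q² ≤ Y⁴`. The diagonal of the variance is `O(P(Y))`; the covariances add up to `O((∑ δ_p p²)² /
Y⁴)`. The trivial bound `δ_p ≤ 1` does not make this `O(1)`, but `#𝔄_p ≤ p³` does, since then `∑ δ_p
p² = O(Y²)`. Primes below `5` and primes dividing both coefficients contribute a bounded second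
moment, and bounded terms are absorbed because the positive values of `P(Y)` are bounded below.
Minimal equations fill a positive proportion of each large box, so the box estimate gives the
density statement.

Two arithmetic facts carry this. The first is `pRank_eq_two_iff`: the filtration of `E(ℚ_p)` by
congruence to the origin has steps of index `p`, on which multiplication by `p` behaves like `x ↦ p
x`. So `E(ℤ/p²)` has rank `2` exactly when some point outside the kernel of reduction is `p`-torsion
modulo `p²`, and such a point can be corrected step by step to a genuine torsion point.

The second is `ncard_frakA_le`: among the `p²` lifts of a curve over `𝔽_p` to `ℤ/p²` at most `p` lie
in `𝔄_p`. A point `T` of order `p` yields a function `f = u + v y` with divisor `p(T - O)`, hence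
with norm `-(X - ξ)^p`. Modulo `p` this function is unique, and moving `ξ` by a multiple of `p`
changes `(X - ξ)^p` only modulo `p²`. Comparing two lifts to first order, and using that `df / f` is
a nonzero multiple of `dx / y` in characteristic `p`, forces their difference to be proportional to
`(2a, 3b)`, the tangent direction of the scaling `(λ⁴a, λ⁶b)` (`deformation_of_torsion`). -/

namespace LocalTorsion

/-! ### The filtration of `E(ℚ_p)` by congruence to the origin, and lifting of torsion. -/

section Reduction

open WeierstrassCurve WeierstrassCurve.Projective

section Field

variable {F : Type*} [Field F] {a b : F}

lemma isPrimitive_iff_ne_zero {v : Fin 3 → F} : IsPrimitive v ↔ v ≠ 0 := by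
  simp [IsPrimitive, Function.ne_iff]

/-- Over a field, `addRep` represents the sum. -/
lemma addRep_equiv_add [(shortCurve a b).IsElliptic] {v w : Fin 3 → F}
    (hv : (shortCurve a b).toProjective.Nonsingular v)
    (hw : (shortCurve a b).toProjective.Nonsingular w) :
    addRep a b v w ≈ (shortCurve a b).toProjective.add v w := by
  by_cases h : IsPrimitive ((shortCurve a b).toProjective.addXYZ v w)
  -- The chord law vanishes on proportional triples, so a primitive value excludes that case.
  · rw [addRep, if_pos h, add_of_not_equiv]
    rintro ⟨s, rfl⟩
    rw [isPrimitive_iff_ne_zero] at h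
    apply h
    have h2 := addXYZ_smul (W' := (shortCurve a b).toProjective) w w (s : F) 1
    rw [one_smul, addXYZ_self] at h2
    refine h2.trans ?_
    simp
  · rw [addRep, if_neg h]
    rw [isPrimitive_iff_ne_zero, not_not] at h
    exact secondLaw_equiv_add hv hw (secondLaw_ne_zero hv hw h)

end Field

variable {p : ℕ} [Fact p.Prime] {a b : ℤ_[p]}

/-- The group `E_{a,b}(ℚ_p)` for `a b : ℤ_p`. -/
abbrev PadicPoint (a b : ℤ_[p]) : Type :=
  (shortCurve (algebraMap ℤ_[p] ℚ_[p] a) (algebraMap ℤ_[p] ℚ_[p] b)).toProjective.Point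

variable {P Q : PadicPoint a b}

lemma isUnit_of_dvd_sub {x y : ℤ_[p]} (h : (p : ℤ_[p]) ∣ x - y) (hy : IsUnit y) : IsUnit x := by
  rw [isUnit_iff_toZMod] at hy ⊢
  have : PadicInt.toZMod (x - y) = 0 := by
    rw [← RingHom.mem_ker, PadicInt.ker_toZMod, PadicInt.maximalIdeal_eq_span_p,
      Ideal.mem_span_singleton]
    exact h
  rw [map_sub, sub_eq_zero] at this
  rwa [this]

lemma toZMod_eq_zero_iff (x : ℤ_[p]) : PadicInt.toZMod x = 0 ↔ (p : ℤ_[p]) ∣ x := by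
  rw [← RingHom.mem_ker, PadicInt.ker_toZMod, PadicInt.maximalIdeal_eq_span_p,
      Ideal.mem_span_singleton]

lemma isLocalHom_toZModPow {n : ℕ} (hn : n ≠ 0) :
    IsLocalHom (PadicInt.toZModPow n : ℤ_[p] →+* ZMod (p ^ n)) := by
  constructor
  intro x hx
  obtain ⟨y, hy⟩ := toZModPow_surjective n (hx.unit⁻¹ : (ZMod (p ^ n))ˣ).val
  have h : PadicInt.toZModPow n (x * y - 1) = 0 := by
    rw [map_sub, map_mul, hy, map_one, sub_eq_zero]
    exact hx.mul_val_inv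
  rw [toZModPow_eq_zero_iff] at h
  exact isUnit_of_mul_isUnit_left
    (isUnit_of_dvd_sub ((dvd_pow_self _ hn).trans h) isUnit_one)

lemma toZModPow_comp_eq_iff {n : ℕ} {v w : Fin 3 → ℤ_[p]} :
    PadicInt.toZModPow n ∘ v = PadicInt.toZModPow n ∘ w ↔ ∀ i, (p : ℤ_[p]) ^ n ∣ v i - w i := by
  simp [funext_iff, ← toZModPow_eq_zero_iff, sub_eq_zero]

lemma Rep.neg {v : Fin 3 → ℤ_[p]} (hc : Rep a b P v) :
    Rep a b (-P) ((shortCurve a b).toProjective.neg v) := by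
  refine ⟨?_, ?_⟩
  · rw [Projective.Point.neg_point, hc.1, negMap_eq, ← shortCurve_map]
    exact congrArg _ (Projective.map_neg _ v)
  · obtain ⟨i, hi⟩ := hc.2
    refine ⟨i, ?_⟩
    fin_cases i
    · exact hi
    · simpa [Projective.neg, negY, shortCurve] using hi
    · exact hi

lemma Rep.smul {v : Fin 3 → ℤ_[p]} (hc : Rep a b P v) (u : ℤ_[p]ˣ) : Rep a b P (u • v) := by
  refine ⟨?_, (isPrimitive_smul u.isUnit v).mpr hc.2⟩
  rw [hc.1]
  refine (Quotient.sound ⟨Units.map (algebraMap ℤ_[p] ℚ_[p]).toMonoidHom u, ?_⟩ : (⟦_⟧ : PointClass _) = ⟦_⟧).symm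
  funext i
  exact (map_mul (algebraMap ℤ_[p] ℚ_[p]) (u : ℤ_[p]) (v i)).symm

lemma Rep.zero : Rep a b 0 ![0, 1, 0] := by
  refine ⟨?_, 1, by simp⟩
  rw [Projective.Point.zero_point, comp_fin3]; simp

lemma Rep.eq_of_rep {v : Fin 3 → ℤ_[p]} (hP : Rep a b P v) (hQ : Rep a b Q v) : P = Q :=
  Projective.Point.ext (hP.1.trans hQ.1.symm)

lemma algebraMap_comp_ne_zero {v : Fin 3 → ℤ_[p]} (h : IsPrimitive v) :
    algebraMap ℤ_[p] ℚ_[p] ∘ v ≠ 0 := by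
  obtain ⟨i, hi⟩ := h
  intro h
  have h1 := congrFun h i
  simp only [Function.comp_apply, Pi.zero_apply, map_eq_zero_iff _ algebraMap_inj] at h1
  rw [h1] at hi
  exact not_isUnit_zero hi

lemma exists_point_of_rep (hE : (shortCurve a b).IsElliptic) {v : Fin 3 → ℤ_[p]}
    (h : IsPrimitive v) (hv : (shortCurve a b).toProjective.Equation v) :
    ∃ P : PadicPoint a b, Rep a b P v := by
  have hE' := isElliptic_map (algebraMap ℤ_[p] ℚ_[p]) hE
  have hns : (shortCurve (algebraMap ℤ_[p] ℚ_[p] a)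
      (algebraMap ℤ_[p] ℚ_[p] b)).toProjective.Nonsingular (algebraMap ℤ_[p] ℚ_[p] ∘ v) := by
    refine nonsingular_short ?_ (algebraMap_comp_ne_zero h)
    rw [← shortCurve_map]
    exact hv.map _
  exact ⟨⟨(nonsingularLift_iff _).mpr hns⟩, rfl, h⟩

lemma Rep.secondLaw {v w : Fin 3 → ℤ_[p]} (hv : Rep a b P v) (hw : Rep a b Q w)
    (h : IsPrimitive (secondLaw a b v w)) : Rep a b (P + Q) (secondLaw a b v w) := by
  refine ⟨?_, h⟩
  rw [Projective.Point.add_point, hv.1, hw.1, addMap_eq, ← secondLaw_map]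
  refine (Quotient.sound (secondLaw_equiv_add hv.nonsingular hw.nonsingular ?_)).symm
  rw [secondLaw_map]
  exact algebraMap_comp_ne_zero h

/-- Congruence of points of `E(ℚ_p)` modulo `p ^ n`. -/
def Cong (n : ℕ) (P Q : PadicPoint a b) : Prop :=
  ∃ v w, Rep a b P v ∧ Rep a b Q w ∧ ∀ i, (p : ℤ_[p]) ^ n ∣ v i - w i

lemma Cong.refl (n : ℕ) (P : PadicPoint a b) : Cong n P P := by
  obtain ⟨v, hv⟩ := exists_rep P
  exact ⟨v, v, hv, hv, by simp⟩

lemma Cong.add (hE : (shortCurve a b).IsElliptic) {n : ℕ} (hn : n ≠ 0) {P P' Q Q' : PadicPoint a b}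
    (h : Cong n P P') (h' : Cong n Q Q') : Cong n (P + Q) (P' + Q') := by
  obtain ⟨v, w, hv, hw, hvw⟩ := h
  obtain ⟨v', w', hv', hw', hvw'⟩ := h'
  refine ⟨_, _, hv.add hE hv', hw.add hE hw', ?_⟩
  rw [← toZModPow_comp_eq_iff] at hvw hvw' ⊢
  have := isLocalHom_toZModPow (p := p) hn
  rw [← addRep_map, ← addRep_map, hvw, hvw']

lemma Cong.neg {n : ℕ} {P P' : PadicPoint a b} (h : Cong n P P') : Cong n (-P) (-P') := by
  obtain ⟨v, w, hv, hw, hvw⟩ := h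
  refine ⟨_, _, hv.neg, hw.neg, fun i => ?_⟩
  fin_cases i
  · exact hvw 0
  · simpa [Projective.neg, negY, shortCurve, neg_add_eq_sub, dvd_sub_comm] using hvw 1
  · exact hvw 2

/-- The kernel of reduction modulo `p ^ (n + 1)` on `E(ℚ_p)`. -/
def redKer (a b : ℤ_[p]) (hE : (shortCurve a b).IsElliptic) (n : ℕ) :
    AddSubgroup (PadicPoint a b) where
  carrier := {P | Cong (n + 1) P 0}
  zero_mem' := Cong.refl _ 0
  add_mem' {P Q} hP hQ := by
    have := Cong.add hE n.succ_ne_zero hP hQ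
    rwa [add_zero] at this
  neg_mem' {P} hP := by
    have := Cong.neg hP
    rwa [neg_zero] at this

lemma mem_redKer {hE : (shortCurve a b).IsElliptic} {n : ℕ} :
    P ∈ redKer a b hE n ↔ Cong (n + 1) P 0 := Iff.rfl

lemma sub_mem_redKer_iff {hE : (shortCurve a b).IsElliptic} {n : ℕ} :
    P - Q ∈ redKer a b hE n ↔ Cong (n + 1) P Q := by
  rw [mem_redKer]
  constructor
  · intro h
    have := h.add hE n.succ_ne_zero (Cong.refl _ Q)
    rwa [sub_add_cancel, zero_add] at this
  · intro h
    have := h.add hE n.succ_ne_zero (Cong.refl _ (-Q))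
    rwa [add_neg_cancel, ← sub_eq_add_neg] at this

/-- `x` is the value at `P` of the local parameter `X / Y` at the origin, for a point `P` that
reduces to the origin modulo `p`. -/
def IsParam (P : PadicPoint a b) (x : ℤ_[p]) : Prop :=
  ∃ z, (p : ℤ_[p]) ∣ x ∧ (p : ℤ_[p]) ∣ z ∧ Rep a b P ![x, 1, z]

/-- The equation reads `x³ = z (1 - a x z - b z²)` with a unit as second factor. Hence `x` alone
measures the distance to the origin. -/
lemma cube_dvd_of_equation {x z : ℤ_[p]} (hz : (p : ℤ_[p]) ∣ z)
    (h : (shortCurve a b).toProjective.Equation ![x, 1, z]) : x ^ 3 ∣ z := by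
  rw [equation_short] at h
  simp at h
  have hu : IsUnit (1 - a * x * z - b * z ^ 2) :=
    isUnit_of_dvd_sub (y := 1) (by
      have : 1 - a * x * z - b * z ^ 2 - 1 = z * (- a * x - b * z) := by ring
      rw [this]
      exact hz.mul_right _) isUnit_one
  have : x ^ 3 = z * (1 - a * x * z - b * z ^ 2) := by linear_combination -h
  rw [this]
  exact hu.mul_right_dvd.mpr dvd_rfl

lemma mem_redKer_iff_param {hE : (shortCurve a b).IsElliptic} {n : ℕ} :
    P ∈ redKer a b hE n ↔ ∃ x, IsParam P x ∧ (p : ℤ_[p]) ^ (n + 1) ∣ x := by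
  rw [mem_redKer]
  constructor
  · rintro ⟨v, w, hv, hw, hvw⟩
    obtain ⟨u, rfl⟩ := hw.unique Rep.zero
    have h0 := hvw 0
    have h1 := hvw 1
    have h2 := hvw 2
    simp [Units.smul_def] at h0 h1 h2
    have hp : (p : ℤ_[p]) ∣ p ^ (n + 1) := dvd_pow_self _ n.succ_ne_zero
    have hu : IsUnit (v 1) := isUnit_of_dvd_sub (hp.trans h1) u.isUnit
    have hr := hv.smul hu.unit⁻¹
    have he : hu.unit⁻¹ • v = ![((hu.unit⁻¹ : ℤ_[p]ˣ) : ℤ_[p]) * v 0, 1,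
        ((hu.unit⁻¹ : ℤ_[p]ˣ) : ℤ_[p]) * v 2] := by
      funext i
      fin_cases i
      · rfl
      · simp [Units.smul_def]
      · rfl
    rw [he] at hr
    exact ⟨_, ⟨_, (hp.trans h0).mul_left _, (hp.trans h2).mul_left _, hr⟩, h0.mul_left _⟩
  · rintro ⟨x, ⟨z, hx, hz, h⟩, hn⟩
    refine ⟨_, _, h, Rep.zero, fun i => ?_⟩
    fin_cases i
    · simpa using hn
    · simp
    · simpa using (hn.trans (dvd_pow_self _ three_ne_zero)).trans (cube_dvd_of_equation hz h.equation)

lemma IsParam.unique {x y : ℤ_[p]} (hx : IsParam P x) (hy : IsParam P y) : x = y := by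
  obtain ⟨z, -, -, hx⟩ := hx
  obtain ⟨w, -, -, hy⟩ := hy
  obtain ⟨u, hu⟩ := hx.unique hy
  have h1 := congrFun hu 1
  have h0 := congrFun hu 0
  simp [Units.smul_def] at h1 h0
  rw [← h0, h1]
  simp

lemma IsParam.eq_zero (h : IsParam P 0) : P = 0 := by
  obtain ⟨z, -, hz, h⟩ := h
  have := cube_dvd_of_equation hz h.equation
  simp at this
  subst this
  exact h.eq_of_rep Rep.zero

lemma IsParam.zero : IsParam (0 : PadicPoint a b) 0 := ⟨0, by simp, by simp, Rep.zero⟩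

lemma IsParam.neg {x : ℤ_[p]} (h : IsParam P x) : IsParam (-P) (-x) := by
  obtain ⟨z, hx, hz, h⟩ := h
  refine ⟨-z, (dvd_neg).mpr hx, (dvd_neg).mpr hz, ?_⟩
  have := h.neg.smul (-1)
  convert this using 1
  funext i
  fin_cases i <;> simp [Projective.neg, negY, shortCurve]

/-- Hensel's lemma solves `z = x³ + a x z² + b z³` for `z`, starting from `0`, where the derivative
is `1`. -/
lemma exists_param (hE : (shortCurve a b).IsElliptic) {x : ℤ_[p]} (hx : (p : ℤ_[p]) ∣ x) :
    ∃ P : PadicPoint a b, IsParam P x := by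
  obtain ⟨z, hz, hzt, -, -⟩ := hensels_lemma
    (F := (.X - .C (x ^ 3) - .C (a * x) * .X ^ 2 - .C b * .X ^ 3 : Polynomial ℤ_[p]))
    (a := (0 : ℤ_[p])) (by
      have : ‖x‖ < 1 := PadicInt.mem_nonunits.mp
        (fun h => PadicInt.p_nonunit (isUnit_of_dvd_unit hx h))
      simp [Polynomial.derivative_pow]
      exact pow_lt_one₀ (norm_nonneg _) this three_ne_zero)
  simp [Polynomial.derivative_pow] at hz hzt
  have hpz : (p : ℤ_[p]) ∣ z := by
    rw [← Ideal.mem_span_singleton, ← PadicInt.maximalIdeal_eq_span_p, IsLocalRing.mem_maximalIdeal]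
    exact PadicInt.mem_nonunits.mpr hzt
  obtain ⟨P, hP⟩ := exists_point_of_rep hE (v := ![x, 1, z]) ⟨1, by simp⟩ (by
    rw [equation_short]; simp; linear_combination hz)
  exact ⟨P, z, hx, hpz, hP⟩

/-- The formal group law is `x + y` up to terms of order three. The second addition law is used
because its middle coordinate is `1` at the pair of origins, hence a unit near it, while the chord
law degenerates there. -/
lemma IsParam.add {x y : ℤ_[p]} {n : ℕ} (hx : IsParam P x) (hy : IsParam Q y)
    (hxn : (p : ℤ_[p]) ^ (n + 1) ∣ x) (hyn : (p : ℤ_[p]) ^ (n + 1) ∣ y) :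
    ∃ s, IsParam (P + Q) s ∧ (p : ℤ_[p]) ^ (3 * (n + 1)) ∣ s - (x + y) := by
  obtain ⟨z, hx, hz, hP⟩ := hx
  obtain ⟨w, hy, hw, hQ⟩ := hy
  obtain ⟨k, hk⟩ := cube_dvd_of_equation hz hP.equation
  obtain ⟨l, hl⟩ := cube_dvd_of_equation hw hQ.equation
  set q := (p : ℤ_[p]) ^ (n + 1) with hq
  have hpq : (p : ℤ_[p]) ∣ q := dvd_pow_self _ n.succ_ne_zero
  obtain ⟨x, rfl⟩ := hxn
  obtain ⟨y, rfl⟩ := hyn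
  subst hk hl
  -- With `q` factored out, the points are `[q x : 1 : q³ Z]` and `[q y : 1 : q³ W]`, and every
  -- error term is visibly a multiple of `q³`.
  set Z := x ^ 3 * k with hZ
  set W := y ^ 3 * l with hW
  have hz' : (q * x) ^ 3 * k = q ^ 3 * Z := by rw [hZ]; ring
  have hw' : (q * y) ^ 3 * l = q ^ 3 * W := by rw [hW]; ring
  rw [hz'] at hP
  rw [hw'] at hQ
  set e := a * (x * W + y * Z) + 3 * b * q ^ 2 * Z * W with he
  set g := a * x * y + 3 * b * q ^ 2 * (x * W + y * Z) - a ^ 2 * q ^ 4 * Z * W with hg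
  set v := LocalTorsion.secondLaw a b ![q * x, 1, q ^ 3 * Z] ![q * y, 1, q ^ 3 * W] with hv
  obtain ⟨r, hr⟩ : ∃ r, v 1 = 1 + q ^ 3 * r :=
    ⟨(3 * x * y + a * q ^ 4 * Z * W) * q * g - q ^ 5 * e ^ 2, by
      simp only [hv, LocalTorsion.secondLaw, Matrix.cons_val, he, hg]; ring⟩
  obtain ⟨r', hr'⟩ : ∃ r, v 0 = q * x + q * y + q ^ 3 * r :=
    ⟨-(x + y) * q ^ 2 * e - (W + Z) * q ^ 2 * g, by
      simp only [hv, LocalTorsion.secondLaw, Matrix.cons_val, he, hg]; ring⟩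
  have h2 : q ∣ v 2 :=
    ⟨q ^ 2 * (Z + W) * (1 + q ^ 4 * e) + (x + y) * (3 * q ^ 2 * x * y + a * q ^ 6 * Z * W), by
      simp only [hv, LocalTorsion.secondLaw, Matrix.cons_val, he]; ring⟩
  have hu : IsUnit (v 1) := isUnit_of_dvd_sub (y := 1) (by
    rw [hr, add_sub_cancel_left]
    exact (hpq.trans (dvd_pow_self _ three_ne_zero)).mul_right _) isUnit_one
  have hrep := (Rep.secondLaw hP hQ ⟨1, hu⟩).smul hu.unit⁻¹
  set u : ℤ_[p] := ((hu.unit⁻¹ : ℤ_[p]ˣ) : ℤ_[p]) with hu_def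
  have huv : u * v 1 = 1 := by simp [hu_def]
  have hvec : hu.unit⁻¹ • v = ![u * v 0, 1, u * v 2] := by
    funext i
    fin_cases i
    · rfl
    · simp [Units.smul_def]
    · rfl
  rw [← hv, hvec] at hrep
  refine ⟨u * v 0, ⟨u * v 2, ?_, (hpq.trans h2).mul_left _, hrep⟩, ?_⟩
  · rw [hr']
    exact ((hpq.trans ⟨x + y + q ^ 2 * r', by ring⟩)).mul_left _
  · rw [mul_comm 3, pow_mul, ← hq]
    refine ⟨u * (r' - r * (q * x + q * y)), ?_⟩
    rw [hr] at huv
    rw [hr']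
    linear_combination (q * x + q * y) * huv

lemma IsParam.nsmul {x : ℤ_[p]} {n : ℕ} (hx : IsParam P x) (hxn : (p : ℤ_[p]) ^ (n + 1) ∣ x)
    (m : ℕ) : ∃ s, IsParam (m • P) s ∧ (p : ℤ_[p]) ^ (3 * (n + 1)) ∣ s - m * x := by
  induction m with
  | zero => exact ⟨0, by simpa using IsParam.zero, by simp⟩
  | succ m ih =>
    obtain ⟨s, hs, hd⟩ := ih
    have hd' : (p : ℤ_[p]) ^ (n + 1) ∣ s - m * x := (pow_dvd_pow _ (by omega)).trans hd
    have hsn : (p : ℤ_[p]) ^ (n + 1) ∣ s := by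
      have := dvd_add hd' (hxn.mul_left (m : ℤ_[p]))
      rwa [sub_add_cancel] at this
    obtain ⟨t, ht, htd⟩ := hs.add hx hsn hxn
    refine ⟨t, by rwa [succ_nsmul], ?_⟩
    have := dvd_add htd hd
    convert this using 1
    push_cast
    ring

lemma p_ne_zero : (p : ℤ_[p]) ≠ 0 := by exact_mod_cast (Fact.out : p.Prime).ne_zero

/-- The kernel of reduction has no `p`-torsion. -/
lemma eq_zero_of_mem_redKer {hE : (shortCurve a b).IsElliptic} (h : P ∈ redKer a b hE 0)
    (hp : p • P = 0) : P = 0 := by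
  obtain ⟨x, hx, hpx⟩ := mem_redKer_iff_param.mp h
  suffices H : ∀ n : ℕ, (p : ℤ_[p]) ^ (n + 1) ∣ x by
    have : x = 0 := by
      by_contra h0
      have hf : FiniteMultiplicity (p : ℤ_[p]) x :=
        FiniteMultiplicity.of_not_isUnit PadicInt.p_nonunit h0
      exact hf.not_pow_dvd_of_multiplicity_lt (Nat.lt_succ_self _) (H _)
    rw [this] at hx
    exact hx.eq_zero
  intro n
  induction n with
  | zero => exact hpx
  | succ n ih =>
    obtain ⟨s, hs, hd⟩ := hx.nsmul ih p
    rw [hp] at hs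
    obtain rfl := hs.unique IsParam.zero
    rw [zero_sub, dvd_neg] at hd
    -- Here `0 ≡ p x` modulo `p ^ (3 (n + 1))`, and `n + 3 ≤ 3 (n + 1)`, so `x` gains one factor of
    -- `p`.
    have h1 : (p : ℤ_[p]) * p ^ (n + 2) ∣ p * x := by
      rw [← pow_succ']
      exact (pow_dvd_pow _ (by omega)).trans hd
    exact (mul_dvd_mul_iff_left p_ne_zero).mp h1

/-- Multiplication by `p` maps the kernel of reduction modulo `p ^ n` onto the kernel of reduction
modulo `p ^ (n + 1)`, up to the kernel of reduction modulo `p ^ (n + 2)`. -/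
lemma exists_nsmul_sub_mem {hE : (shortCurve a b).IsElliptic} {n : ℕ}
    (h : P ∈ redKer a b hE (n + 1)) :
    ∃ S ∈ redKer a b hE n, P - p • S ∈ redKer a b hE (n + 2) := by
  obtain ⟨x, hx, y, rfl⟩ := mem_redKer_iff_param.mp h
  obtain ⟨S, hS⟩ := exists_param hE (x := p ^ (n + 1) * y)
    ((dvd_pow_self _ n.succ_ne_zero).mul_right _)
  refine ⟨S, mem_redKer_iff_param.mpr ⟨_, hS, dvd_mul_right _ _⟩, ?_⟩
  obtain ⟨s, hs, hd⟩ := hS.nsmul (dvd_mul_right _ _) p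
  have hd' : (p : ℤ_[p]) ^ (n + 2 + 1) ∣ s - p ^ (n + 1 + 1) * y := by
    refine (pow_dvd_pow _ (by omega)).trans ((hd.trans (dvd_of_eq ?_)))
    ring
  have hsn : (p : ℤ_[p]) ^ (n + 1 + 1) ∣ s := by
    have := dvd_add ((pow_dvd_pow _ (by omega : n + 1 + 1 ≤ n + 2 + 1)).trans hd')
      (dvd_mul_right ((p : ℤ_[p]) ^ (n + 1 + 1)) y)
    rwa [sub_add_cancel] at this
  obtain ⟨t, ht, htd⟩ := hx.add hs.neg (dvd_mul_right _ _) ((dvd_neg).mpr hsn)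
  rw [sub_eq_add_neg]
  refine mem_redKer_iff_param.mpr ⟨t, ht, ?_⟩
  have := dvd_sub ((pow_dvd_pow _ (by omega)).trans htd) hd'
  convert this using 1
  ring

lemma redKer_anti (hE : (shortCurve a b).IsElliptic) {m n : ℕ} (h : m ≤ n) :
    redKer a b hE n ≤ redKer a b hE m := by
  rintro P ⟨v, w, hv, hw, hvw⟩
  exact ⟨v, w, hv, hw, fun i => (pow_dvd_pow _ (by omega)).trans (hvw i)⟩

lemma eq_zero_of_forall_mem_redKer {hE : (shortCurve a b).IsElliptic}
    (h : ∀ n, P ∈ redKer a b hE n) : P = 0 := by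
  obtain ⟨x, hx, -⟩ := mem_redKer_iff_param.mp (h 0)
  have : x = 0 := by
    by_contra h0
    have hf : FiniteMultiplicity (p : ℤ_[p]) x :=
      FiniteMultiplicity.of_not_isUnit PadicInt.p_nonunit h0
    obtain ⟨y, hy, hd⟩ := mem_redKer_iff_param.mp (h (multiplicity (p : ℤ_[p]) x))
    obtain rfl := hx.unique hy
    exact hf.not_pow_dvd_of_multiplicity_lt (Nat.lt_succ_self _) hd
  rw [this] at hx
  exact hx.eq_zero

/-- The leading digit `x / p ^ (n + 1)` modulo `p` of the parameter is a surjective homomorphism to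
`ZMod p`, whose kernel is the next step of the filtration. -/
lemma index_redKer (hE : (shortCurve a b).IsElliptic) (n : ℕ) :
    (redKer a b hE (n + 1)).relIndex (redKer a b hE n) = p := by
  have hex : ∀ P : redKer a b hE n, ∃ y, IsParam P.1 ((p : ℤ_[p]) ^ (n + 1) * y) := by
    rintro ⟨P, hP⟩
    obtain ⟨x, hx, y, rfl⟩ := mem_redKer_iff_param.mp hP
    exact ⟨y, hx⟩
  choose y hy using hex
  let f : redKer a b hE n →+ ZMod p := AddMonoidHom.mk' (fun P => PadicInt.toZMod (y P)) (by
    intro P Q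
    obtain ⟨s, hs, hd⟩ := (hy P).add (hy Q) (dvd_mul_right _ _) (dvd_mul_right _ _)
    obtain rfl := hs.unique (hy (P + Q))
    rw [← map_add, ← sub_eq_zero, ← map_sub, toZMod_eq_zero_iff]
    have h1 : (p : ℤ_[p]) ^ (n + 1) * p ∣ p ^ (n + 1) * (y (P + Q) - (y P + y Q)) := by
      rw [← pow_succ]
      refine (pow_dvd_pow _ (by omega)).trans (hd.trans (dvd_of_eq ?_))
      ring
    exact (mul_dvd_mul_iff_left (pow_ne_zero _ p_ne_zero)).mp h1)
  have hf : Function.Surjective f := by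
    intro c
    obtain ⟨t, rfl⟩ := ZMod.ringHom_surjective (PadicInt.toZMod : ℤ_[p] →+* ZMod p) c
    obtain ⟨P, hP⟩ := exists_param hE (x := p ^ (n + 1) * t)
      ((dvd_pow_self _ n.succ_ne_zero).mul_right _)
    refine ⟨⟨P, mem_redKer_iff_param.mpr ⟨_, hP, dvd_mul_right _ _⟩⟩, ?_⟩
    have := (hy ⟨P, mem_redKer_iff_param.mpr ⟨_, hP, dvd_mul_right _ _⟩⟩).unique hP
    exact congrArg PadicInt.toZMod (mul_left_cancel₀ (pow_ne_zero _ p_ne_zero) this)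
  have hk : (redKer a b hE (n + 1)).addSubgroupOf (redKer a b hE n) = f.ker := by
    ext P
    rw [AddSubgroup.mem_addSubgroupOf, mem_redKer_iff_param, AddMonoidHom.mem_ker]
    change _ ↔ PadicInt.toZMod (y P) = 0
    rw [toZMod_eq_zero_iff, ← mul_dvd_mul_iff_left (pow_ne_zero (n + 1) p_ne_zero), ← pow_succ]
    constructor
    · rintro ⟨x, hx, hd⟩
      rwa [← hx.unique (hy P)]
    · exact fun h => ⟨_, hy P, h⟩
  rw [AddSubgroup.relIndex, hk, AddSubgroup.index_ker, AddMonoidHom.range_eq_top.mpr hf]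
  simp

/-- Successive approximation: the defect `p • R` is `p • S` up to the next step for some `S` in the
kernel of reduction, and passing to `R - S` does not change the reduction modulo `p`. -/
lemma exists_seq_torsion {hE : (shortCurve a b).IsElliptic} (hQ : Q ∉ redKer a b hE 0)
    (hp : p • Q ∈ redKer a b hE 1) (n : ℕ) :
    ∃ R : PadicPoint a b, R ∉ redKer a b hE 0 ∧ p • R ∈ redKer a b hE (n + 1) := by
  induction n with
  | zero => exact ⟨Q, hQ, hp⟩
  | succ n ih =>
    obtain ⟨R, hR, hpR⟩ := ih
    obtain ⟨S, hS, hd⟩ := exists_nsmul_sub_mem hpR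
    refine ⟨R - S, fun h => hR ?_, by rwa [nsmul_sub]⟩
    have := add_mem h (redKer_anti hE (Nat.zero_le n) hS)
    rwa [sub_add_cancel] at this

/-- A point that is `p`-torsion modulo `p²` but nonzero modulo `p` gives rise to a point of
order `p`. -/
lemma exists_torsion {hE : (shortCurve a b).IsElliptic} (hQ : Q ∉ redKer a b hE 0)
    (hp : p • Q ∈ redKer a b hE 1) :
    ∃ T : PadicPoint a b, T ∉ redKer a b hE 0 ∧ p • T = 0 := by
  choose R hR hpR using exists_seq_torsion hQ hp
  choose v hv using fun n => exists_rep (R n)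
  -- The approximations need not converge, but `ℤ_p³` is compact; a limit of primitive solutions is
  -- again a primitive solution.
  obtain ⟨w, φ, hφ, hw⟩ := CompactSpace.tendsto_subseq v
  have hclose : ∀ N, ∃ n, N ≤ n ∧ ∀ i, (p : ℤ_[p]) ^ (N + 1) ∣ w i - v n i := by
    intro N
    have h : ∀ i, ∀ᶠ n in Filter.atTop, (p : ℤ_[p]) ^ (N + 1) ∣ w i - v (φ n) i := by
      intro i
      have ht := (tendsto_pi_nhds.mp hw) i
      have hpos : (0 : ℝ) < (p : ℝ) ^ (-((N + 1 : ℕ) : ℤ)) :=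
        zpow_pos (by exact_mod_cast (Fact.out : p.Prime).pos) _
      filter_upwards [(Metric.tendsto_nhds.mp ht) _ hpos] with n hn
      rw [← Ideal.mem_span_singleton, ← PadicInt.norm_le_pow_iff_mem_span_pow, norm_sub_rev]
      exact (dist_eq_norm (v (φ n) i) (w i) ▸ hn).le
    obtain ⟨n, hn, hNn⟩ := ((Filter.eventually_all.mpr h).and (Filter.eventually_ge_atTop N)).exists
    exact ⟨φ n, hNn.trans hφ.le_apply, hn⟩
  have hprim : IsPrimitive w := by
    obtain ⟨n, -, h⟩ := hclose 0
    obtain ⟨i, hi⟩ := (hv n).2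
    exact ⟨i, isUnit_of_dvd_sub (by simpa using h i) hi⟩
  have heq : (shortCurve a b).toProjective.Equation w := by
    have hcont : ∀ i, Filter.Tendsto (fun n => v (φ n) i) Filter.atTop (nhds (w i)) :=
      tendsto_pi_nhds.mp hw
    rw [equation_short]
    refine tendsto_nhds_unique (((hcont 1).pow 2).mul (hcont 2)) ?_
    refine Filter.Tendsto.congr (fun n => (equation_short.mp (hv (φ n)).equation).symm) ?_
    exact (((hcont 0).pow 3).add (((hcont 0).const_mul a).mul ((hcont 2).pow 2))).add
      (((hcont 2).pow 3).const_mul b)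
  obtain ⟨T, hT⟩ := exists_point_of_rep hE hprim heq
  have hsub : ∀ N, ∃ n, N ≤ n ∧ T - R n ∈ redKer a b hE N := by
    intro N
    obtain ⟨n, hn, h⟩ := hclose N
    exact ⟨n, hn, sub_mem_redKer_iff.mpr ⟨w, v n, hT, hv n, h⟩⟩
  refine ⟨T, fun h => ?_, eq_zero_of_forall_mem_redKer (hE := hE) fun N => ?_⟩
  · obtain ⟨n, -, hn⟩ := hsub 0
    apply hR n
    have := sub_mem h hn
    rwa [sub_sub_cancel] at this
  · obtain ⟨n, hn, h⟩ := hsub N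
    have h1 := add_mem (AddSubgroup.nsmul_mem _ h p) (redKer_anti hE (by omega : N ≤ n + 1) (hpR n))
    rwa [nsmul_sub, sub_add_cancel] at h1

/-! ### Reduction modulo `p` -/

/-- The group `E(𝔽_p)` of the reduced curve. -/
abbrev ResiduePoint (a b : ZMod p) : Type := (shortCurve a b).toProjective.Point

lemma Rep.nonsingular_toZMod (hE : (shortCurve a b).IsElliptic) {v : Fin 3 → ℤ_[p]}
    (h : Rep a b P v) :
    (shortCurve (PadicInt.toZMod a) (PadicInt.toZMod b)).toProjective.Nonsingular
      ((PadicInt.toZMod : ℤ_[p] →+* ZMod p) ∘ v) := by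
  have hE' := isElliptic_map (PadicInt.toZMod : ℤ_[p] →+* ZMod p) hE
  obtain ⟨i, hi⟩ := h.2
  refine nonsingular_short ?_ fun h0 => (isUnit_iff_toZMod _).mp hi (congrFun h0 i)
  rw [← shortCurve_map]
  exact h.equation.map _

/-- Reduction modulo `p` on points. -/
noncomputable def redFun (hE : (shortCurve a b).IsElliptic) (P : PadicPoint a b) :
    ResiduePoint (PadicInt.toZMod a) (PadicInt.toZMod b) :=
  ⟨(nonsingularLift_iff _).mpr ((exists_rep P).choose_spec.nonsingular_toZMod hE)⟩

lemma redFun_point (hE : (shortCurve a b).IsElliptic) {v : Fin 3 → ℤ_[p]} (h : Rep a b P v) :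
    (redFun hE P).point = ⟦(PadicInt.toZMod : ℤ_[p] →+* ZMod p) ∘ v⟧ := by
  obtain ⟨u, hu⟩ := (exists_rep P).choose_spec.unique h
  refine Quotient.sound ⟨Units.map (PadicInt.toZMod : ℤ_[p] →+* ZMod p) u, ?_⟩
  rw [← hu]
  funext i
  exact (map_mul (PadicInt.toZMod : ℤ_[p] →+* ZMod p) (u : ℤ_[p]) (v i)).symm

instance isLocalHom_toZMod : IsLocalHom (PadicInt.toZMod : ℤ_[p] →+* ZMod p) :=
  ⟨fun x hx => (isUnit_iff_toZMod x).mpr hx.ne_zero⟩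

/-- Reduction modulo `p` as a homomorphism. -/
noncomputable def redHom (hE : (shortCurve a b).IsElliptic) :
    PadicPoint a b →+ ResiduePoint (PadicInt.toZMod a) (PadicInt.toZMod b) :=
  AddMonoidHom.mk' (redFun hE) (by
    intro P Q
    obtain ⟨v, hv⟩ := exists_rep P
    obtain ⟨w, hw⟩ := exists_rep Q
    have hE' := isElliptic_map (PadicInt.toZMod : ℤ_[p] →+* ZMod p) hE
    refine Projective.Point.ext ?_
    rw [redFun_point hE (hv.add hE hw), Projective.Point.add_point, redFun_point hE hv,
      redFun_point hE hw, addMap_eq, ← addRep_map]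
    exact Quotient.sound (addRep_equiv_add (hv.nonsingular_toZMod hE) (hw.nonsingular_toZMod hE)))

lemma redHom_point (hE : (shortCurve a b).IsElliptic) {v : Fin 3 → ℤ_[p]} (h : Rep a b P v) :
    (redHom hE P).point = ⟦(PadicInt.toZMod : ℤ_[p] →+* ZMod p) ∘ v⟧ :=
  redFun_point hE h

lemma ker_redHom (hE : (shortCurve a b).IsElliptic) : (redHom hE).ker = redKer a b hE 0 := by
  ext P
  rw [AddMonoidHom.mem_ker, mem_redKer]
  constructor
  · intro h
    obtain ⟨v, hv⟩ := exists_rep P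
    have h1 := redHom_point hE hv
    rw [h, Projective.Point.zero_point] at h1
    obtain ⟨u, hu⟩ := Quotient.exact h1
    obtain ⟨s, hs⟩ := ZMod.ringHom_surjective (PadicInt.toZMod : ℤ_[p] →+* ZMod p) u
    have hsu : IsUnit s := (isUnit_iff_toZMod s).mpr (by rw [hs]; exact u.ne_zero)
    refine ⟨_, _, hv.smul hsu.unit, Rep.zero, fun i => ?_⟩
    rw [zero_add, pow_one, ← toZMod_eq_zero_iff, map_sub, sub_eq_zero]
    have := congrFun hu i
    simp only [Units.smul_def, Pi.smul_apply, smul_eq_mul, Function.comp_apply, map_mul,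
      IsUnit.unit_spec, hs] at this ⊢
    rw [this]
    fin_cases i <;> simp
  · rintro ⟨v, w, hv, hw, hvw⟩
    refine Projective.Point.ext ?_
    rw [redHom_point hE hv, ← map_zero (redHom hE), redHom_point hE hw]
    congr 1
    funext i
    have := hvw i
    rwa [zero_add, pow_one, ← toZMod_eq_zero_iff, map_sub, sub_eq_zero] at this

end Reduction

/-! ### Rank `2` modulo `p²` is equivalent to `p`-torsion over `ℚ_p`. -/

section Rank

open WeierstrassCurve WeierstrassCurve.Projective

-- `M ⊗ 𝔽_p` is `M / pM`, and in a finite group the index of `pM` equals the order of the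
-- `p`-torsion.
open scoped TensorProduct in
lemma pow_pRank (p : ℕ) [Fact p.Prime] (M : Type*) [AddCommGroup M] [Finite M] :
    p ^ pRank p M = Nat.card (nsmulAddMonoidHom p : M →+ M).ker := by
  let e : (ZMod p ⊗[ℤ] M) ≃ₗ[ℤ] (M ⧸ (Ideal.span {(p : ℤ)} • (⊤ : Submodule ℤ M))) :=
    (TensorProduct.congr (Int.quotientSpanNatEquivZMod p).symm.toAddEquiv.toIntLinearEquiv
      (LinearEquiv.refl ℤ M)).trans (TensorProduct.quotTensorEquivQuotSMul M (Ideal.span {(p : ℤ)}))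
  have hq : Finite (M ⧸ (Ideal.span {(p : ℤ)} • (⊤ : Submodule ℤ M))) :=
    Finite.of_surjective _ (Submodule.mkQ_surjective _)
  have hfin : Finite (ZMod p ⊗[ℤ] M) := Finite.of_equiv _ e.symm.toEquiv
  have h1 : Nat.card (ZMod p ⊗[ℤ] M) = p ^ pRank p M := by
    rw [Module.natCard_eq_pow_finrank (K := ZMod p), Nat.card_zmod, pRank]
  have h2 : (Ideal.span {(p : ℤ)} • (⊤ : Submodule ℤ M)).toAddSubgroup
      = (nsmulAddMonoidHom p : M →+ M).range := by
    ext x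
    rw [Submodule.mem_toAddSubgroup, Submodule.ideal_span_singleton_smul,
      Submodule.mem_smul_pointwise_iff_exists]
    simp
  have h3 := AddSubgroup.index_range (f := (nsmulAddMonoidHom p : M →+ M))
  rw [← h1, ← h3, ← h2, Nat.card_congr e.toEquiv]
  rfl

lemma natCard_eq_one_or_prime {p : ℕ} [Fact p.Prime] {A : Type*} [AddCommGroup A] [Finite A]
    (hA : Nat.card A < p ^ 2) (H : AddSubgroup A) (hH : ∀ x ∈ H, p • x = 0) :
    Nat.card H = 1 ∨ Nat.card H = p := by
  let _ : Module (ZMod p) H := AddCommGroup.zmodModule (fun x => Subtype.ext (hH x x.2))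
  have h1 : Nat.card H = p ^ Module.finrank (ZMod p) H :=
    (FiniteField.pow_finrank_eq_natCard p H).symm
  have h2 : Nat.card H ≤ Nat.card A := Nat.card_le_card_of_injective _ H.subtype_injective
  have h3 : Module.finrank (ZMod p) H < 2 := by
    by_contra! h
    have := Nat.pow_le_pow_right (Fact.out : p.Prime).pos h
    omega
  rw [h1]
  interval_cases Module.finrank (ZMod p) H <;> simp

/-- In a group of order less than `p²`, any two elements of order `p` are multiples of each
other. -/
lemma exists_nsmul_eq_of_torsion {p : ℕ} [Fact p.Prime] {A : Type*} [AddCommGroup A] [Finite A]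
    (hA : Nat.card A < p ^ 2) {x y : A} (hx : p • x = 0) (hx0 : x ≠ 0) (hy : p • y = 0) :
    ∃ k : ℕ, k • x = y := by
  have hcard := natCard_eq_one_or_prime hA (nsmulAddMonoidHom p : A →+ A).ker (fun x hx => hx)
  have hord : addOrderOf x = p := addOrderOf_eq_prime hx hx0
  have hle : AddSubgroup.zmultiples x ≤ (nsmulAddMonoidHom p : A →+ A).ker := by
    rw [AddSubgroup.zmultiples_le]; exact hx
  have h1 : Nat.card (AddSubgroup.zmultiples x) = p := by rw [Nat.card_zmultiples, hord]
  have hp := (Fact.out : p.Prime).one_lt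
  have heq : AddSubgroup.zmultiples x = (nsmulAddMonoidHom p : A →+ A).ker := by
    apply AddSubgroup.eq_of_le_of_card_ge hle
    omega
  have hy' : y ∈ AddSubgroup.zmultiples x := by rw [heq]; exact hy
  classical
  obtain ⟨k, hk⟩ := Finset.mem_image.mp (mem_zmultiples_iff_mem_range_addOrderOf.mp hy')
  exact ⟨k, hk.2⟩

variable {p : ℕ} [Fact p.Prime]

instance (a b : ZMod p) [(shortCurve a b).IsElliptic] : Finite (ResiduePoint a b) := by
  classical
  have e := (Projective.Point.toAffineAddEquiv (shortCurve a b).toProjective).toEquiv.trans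
    (Affine.pointEquiv (shortCurve a b).toAffine)
  have : Finite (WithZero {xy : ZMod p × ZMod p //
    (shortCurve a b).toAffine.Equation xy.1 xy.2}) := inferInstanceAs (Finite (Option _))
  exact Finite.of_equiv _ e.symm

lemma equation_short_affine {R : Type*} [CommRing R] {a b x y : R} :
    (shortCurve a b).toAffine.Equation x y ↔ y ^ 2 = x ^ 3 + a * x + b := by
  rw [Affine.equation_iff]
  simp [shortCurve]

/-- Each abscissa carries at most two points, so the order is at most `2 p + 1`, which is below `p²`
once `p ≥ 3`. Hasse's bound is unnecessary. -/
lemma card_residuePoint_lt (hp : 3 ≤ p) (a b : ZMod p) [(shortCurve a b).IsElliptic] :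
    Nat.card (ResiduePoint a b) < p ^ 2 := by
  classical
  have e := (Projective.Point.toAffineAddEquiv (shortCurve a b).toProjective).toEquiv.trans
    (Affine.pointEquiv (shortCurve a b).toAffine)
  rw [Nat.card_congr e]
  have h0 : Nat.card (WithZero {xy : ZMod p × ZMod p //
      (shortCurve a b).toAffine.Equation xy.1 xy.2}) = Nat.card {xy : ZMod p × ZMod p //
      (shortCurve a b).toAffine.Equation xy.1 xy.2} + 1 := Finite.card_option
  rw [h0, Nat.card_eq_fintype_card, Fintype.card_subtype]
  have h1 := Finset.card_le_mul_card_image (f := fun xy : ZMod p × ZMod p => xy.1)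
    (Finset.univ.filter fun xy : ZMod p × ZMod p => (shortCurve a b).toAffine.Equation xy.1 xy.2) 2
    (by
      intro x _
      by_contra! h
      obtain ⟨u, hu, v, hv, w, hw, huv, huw, hvw⟩ := Finset.two_lt_card.mp h
      simp only [Finset.mem_filter, Finset.mem_univ, true_and, equation_short_affine] at hu hv hw
      obtain ⟨hu, hux⟩ := hu
      obtain ⟨hv, hvx⟩ := hv
      obtain ⟨hw, hwx⟩ := hw
      rw [hux] at hu
      rw [hvx] at hv
      rw [hwx] at hw
      have k1 : u.2 ≠ v.2 := fun h => huv (Prod.ext (hux.trans hvx.symm) h)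
      have k2 : u.2 ≠ w.2 := fun h => huw (Prod.ext (hux.trans hwx.symm) h)
      have k3 : v.2 ≠ w.2 := fun h => hvw (Prod.ext (hvx.trans hwx.symm) h)
      have l1 := (sq_eq_sq_iff_eq_or_eq_neg.mp (hv.trans hu.symm)).resolve_left k1.symm
      have l2 := (sq_eq_sq_iff_eq_or_eq_neg.mp (hw.trans hu.symm)).resolve_left k2.symm
      exact k3 (l1.trans l2.symm))
  have h2 : (Finset.image (fun xy : ZMod p × ZMod p => xy.1) (Finset.univ.filter
      fun xy : ZMod p × ZMod p => (shortCurve a b).toAffine.Equation xy.1 xy.2)).card ≤ p := by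
    refine (Finset.card_le_univ _).trans ?_
    rw [ZMod.card]
  nlinarith

variable {a b : ℤ_[p]}

/-- Reduction modulo `p²` as a homomorphism. -/
lemma exists_redHom_two (hE : (shortCurve a b).IsElliptic)
    [hE' : (shortCurve (PadicInt.toZModPow 2 a) (PadicInt.toZModPow 2 b)).IsElliptic] :
    ∃ f : PadicPoint a b →+ Point (PadicInt.toZModPow 2 a) (PadicInt.toZModPow 2 b),
      Function.Surjective f ∧ f.ker = redKer a b hE 1 := by
  have hex : ∀ P : PadicPoint a b, ∃ c : Point (PadicInt.toZModPow 2 a) (PadicInt.toZModPow 2 b),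
      Reduces a b P c.1 := by
    intro P
    obtain ⟨v, hv⟩ := exists_rep P
    have h : Reduces a b P ⟦PadicInt.toZModPow 2 ∘ v⟧ := ⟨v, hv, rfl⟩
    exact ⟨⟨_, h.mem⟩, h⟩
  choose f hf using hex
  refine ⟨AddMonoidHom.mk' f fun P Q => Subtype.ext ((hf _).unique ((hf P).add hE (hf Q))), ?_, ?_⟩
  · intro c
    obtain ⟨P, hP⟩ := exists_reduces hE c
    exact ⟨P, Subtype.ext ((hf P).unique hP)⟩
  · ext P
    rw [AddMonoidHom.mem_ker, mem_redKer]
    change f P = infinity _ _ ↔ _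
    constructor
    · intro h
      obtain ⟨v, hv, hc⟩ := hf P
      rw [h] at hc
      obtain ⟨u, hu⟩ := Quotient.exact hc.symm
      obtain ⟨s, hs⟩ := toZModPow_surjective 2 (u : ZMod (p ^ 2))
      have hsu : IsUnit s := isUnit_of_map_unit (PadicInt.toZModPow 2 : ℤ_[p] →+* ZMod (p ^ 2)) s
        (by rw [hs]; exact u.isUnit)
      refine ⟨_, _, hv, Rep.zero.smul hsu.unit, ?_⟩
      rw [← toZModPow_comp_eq_iff, ← hu]
      funext i
      fin_cases i <;> simp [Units.smul_def, hs]
    · rintro ⟨v, w, hv, hw, hvw⟩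
      rw [← toZModPow_comp_eq_iff] at hvw
      have hw0 : (⟦PadicInt.toZModPow 2 ∘ w⟧ : PointClass (ZMod (p ^ 2))) = ⟦![0, 1, 0]⟧ :=
        Reduces.unique ⟨w, hw, rfl⟩ Reduces.zero
      have hP0 : Reduces a b P ⟦![0, 1, 0]⟧ := ⟨v, hv, by rw [hvw, hw0]⟩
      exact Subtype.ext ((hf P).unique hP0)

instance (A B : ZMod (p ^ 2)) : Finite (Point A B) := by
  have : Finite (PointClass (ZMod (p ^ 2))) := Quotient.finite _
  exact Subtype.finite

/-- The group `E(ℤ/p²)` has `p`-rank `2` if and only if `E(ℚ_p)` has a point of order `p`. -/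
theorem pRank_eq_two_iff (hp : 3 ≤ p) (hE : (shortCurve a b).IsElliptic)
    [hE' : (shortCurve (PadicInt.toZModPow 2 a) (PadicInt.toZModPow 2 b)).IsElliptic] :
    pRank p (Point (PadicInt.toZModPow 2 a) (PadicInt.toZModPow 2 b)) = 2 ↔
      ∃ T : PadicPoint a b, T ≠ 0 ∧ p • T = 0 := by
  obtain ⟨f, hf, hker⟩ := exists_redHom_two hE
  have hEp := isElliptic_map (PadicInt.toZMod : ℤ_[p] →+* ZMod p) hE
  set M := Point (PadicInt.toZModPow 2 a) (PadicInt.toZModPow 2 b)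
  -- `T` is the preimage in `E(ℚ_p)` of the `p`-torsion of `E(ℤ/p²)`. It contains the whole kernel
  -- of reduction modulo `p`.
  set T := (nsmulAddMonoidHom p : M →+ M).ker.comap f with hT
  have hmemT : ∀ P, P ∈ T ↔ p • P ∈ redKer a b hE 1 := by
    intro P
    rw [← hker, hT, AddSubgroup.mem_comap, AddMonoidHom.mem_ker, AddMonoidHom.mem_ker, map_nsmul]
    rfl
  have h01 : redKer a b hE 1 ≤ redKer a b hE 0 := redKer_anti hE zero_le_one
  have h0T : redKer a b hE 0 ≤ T := by
    intro P hP
    rw [hmemT]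
    obtain ⟨x, hx, hd⟩ := mem_redKer_iff_param.mp hP
    obtain ⟨s, hs, hsd⟩ := hx.nsmul hd p
    refine mem_redKer_iff_param.mpr ⟨s, hs, ?_⟩
    have := dvd_add ((pow_dvd_pow (p : ℤ_[p]) (by norm_num : 1 + 1 ≤ 3 * (0 + 1))).trans hsd)
      (show (p : ℤ_[p]) ^ (1 + 1) ∣ p * x by
        rw [pow_succ']; exact mul_dvd_mul_left _ (by simpa using hd))
    rwa [sub_add_cancel] at this
  -- The index of the kernel modulo `p²` in `T` splits along the kernel modulo `p`: the lower step
  -- contributes `p`, the upper one the image of `T` in `E(𝔽_p)`. That image has order `1` or `p`,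
  -- so the rank is `2` exactly when it is nontrivial.
  have hcard : p ^ pRank p M = p * Nat.card (T.map (redHom hE)) := by
    rw [pow_pRank, ← AddSubgroup.map_comap_eq_self_of_surjective hf (nsmulAddMonoidHom p : M →+ M).ker,
      ← AddSubgroup.relIndex_ker, hker, ← hT, ← AddSubgroup.relIndex_ker, ker_redHom,
      ← AddSubgroup.relIndex_mul_relIndex _ _ _ h01 h0T, index_redKer]
  have hmap : ∀ x ∈ T.map (redHom hE), p • x = 0 := by
    rintro _ ⟨P, hP, rfl⟩
    rw [← map_nsmul]
    rw [← AddMonoidHom.mem_ker, ker_redHom]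
    exact h01 ((hmemT P).mp hP)
  have hpp := (Fact.out : p.Prime)
  constructor
  · intro hr
    rw [hr, pow_two] at hcard
    have hc := Nat.eq_of_mul_eq_mul_left hpp.pos hcard
    have hne : T.map (redHom hE) ≠ ⊥ := by
      intro h
      rw [h] at hc
      simp at hc
      exact hpp.one_lt.ne' hc
    obtain ⟨⟨x, P, hP, rfl⟩, hx⟩ := AddSubgroup.ne_bot_iff_exists_ne_zero.mp hne
    have hx0 : redHom hE P ≠ 0 := fun h => hx (Subtype.ext h)
    obtain ⟨R, hR, hpR⟩ := exists_torsion (hE := hE) (Q := P)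
      (fun h => hx0 (by rwa [← ker_redHom, AddMonoidHom.mem_ker] at h)) ((hmemT P).mp hP)
    exact ⟨R, fun h => hR (h ▸ zero_mem _), hpR⟩
  · rintro ⟨R, hR, hpR⟩
    rcases natCard_eq_one_or_prime (card_residuePoint_lt hp _ _) _ hmap with h | h
    · exfalso
      apply hR
      refine eq_zero_of_mem_redKer (hE := hE) ?_ hpR
      rw [← ker_redHom, AddMonoidHom.mem_ker]
      have hm : redHom hE R ∈ T.map (redHom hE) :=
        AddSubgroup.mem_map_of_mem _ ((hmemT R).mpr (hpR ▸ zero_mem _))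
      rw [AddSubgroup.eq_bot_of_card_eq _ h] at hm
      exact hm
    · rw [h, ← pow_two] at hcard
      exact Nat.pow_right_injective hpp.two_le hcard

end Rank

/-! ### Functions with divisor `n (T - O)`: uniqueness and first-order deformation. -/

section TorsionFunction

open WeierstrassCurve Polynomial

/-- The polynomial `X³ + a X + b`. -/
noncomputable def cubic {R : Type*} [CommRing R] (a b : R) : R[X] := X ^ 3 + C a * X + C b

section Cubic

variable {R : Type*} [CommRing R] (a b : R)

lemma cubic_eq_add_quadratic : cubic a b = X ^ 3 + (C a * X + C b) := add_assoc _ _ _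

lemma degree_linear_lt : (C a * X + C b).degree < ((3 : ℕ) : WithBot ℕ) :=
  degree_linear_le.trans_lt (by norm_num)

lemma monic_cubic : (cubic a b).Monic := by
  rw [cubic_eq_add_quadratic]
  exact monic_X_pow_add (degree_linear_lt a b)

variable [Nontrivial R]

lemma natDegree_cubic_short : (cubic a b).natDegree = 3 := by
  rw [cubic_eq_add_quadratic]
  have := degree_add_eq_left_of_degree_lt (p := (X : R[X]) ^ 3) (q := C a * X + C b)
    (by rw [degree_X_pow]; exact degree_linear_lt a b)
  rw [degree_X_pow] at this
  exact natDegree_eq_of_degree_eq_some this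

end Cubic

lemma map_cubic {R S : Type*} [CommRing R] [CommRing S] (f : R →+* S) (a b : R) :
    (cubic a b).map f = cubic (f a) (f b) := by
  simp [cubic]

section Domain

variable {k : Type*} [CommRing k] [IsDomain k] {a b : k} {u v : k[X]}

lemma natDegree_cubic_mul_sq (hv : v ≠ 0) :
    (cubic a b * v ^ 2).natDegree = 3 + 2 * v.natDegree := by
  rw [natDegree_mul (monic_cubic a b).ne_zero (pow_ne_zero 2 hv), natDegree_cubic_short, natDegree_pow]

/-- Parity of degrees: the left side has even degree, the right side odd degree. No smoothness is
needed. -/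
lemma eq_zero_of_sq_eq_cubic_mul_sq (h : u ^ 2 = cubic a b * v ^ 2) : u = 0 ∧ v = 0 := by
  by_cases hv : v = 0
  · subst hv
    simpa using h
  · exfalso
    have := congrArg natDegree h
    rw [natDegree_cubic_mul_sq hv, natDegree_pow] at this
    omega

/-- The two terms have degrees of different parity, so they cannot cancel at the top; an odd total
degree means that the term with `v` dominates. -/
lemma degrees_of_norm {m : ℕ} (h : (u ^ 2 - cubic a b * v ^ 2).natDegree = 2 * m + 3) :
    u.natDegree ≤ m + 1 ∧ v.natDegree = m ∧
      (u ^ 2 - cubic a b * v ^ 2).leadingCoeff = -v.leadingCoeff ^ 2 := by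
  have hu : (u ^ 2).natDegree = 2 * u.natDegree := natDegree_pow _ _
  by_cases hv : v = 0
  · subst hv
    simp [natDegree_pow] at h
    omega
  have hd := natDegree_cubic_mul_sq (a := a) (b := b) hv
  rcases lt_or_ge (u ^ 2).natDegree (cubic a b * v ^ 2).natDegree with hlt | hge
  · have hlt' := degree_lt_degree hlt
    rw [leadingCoeff_sub_of_degree_lt' hlt', leadingCoeff_mul, (monic_cubic a b).leadingCoeff,
      one_mul, leadingCoeff_pow]
    rw [natDegree_sub_eq_right_of_natDegree_lt hlt] at h
    refine ⟨?_, ?_, rfl⟩ <;> omega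
  · have hlt : (cubic a b * v ^ 2).natDegree < (u ^ 2).natDegree := by omega
    rw [natDegree_sub_eq_left_of_natDegree_lt hlt] at h
    omega

end Domain

/-- The function `u + v y` on `y² = x³ + a x + b` has divisor `(2 m + 3) ((ξ, η) - O)`. The polynomial
`Y` is an expansion of the function `y` at the point `(ξ, η)`. -/
structure IsTorsionFunction {R : Type*} [CommRing R] (m : ℕ) (a b ξ η : R) (u v : R[X]) : Prop where
  monic : v.Monic
  natDegree_right : v.natDegree = m
  natDegree_left : u.natDegree ≤ m + 1
  norm_eq : u ^ 2 - cubic a b * v ^ 2 = -(X - C ξ) ^ (2 * m + 3)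
  vanish : ∃ Y : R[X], X - C ξ ∣ Y - C η ∧ (X - C ξ) ^ (2 * m + 3) ∣ Y ^ 2 - cubic a b ∧
    (X - C ξ) ^ (2 * m + 3) ∣ u + v * Y

lemma IsTorsionFunction.map {R S : Type*} [CommRing R] [CommRing S] [Nontrivial S] (f : R →+* S)
    {m : ℕ} {a b ξ η : R} {u v : R[X]} (h : IsTorsionFunction m a b ξ η u v) :
    IsTorsionFunction m (f a) (f b) (f ξ) (f η) (u.map f) (v.map f) where
  monic := h.monic.map f
  natDegree_right := by rw [h.monic.natDegree_map, h.natDegree_right]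
  natDegree_left := natDegree_map_le.trans h.natDegree_left
  norm_eq := by
    have := congrArg (Polynomial.map f) h.norm_eq
    simpa [map_cubic] using this
  vanish := by
    obtain ⟨Y, h1, h2, h3⟩ := h.vanish
    refine ⟨Y.map f, ?_, ?_, ?_⟩
    · simpa using map_dvd (mapRingHom f) h1
    · simpa [map_cubic] using map_dvd (mapRingHom f) h2
    · simpa using map_dvd (mapRingHom f) h3

section Field

variable {k : Type*} [Field k] {m : ℕ} {a b ξ η : k} {u v : k[X]}

/-- A function vanishing to order `n` at `(ξ, η)` has a norm vanishing to order `n` at `ξ`. -/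
lemma dvd_norm_of_dvd {Y : k[X]} {n : ℕ} (h1 : (X - C ξ) ^ n ∣ Y ^ 2 - cubic a b)
    (h2 : (X - C ξ) ^ n ∣ u + v * Y) : (X - C ξ) ^ n ∣ u ^ 2 - cubic a b * v ^ 2 := by
  have : u ^ 2 - cubic a b * v ^ 2 = (u + v * Y) * (u - v * Y) + v ^ 2 * (Y ^ 2 - cubic a b) := by
    ring
  rw [this]
  exact dvd_add (h2.mul_right _) (h1.mul_left _)

lemma isCoprime_X_sub_C_of_eval_ne_zero {f : k[X]} (h : f.eval ξ ≠ 0) : IsCoprime (X - C ξ) f :=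
  (irreducible_X_sub_C ξ).coprime_iff_not_dvd.mpr (fun hd => h (dvd_iff_isRoot.mp hd))

/-- Subtracting the two functions cancels the leading terms of `v` and `v'`, so the norm of the
difference has degree at most `2 m + 2`, yet it is divisible by `(X - ξ) ^ (2 m + 3)`. It is
therefore zero, and so is the difference. -/
lemma IsTorsionFunction.unique (h2 : (2 : k) * η ≠ 0) (h : IsTorsionFunction m a b ξ η u v)
    {u' v' : k[X]} (h' : IsTorsionFunction m a b ξ η u' v') : u = u' ∧ v = v' := by
  obtain ⟨Y, hY, hYF, hYu⟩ := h.vanish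
  obtain ⟨Y', hY', hYF', hYu'⟩ := h'.vanish
  have hev : Y.eval ξ = η := by
    have := dvd_iff_isRoot.mp hY
    simpa [sub_eq_zero] using this
  have hev' : Y'.eval ξ = η := by
    have := dvd_iff_isRoot.mp hY'
    simpa [sub_eq_zero] using this
  -- The two expansions of `y` may differ as polynomials. They agree to the required order because
  -- `Y + Y'` takes the value `2 η ≠ 0` at `ξ`.
  have hYY : (X - C ξ) ^ (2 * m + 3) ∣ Y - Y' := by
    have h1 : (X - C ξ) ^ (2 * m + 3) ∣ (Y + Y') * (Y - Y') := by
      have := dvd_sub hYF hYF'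
      convert this using 1
      ring
    refine (IsCoprime.pow_left (isCoprime_X_sub_C_of_eval_ne_zero ?_)).dvd_of_dvd_mul_left h1
    rw [eval_add, hev, hev', ← two_mul]
    exact h2
  have hd : (X - C ξ) ^ (2 * m + 3) ∣ (u - u') + (v - v') * Y := by
    have := dvd_sub (dvd_sub hYu hYu') (hYY.mul_left v')
    convert this using 1
    ring
  have hN := dvd_norm_of_dvd hYF hd
  have hlt : ((u - u') ^ 2 - cubic a b * (v - v') ^ 2).natDegree < 2 * m + 3 := by
    have hu : ((u - u') ^ 2).natDegree ≤ 2 * (m + 1) :=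
      natDegree_pow_le.trans (Nat.mul_le_mul_left 2
        ((natDegree_sub_le_of_le h.natDegree_left h'.natDegree_left).trans (max_self _).le))
    have hv : (cubic a b * (v - v') ^ 2).natDegree ≤ 2 * m + 2 := by
      by_cases hv0 : v - v' = 0
      · simp [hv0]
      · rw [natDegree_cubic_mul_sq hv0]
        have hm : v.degree = v'.degree := by
          rw [degree_eq_natDegree h.monic.ne_zero, degree_eq_natDegree h'.monic.ne_zero,
            h.natDegree_right, h'.natDegree_right]
        have := degree_sub_lt_left hm h.monic.ne_zero
          (h.monic.leadingCoeff.trans h'.monic.leadingCoeff.symm)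
        have := natDegree_lt_natDegree hv0 this
        rw [h.natDegree_right] at this
        omega
    have := natDegree_sub_le_of_le hu hv
    omega
  have h0 : (u - u') ^ 2 - cubic a b * (v - v') ^ 2 = 0 :=
    eq_zero_of_dvd_of_natDegree_lt hN (by
      rw [natDegree_pow, natDegree_X_sub_C, mul_one]; exact hlt)
  have := eq_zero_of_sq_eq_cubic_mul_sq (sub_eq_zero.mp h0)
  exact ⟨sub_eq_zero.mp this.1, sub_eq_zero.mp this.2⟩

/-- A common zero of `u` and `v` could only be `ξ`, by the norm equation, and would make the
function vanish at `(ξ, -η)` as well. -/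
lemma IsTorsionFunction.isCoprime (h : IsTorsionFunction m a b ξ η u v) : IsCoprime v u := by
  have hv : v.eval ξ ≠ 0 := by
    intro hv
    have hu : u.eval ξ = 0 := by
      have := congrArg (eval ξ) h.norm_eq
      simpa [hv] using this
    obtain ⟨u', rfl⟩ := dvd_iff_isRoot.mpr hu
    obtain ⟨v', rfl⟩ := dvd_iff_isRoot.mpr hv
    obtain ⟨Y, -, hYF, hYu⟩ := h.vanish
    have hX : (X - C ξ) ≠ 0 := X_sub_C_ne_zero ξ
    -- After division by `X - ξ` the function still vanishes to order `2 m + 2`, but its norm is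
    -- `-(X - ξ) ^ (2 m + 1)`.
    have h1 : (X - C ξ) ^ (2 * m + 2) ∣ u' + v' * Y := by
      have e : (X - C ξ) * u' + (X - C ξ) * v' * Y = (X - C ξ) * (u' + v' * Y) := by ring
      rw [e, pow_succ' _ (2 * m + 2)] at hYu
      exact (mul_dvd_mul_iff_left hX).mp hYu
    have h2 := dvd_norm_of_dvd ((pow_dvd_pow _ (by omega)).trans hYF) h1
    have h3 : u' ^ 2 - cubic a b * v' ^ 2 = -(X - C ξ) ^ (2 * m + 1) := by
      apply mul_left_cancel₀ (pow_ne_zero 2 hX)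
      linear_combination h.norm_eq
    rw [h3, dvd_neg, pow_dvd_pow_iff hX (not_isUnit_X_sub_C ξ)] at h2
    omega
  have h1 : IsCoprime v ((X - C ξ) ^ (2 * m + 3)) :=
    (IsCoprime.pow_left (isCoprime_X_sub_C_of_eval_ne_zero hv)).symm
  have h2 : IsCoprime v (u ^ 2 + v * (-(cubic a b * v))) := by
    have e : u ^ 2 + v * (-(cubic a b * v)) = -(X - C ξ) ^ (2 * m + 3) := by
      rw [← h.norm_eq]; ring
    rw [e]
    exact h1.neg_right
  exact (IsCoprime.pow_right_iff two_pos).mp h2.of_add_mul_left_right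

end Field

section ZModField

variable {p : ℕ} [Fact p.Prime] {m : ℕ} {a b ξ η : ZMod p} {u v : (ZMod p)[X]}

lemma derivative_cubic {R : Type*} [CommRing R] (a b : R) :
    derivative (cubic a b) = 3 * X ^ 2 + C a := by
  simp [cubic, map_ofNat]
  norm_num

/-- The witnesses come from an explicit Bézout identity over the integers for the cubic and its
derivative, with value `4 a³ + 27 b²`. -/
lemma isCoprime_cubic_derivative (h : 4 * a ^ 3 + 27 * b ^ 2 ≠ 0) :
    IsCoprime (cubic a b) (derivative (cubic a b)) := by
  have hC : (C (4 * a ^ 3 + 27 * b ^ 2) : (ZMod p)[X]) * C (4 * a ^ 3 + 27 * b ^ 2)⁻¹ = 1 := by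
    rw [← C_mul, mul_inv_cancel₀ h, C_1]
  refine ⟨C (4 * a ^ 3 + 27 * b ^ 2)⁻¹ * (-18 * C a * X + 27 * C b),
    C (4 * a ^ 3 + 27 * b ^ 2)⁻¹ * (6 * C a * X ^ 2 - 9 * C b * X + 4 * C a ^ 2), ?_⟩
  rw [derivative_cubic, ← hC]
  simp [cubic, map_ofNat]
  ring

/-- The differential of the torsion function is a nonzero multiple of the invariant differential. -/
lemma IsTorsionFunction.exists_derivative (hp : p = 2 * m + 3)
    (hΔ : 4 * a ^ 3 + 27 * b ^ 2 ≠ 0) (h : IsTorsionFunction m a b ξ η u v) :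
    ∃ ω : ZMod p, ω ≠ 0 ∧ 2 * u * C ω = derivative (cubic a b) * v + 2 * cubic a b * derivative v := by
  have h20 : (2 : ZMod p) ≠ 0 := by
    intro h2
    have : ((2 : ℕ) : ZMod p) = 0 := by exact_mod_cast h2
    rw [ZMod.natCast_eq_zero_iff] at this
    have := Nat.le_of_dvd two_pos this
    omega
  -- In characteristic `p` the right side `-(X - ξ) ^ p` of the norm equation has zero derivative.
  have hder : 2 * u * derivative u =
      v * (derivative (cubic a b) * v + 2 * cubic a b * derivative v) := by
    have := congrArg derivative h.norm_eq
    rw [← hp] at this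
    simp [derivative_pow, derivative_mul, map_ofNat] at this
    linear_combination this
  have hdvd : v ∣ derivative u := by
    have h1 : v ∣ u * derivative u := by
      have h2 : (2 : (ZMod p)[X]) = C 2 := rfl
      have h3 : u * derivative u = C (2⁻¹ : ZMod p) * (2 * u * derivative u) := by
        rw [h2, mul_assoc (C 2), ← mul_assoc (C _), ← C_mul, inv_mul_cancel₀ h20, C_1, one_mul]
      rw [h3, hder]
      exact (dvd_mul_right _ _).mul_left _
    exact h.isCoprime.dvd_of_dvd_mul_left h1
  obtain ⟨w, hw⟩ := hdvd
  -- The degree of `u'` is at most `m`, the degree of `v`, so the quotient is a constant `ω`.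
  -- Equivalently, `df = ω f dx / y` for `f = u + v y`.
  have hwc : ∃ ω, w = C ω := by
    by_cases hw0 : w = 0
    · exact ⟨0, by simp [hw0]⟩
    · refine ⟨w.coeff 0, eq_C_of_natDegree_eq_zero ?_⟩
      have h1 := congrArg natDegree hw
      rw [natDegree_mul h.monic.ne_zero hw0, h.natDegree_right] at h1
      have h2 := natDegree_derivative_le u
      have h3 := h.natDegree_left
      omega
  obtain ⟨ω, rfl⟩ := hwc
  have heq : 2 * u * C ω = derivative (cubic a b) * v + 2 * cubic a b * derivative v := by
    apply mul_left_cancel₀ h.monic.ne_zero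
    rw [← hder, hw]
    ring
  refine ⟨ω, ?_, heq⟩
  rintro rfl
  -- `u` is a constant
  simp at hw
  have hu : ∃ c, u = C c := by
    refine ⟨u.coeff 0, ?_⟩
    ext i
    rw [coeff_C]
    split_ifs with hi
    · rw [hi]
    · obtain ⟨i, rfl⟩ := Nat.exists_eq_succ_of_ne_zero hi
      have h1 := congrArg (fun f => coeff f i) hw
      simp only [coeff_derivative, coeff_zero] at h1
      rcases mul_eq_zero.mp h1 with h1 | h1
      · exact h1
      · have h2 : ((i + 1 : ℕ) : ZMod p) = 0 := by exact_mod_cast h1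
        rw [ZMod.natCast_eq_zero_iff] at h2
        have := Nat.le_of_dvd (Nat.succ_pos i) h2
        apply coeff_eq_zero_of_natDegree_lt
        have h3 := h.natDegree_left
        omega
  obtain ⟨c, rfl⟩ := hu
  -- With `u = c` constant, Frobenius and `c ^ p = c` collapse the norm equation. The cubic would
  -- then be the cube of a linear polynomial up to a unit, hence not separable.
  have hF : cubic a b * v ^ 2 = (X - C (ξ - c ^ 2)) ^ p := by
    have h1 : (X - C (ξ - c ^ 2)) ^ p = (X - C ξ) ^ p + (C (c ^ 2)) ^ p := by
      rw [← add_pow_char]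
      congr 1
      simp
      ring
    have h2 := h.norm_eq
    rw [← hp, C_pow.symm] at h2
    rw [h1, ← C_pow, ZMod.pow_card]
    linear_combination -h2
  have hdF : cubic a b ∣ (X - C (ξ - c ^ 2)) ^ p := ⟨_, hF.symm⟩
  obtain ⟨i, -, hi⟩ := (dvd_prime_pow (prime_X_sub_C _) _).mp hdF
  have hi3 : i = 3 := by
    have := natDegree_eq_of_degree_eq (degree_eq_degree_of_associated hi)
    rw [natDegree_cubic_short, natDegree_pow, natDegree_X_sub_C] at this
    omega
  have hd1 : (X - C (ξ - c ^ 2)) ^ (1 + 1) ∣ cubic a b := by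
    rw [hi.dvd_iff_dvd_right, hi3]
    exact pow_dvd_pow _ (by norm_num)
  have hd2 : X - C (ξ - c ^ 2) ∣ derivative (cubic a b) := by
    obtain ⟨g, hg⟩ := hd1
    rw [hg]
    simp [derivative_pow, derivative_mul, map_ofNat]
    exact ⟨2 * g + (X - C (ξ - c ^ 2)) * derivative g, by simp; ring⟩
  exact not_isUnit_X_sub_C _ ((isCoprime_cubic_derivative hΔ).isUnit_of_dvd'
    ((dvd_pow_self _ (by norm_num)).trans hd1) hd2)

/-- If a torsion function deforms to first order in the direction `(s, t)`, then this direction is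
tangent to the isomorphism class of the curve. -/
lemma IsTorsionFunction.deformation (hp : p = 2 * m + 3) (h5 : 5 ≤ p)
    (hΔ : 4 * a ^ 3 + 27 * b ^ 2 ≠ 0) (h : IsTorsionFunction m a b ξ η u v) {s t : ZMod p}
    {μ ν : (ZMod p)[X]} (hμ : μ.natDegree ≤ m + 1)
    (heq : 2 * u * μ = (C s * X + C t) * v ^ 2 + 2 * cubic a b * v * ν) :
    ∃ κ : ZMod p, s = κ * (2 * a) ∧ t = κ * (3 * b) := by
  have hcast : ∀ n : ℕ, 0 < n → n < 5 → ((n : ℕ) : ZMod p) ≠ 0 := by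
    intro n hn hn5 h0
    rw [ZMod.natCast_eq_zero_iff] at h0
    have := Nat.le_of_dvd hn h0
    omega
  have h20 : (2 : ZMod p) ≠ 0 := by exact_mod_cast hcast 2 (by norm_num) (by norm_num)
  have h30 : (3 : ZMod p) ≠ 0 := by exact_mod_cast hcast 3 (by norm_num) (by norm_num)
  have h2C : (2 : (ZMod p)[X]) = C 2 := rfl
  have hu2 : IsUnit (2 : (ZMod p)[X]) := by rw [h2C]; exact isUnit_C.mpr h20.isUnit
  obtain ⟨ω, hω, hder⟩ := h.exists_derivative hp hΔ
  have hdvd : v ∣ μ := by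
    have h1 : v ∣ 2 * (u * μ) := ⟨(C s * X + C t) * v + 2 * cubic a b * ν, by
      linear_combination heq⟩
    exact h.isCoprime.dvd_of_dvd_mul_left (hu2.dvd_mul_left.mp h1)
  obtain ⟨r, rfl⟩ := hdvd
  have hr : r.natDegree ≤ 1 := by
    by_cases hr0 : r = 0
    · simp [hr0]
    · rw [natDegree_mul h.monic.ne_zero hr0, h.natDegree_right] at hμ
      omega
  have heq' : 2 * u * r = (C s * X + C t) * v + 2 * cubic a b * ν := by
    apply mul_left_cancel₀ h.monic.ne_zero
    linear_combination heq
  have hcop : IsCoprime v (cubic a b) := by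
    have h1 : IsCoprime v (2 * u * C ω) := by
      have hu' : IsUnit (2 * C ω) := hu2.mul (isUnit_C.mpr hω.isUnit)
      have e : 2 * u * C ω = (2 * C ω) * u := by ring
      rw [e]
      exact (isCoprime_mul_unit_left_right hu' _ _).mpr h.isCoprime
    have e : 2 * u * C ω = 2 * cubic a b * derivative v + v * derivative (cubic a b) := by
      rw [hder]; ring
    rw [e] at h1
    have h2 := h1.of_add_mul_left_right
    have e' : 2 * cubic a b * derivative v = cubic a b * (2 * derivative v) := by ring
    rw [e'] at h2
    exact h2.of_mul_right_left
  -- Eliminating `u` between the deformation equation and the differential equation leaves a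
  -- multiple of `v` divisible by the cubic, and `v` is prime to the cubic.
  have hF : cubic a b ∣ C ω * (C s * X + C t) - r * derivative (cubic a b) := by
    have h1 : cubic a b ∣ v * (C ω * (C s * X + C t) - r * derivative (cubic a b)) :=
      ⟨2 * (r * derivative v - C ω * ν), by linear_combination r * hder - C ω * heq'⟩
    exact hcop.symm.dvd_of_dvd_mul_left h1
  obtain ⟨q, hq⟩ := hF
  rw [eq_X_add_C_of_natDegree_le_one hr, derivative_cubic] at hq
  set r0 := r.coeff 0
  set r1 := r.coeff 1
  have hlhs : C ω * (C s * X + C t) - (C r1 * X + C r0) * (3 * X ^ 2 + C a)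
      = C (-3 * r1) * X ^ 3 + C (-3 * r0) * X ^ 2 + C (ω * s - r1 * a) * X + C (ω * t - r0 * a) := by
    simp [map_ofNat]
    ring
  -- The left side has degree at most `3`, so it is a constant times the cubic. The coefficient of
  -- `X²` gives `r0 = 0`, that of `X³` gives `κ = -3 r1`; the last two then give `ω s = -2 r1 a` and
  -- `ω t = -3 r1 b`.
  have hqc : ∃ κ, q = C κ := by
    by_cases hq0 : q = 0
    · exact ⟨0, by simp [hq0]⟩
    · refine ⟨q.coeff 0, eq_C_of_natDegree_eq_zero ?_⟩
      have h1 := congrArg natDegree hq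
      rw [natDegree_mul (monic_cubic a b).ne_zero hq0, natDegree_cubic_short, hlhs] at h1
      have h2 := natDegree_cubic_le (a := -3 * r1) (b := -3 * r0) (c := ω * s - r1 * a)
        (d := ω * t - r0 * a)
      omega
  obtain ⟨κ, rfl⟩ := hqc
  have hrhs : cubic a b * C κ = C κ * X ^ 3 + C 0 * X ^ 2 + C (κ * a) * X + C (κ * b) := by
    simp [cubic]
    ring
  rw [hlhs, hrhs] at hq
  have c3 := congrArg (fun f => coeff f 3) hq
  have c2 := congrArg (fun f => coeff f 2) hq
  have c1 := congrArg (fun f => coeff f 1) hq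
  have c0 := congrArg (fun f => coeff f 0) hq
  simp [-map_mul, -map_sub, -map_neg, -neg_mul, coeff_X, coeff_C] at c3 c2 c1 c0
  have hr0 : r0 = 0 := by simpa [h30] using c2
  rw [hr0] at c0
  refine ⟨-r1 / ω, ?_, ?_⟩
  · field_simp
    linear_combination c1 - a * c3
  · field_simp
    linear_combination c0 - b * c3

end ZModField

end TorsionFunction

/-! ### Existence of torsion functions, through the class group and integrality. -/

section TorsionFunctionExistence

open WeierstrassCurve Polynomial Affine Affine.CoordinateRing

section CoordinateRing

variable {R : Type*} [CommRing R] {a b : R}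

lemma polynomial_short : (shortCurve a b).toAffine.polynomial = X ^ 2 - C (cubic a b) := by
  simp only [WeierstrassCurve.Affine.polynomial, shortCurve, cubic]
  simp

/-- Evaluation of functions on `y² = x³ + a x + b` at a solution with `y = Y` over an algebra of
polynomials. -/
noncomputable def evalFunction {S : Type*} [CommRing S] (g : R[X] →+* S) (Y : S)
    (h : Y ^ 2 = g (cubic a b)) : (shortCurve a b).toAffine.CoordinateRing →+* S :=
  AdjoinRoot.lift g Y (by
    rw [polynomial_short, eval₂_sub, eval₂_C, eval₂_pow, eval₂_X, h, sub_self])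

lemma evalFunction_C {S : Type*} [CommRing S] (g : R[X] →+* S) (Y : S)
    (h : Y ^ 2 = g (cubic a b)) (q : R[X]) : evalFunction g Y h (CoordinateRing.mk _ (C q)) = g q :=
  AdjoinRoot.lift_of _

lemma evalFunction_X {S : Type*} [CommRing S] (g : R[X] →+* S) (Y : S)
    (h : Y ^ 2 = g (cubic a b)) : evalFunction g Y h (CoordinateRing.mk _ X) = Y :=
  AdjoinRoot.lift_root _

lemma mk_X_sq : (CoordinateRing.mk (shortCurve a b).toAffine X) ^ 2 = CoordinateRing.mk _ (C (cubic a b)) := by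
  rw [← map_pow]
  exact AdjoinRoot.mk_eq_mk.mpr ⟨1, by rw [polynomial_short, mul_one]⟩

/-- The coordinate ring is free over `R[X]` on `1` and `y`; compare the coordinates of `1`. This
brings divisibility of norms back to polynomials. -/
lemma mk_C_dvd_iff {q r : R[X]} :
    CoordinateRing.mk (shortCurve a b).toAffine (C q) ∣ CoordinateRing.mk (shortCurve a b).toAffine (C r) ↔ q ∣ r := by
  constructor
  · rintro ⟨f, hf⟩
    obtain ⟨s, t, rfl⟩ := exists_smul_basis_eq f
    have h : (q * s - r) • (1 : (shortCurve a b).toAffine.CoordinateRing)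
        + (q * t) • CoordinateRing.mk (shortCurve a b).toAffine X = 0 := by
      simp only [CoordinateRing.smul, map_mul, map_sub] at hf ⊢
      linear_combination -hf
    exact ⟨s, (sub_eq_zero.mp (smul_basis_eq_zero h).1).symm⟩
  · exact fun h => map_dvd ((CoordinateRing.mk (shortCurve a b).toAffine).comp C) h

/-- The involution `y ↦ -y` of the coordinate ring. -/
noncomputable def conj (a b : R) :
    (shortCurve a b).toAffine.CoordinateRing →+* (shortCurve a b).toAffine.CoordinateRing :=
  evalFunction ((CoordinateRing.mk (shortCurve a b).toAffine).comp C)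
    (-(CoordinateRing.mk (shortCurve a b).toAffine X)) (by rw [neg_sq]; exact mk_X_sq)

lemma conj_C (q : R[X]) : conj a b (CoordinateRing.mk _ (C q)) = CoordinateRing.mk _ (C q) :=
  evalFunction_C _ _ _ q

lemma conj_X : conj a b (CoordinateRing.mk _ X) = -CoordinateRing.mk _ X :=
  evalFunction_X _ _ _

lemma conj_mul_self (u v : R[X]) :
    conj a b (u • 1 + v • CoordinateRing.mk _ X) * (u • 1 + v • CoordinateRing.mk _ X)
      = CoordinateRing.mk _ (C (u ^ 2 - cubic a b * v ^ 2)) := by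
  simp only [CoordinateRing.smul, map_add, map_mul, conj_C, conj_X, map_sub, map_pow,
    mul_one]
  rw [← mk_X_sq]
  ring

lemma map_conj_XYIdeal (ξ η : R) :
    (XYIdeal (shortCurve a b).toAffine ξ (C η)).map (conj a b)
      = XYIdeal (shortCurve a b).toAffine ξ (C (-η)) := by
  have e1 : conj a b (XClass (shortCurve a b).toAffine ξ) = XClass _ ξ := conj_C _
  have e2 : conj a b (YClass (shortCurve a b).toAffine (C η)) = -YClass _ (C (-η)) := by
    simp only [YClass, map_sub, conj_C, conj_X, map_neg]
    ring
  rw [XYIdeal, XYIdeal, Ideal.map_span, Set.image_pair, e1, e2, Ideal.span_insert,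
    Ideal.span_insert, Ideal.span_singleton_neg]

end CoordinateRing

variable {K : Type*} [Field K] {a b : K}

/-- The homomorphism from points to the class group sends the point to the class of its ideal, so
the `n`-th power of that ideal is principal. -/
lemma exists_span_eq_of_torsion [DecidableEq K] {ξ η : K}
    (h : (shortCurve a b).toAffine.Nonsingular ξ η) {n : ℕ}
    (hn : n • (Affine.Point.some ξ η h) = 0) :
    ∃ f, XYIdeal (shortCurve a b).toAffine ξ (C η) ^ n = Ideal.span {f} := by
  have h1 := congrArg Affine.Point.toClass hn
  rw [map_nsmul, map_zero, Affine.Point.toClass_some] at h1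
  have h2 : ClassGroup.mk (shortCurve a b).toAffine.FunctionField
      (XYIdeal' (W := (shortCurve a b).toAffine) h ^ n) = 1 := by
    rw [map_pow]
    exact h1
  obtain ⟨f, -, hf⟩ := (ClassGroup.mk_eq_one_of_coe_ideal (I' :=
    XYIdeal (shortCurve a b).toAffine ξ (C η) ^ n) (by
      rw [Units.val_pow_eq_pow_val, XYIdeal'_eq, FractionalIdeal.coeIdeal_pow])).mp h2
  exact ⟨f, hf⟩

/-- The ideal of a point times that of its negative, its image under `conj`, is generated by `X -
ξ`. Raising to the power `n` gives an equality of principal ideals for the norm. -/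
lemma associated_norm_of_span_eq {ξ η : K} (h : (shortCurve a b).toAffine.Nonsingular ξ η) {n : ℕ}
    {u v : K[X]} (hf : XYIdeal (shortCurve a b).toAffine ξ (C η) ^ n
      = Ideal.span {u • 1 + v • CoordinateRing.mk _ X}) :
    Associated (u ^ 2 - cubic a b * v ^ 2) ((X - C ξ) ^ n) := by
  have hneg : (shortCurve a b).toAffine.negY ξ η = -η := by simp [Affine.negY, shortCurve]
  have hX := congrArg (· ^ n) (XYIdeal_neg_mul h)
  rw [hneg] at hX
  simp only [mul_pow] at hX
  rw [← map_conj_XYIdeal, ← Ideal.map_pow, hf, Ideal.map_span, Set.image_singleton,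
    Ideal.span_singleton_mul_span_singleton, conj_mul_self, XIdeal, Ideal.span_singleton_pow,
    XClass, ← map_pow, ← C_pow] at hX
  have hass := Ideal.span_singleton_eq_span_singleton.mp hX
  exact associated_of_dvd_dvd (mk_C_dvd_iff.mp hass.dvd) (mk_C_dvd_iff.mp hass.dvd')

/-- A point of order dividing `n` on `y² = x³ + a x + b` is the support of the divisor of a
function. -/
lemma exists_function_of_torsion [DecidableEq K] {ξ η : K}
    (h : (shortCurve a b).toAffine.Nonsingular ξ η) {n : ℕ}
    (hn : n • (Affine.Point.some ξ η h) = 0) :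
    ∃ u v : K[X], Associated (u ^ 2 - cubic a b * v ^ 2) ((X - C ξ) ^ n) ∧
      ∀ Y : K[X], X - C ξ ∣ Y - C η → (X - C ξ) ^ n ∣ Y ^ 2 - cubic a b →
        (X - C ξ) ^ n ∣ u + v * Y := by
  obtain ⟨f, hf⟩ := exists_span_eq_of_torsion h hn
  obtain ⟨u, v, rfl⟩ := exists_smul_basis_eq f
  refine ⟨u, v, ?_, ?_⟩
  · exact associated_norm_of_span_eq h hf
  · intro Y hY hYF
    let I : Ideal K[X] := Ideal.span {(X - C ξ) ^ n}
    let ρ : (shortCurve a b).toAffine.CoordinateRing →+* K[X] ⧸ I :=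
      evalFunction (Ideal.Quotient.mk I) (Ideal.Quotient.mk I Y) (by
        rw [← map_pow, Ideal.Quotient.eq, Ideal.mem_span_singleton]
        exact hYF)
    -- Substituting `Y` for `y` sends the ideal of the point into `(X - ξ)`, so its `n`-th power
    -- goes to zero modulo `(X - ξ) ^ n`.
    have hle : (XYIdeal (shortCurve a b).toAffine ξ (C η)).map ρ
        ≤ Ideal.span {Ideal.Quotient.mk I (X - C ξ)} := by
      rw [XYIdeal, Ideal.map_span, Ideal.span_le]
      rintro _ ⟨x, hx | hx, rfl⟩
      · rw [hx, SetLike.mem_coe, Ideal.mem_span_singleton, XClass, evalFunction_C]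
      · rw [hx, SetLike.mem_coe, Ideal.mem_span_singleton, YClass, map_sub (CoordinateRing.mk _),
          map_sub ρ, evalFunction_C, evalFunction_X, ← map_sub (Ideal.Quotient.mk I)]
        exact map_dvd _ hY
    have hmem : ρ (u • (1 : (shortCurve a b).toAffine.CoordinateRing)
        + v • CoordinateRing.mk (shortCurve a b).toAffine X) ∈ Ideal.span {Ideal.Quotient.mk I (X - C ξ)} ^ n := by
      refine Ideal.pow_right_mono hle n ?_
      rw [← Ideal.map_pow, hf]
      exact Ideal.mem_map_of_mem _ (Ideal.mem_span_singleton_self _)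
    have h0 : (Ideal.Quotient.mk I (X - C ξ)) ^ n = 0 := by
      rw [← map_pow]
      exact Ideal.Quotient.eq_zero_iff_mem.mpr (Ideal.mem_span_singleton_self _)
    rw [Ideal.span_singleton_pow, h0, Ideal.mem_span_singleton, zero_dvd_iff] at hmem
    simp only [CoordinateRing.smul, map_add, map_mul, mul_one, ρ, evalFunction_C,
      evalFunction_X] at hmem
    rw [← map_mul, ← map_add, Ideal.Quotient.eq_zero_iff_mem, Ideal.mem_span_singleton] at hmem
    exact hmem

/-- The monic normalization of the function of `exists_function_of_torsion`. -/
lemma exists_monic_function_of_torsion [DecidableEq K] {ξ η : K}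
    (h : (shortCurve a b).toAffine.Nonsingular ξ η) {m : ℕ}
    (hn : (2 * m + 3) • (Affine.Point.some ξ η h) = 0) :
    ∃ u v : K[X], v.Monic ∧ v.natDegree = m ∧ u.natDegree ≤ m + 1 ∧
      u ^ 2 - cubic a b * v ^ 2 = -(X - C ξ) ^ (2 * m + 3) ∧
      ∀ Y : K[X], X - C ξ ∣ Y - C η → (X - C ξ) ^ (2 * m + 3) ∣ Y ^ 2 - cubic a b →
        (X - C ξ) ^ (2 * m + 3) ∣ u + v * Y := by
  obtain ⟨u, v, hN, hY⟩ := exists_function_of_torsion h hn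
  have hdeg : (u ^ 2 - cubic a b * v ^ 2).natDegree = 2 * m + 3 := by
    rw [natDegree_eq_of_degree_eq (degree_eq_degree_of_associated hN), natDegree_pow,
      natDegree_X_sub_C, mul_one]
  obtain ⟨hu, hv, hlc⟩ := degrees_of_norm hdeg
  have hv0 : v ≠ 0 := by
    rintro rfl
    simp at hlc
    rw [hlc] at hdeg
    simp at hdeg
  have hl : v.leadingCoeff ≠ 0 := leadingCoeff_ne_zero.mpr hv0
  set l := v.leadingCoeff
  obtain ⟨c, hc⟩ := hN.symm
  obtain ⟨d, -, hd⟩ := Polynomial.isUnit_iff.mp c.isUnit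
  -- The unit relating the norm to `(X - ξ) ^ (2 m + 3)` is the leading coefficient `-l²` of the
  -- norm. Dividing the function by `l` thus makes `v` monic and the norm exactly `-(X - ξ) ^ (2 m +
  -- 3)`.
  have hcl : (d : K) = -l ^ 2 := by
    rw [← hlc, ← hc, ← hd, leadingCoeff_mul, leadingCoeff_C, leadingCoeff_pow,
      leadingCoeff_X_sub_C, one_pow, one_mul]
  refine ⟨C l⁻¹ * u, C l⁻¹ * v, ?_, ?_, ?_, ?_, fun Y h1 h2 => ?_⟩
  · rw [mul_comm]
    exact monic_mul_leadingCoeff_inv hv0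
  · rw [natDegree_C_mul (inv_ne_zero hl), hv]
  · exact (natDegree_C_mul_le _ _).trans hu
  · have e : (C l⁻¹ * u) ^ 2 - cubic a b * (C l⁻¹ * v) ^ 2
        = C (l⁻¹ ^ 2) * (u ^ 2 - cubic a b * v ^ 2) := by
      rw [C_pow]; ring
    rw [e, ← hc, ← hd, hcl, mul_comm, mul_assoc, ← C_mul]
    have : -l ^ 2 * l⁻¹ ^ 2 = -1 := by field_simp
    rw [this]
    simp
  · have := (hY Y h1 h2).mul_left (C l⁻¹)
    convert this using 1
    ring

/-- An expansion of the function `y` at the point `(ξ, η)`. -/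
lemma exists_expansion {R : Type*} [CommRing R] {a b ξ η : R} (hη : IsUnit (2 * η))
    (h : η ^ 2 = ξ ^ 3 + a * ξ + b) (n : ℕ) :
    ∃ Y : R[X], X - C ξ ∣ Y - C η ∧ (X - C ξ) ^ (n + 1) ∣ Y ^ 2 - cubic a b := by
  induction n with
  | zero =>
    refine ⟨C η, by simp, ?_⟩
    rw [zero_add, pow_one, dvd_iff_isRoot]
    simp [cubic, h]
  | succ n ih =>
    obtain ⟨Y, hY, G, hG⟩ := ih
    have hev : Y.eval ξ = η := by
      have := dvd_iff_isRoot.mp hY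
      simpa [sub_eq_zero] using this
    -- Newton's iteration: the correction `c (X - ξ) ^ (n + 1)` removes the leading error, and `2 η`
    -- is the derivative of `Y²`.
    obtain ⟨c, hc⟩ : ∃ c, G.eval ξ + 2 * η * c = 0 := by
      obtain ⟨w, hw⟩ := hη.exists_right_inv
      exact ⟨-w * G.eval ξ, by linear_combination (-G.eval ξ) * hw⟩
    refine ⟨Y + C c * (X - C ξ) ^ (n + 1), ?_, ?_⟩
    · have := dvd_add hY ((dvd_pow_self (X - C ξ) (Nat.add_one_ne_zero n)).mul_left (C c))
      convert this using 1
      ring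
    · have hd : X - C ξ ∣ G + 2 * Y * C c := by
        rw [dvd_iff_isRoot]
        simpa [hev] using hc
      obtain ⟨H, hH⟩ := hd
      refine ⟨H + C c ^ 2 * (X - C ξ) ^ n, ?_⟩
      linear_combination hG + (X - C ξ) ^ (n + 1) * hH

section Padic

variable {p : ℕ} [Fact p.Prime]

lemma exists_lift_of_norm_le {f : ℚ_[p][X]} (h : ∀ i, ‖f.coeff i‖ ≤ 1) :
    ∃ g : ℤ_[p][X], g.map (algebraMap ℤ_[p] ℚ_[p]) = f := by
  have : f ∈ Polynomial.lifts (algebraMap ℤ_[p] ℚ_[p]) :=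
    (Polynomial.lifts_iff_coeff_lifts f).mpr fun i => ⟨⟨_, h i⟩, rfl⟩
  exact (Polynomial.mem_lifts f).mp this

/-- If the norm of a function on `y² = x³ + a x + b` is integral, then so is the function. -/
lemma exists_lift_of_norm {a b : ℤ_[p]} {u v : ℚ_[p][X]} {G : ℤ_[p][X]}
    (h : u ^ 2 - (cubic a b).map (algebraMap ℤ_[p] ℚ_[p]) * v ^ 2
      = G.map (algebraMap ℤ_[p] ℚ_[p])) :
    ∃ u' v' : ℤ_[p][X], u'.map (algebraMap ℤ_[p] ℚ_[p]) = u ∧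
      v'.map (algebraMap ℤ_[p] ℚ_[p]) = v := by
  classical
  by_contra hcon
  -- `c` is a coefficient of largest norm. As in Gauss's lemma, dividing by `c` makes the pair
  -- primitive.
  have hcoef : ∃ c : ℚ_[p], (∃ i, u.coeff i = c ∨ v.coeff i = c) ∧
      (∀ i, ‖u.coeff i‖ ≤ ‖c‖) ∧ ∀ i, ‖v.coeff i‖ ≤ ‖c‖ := by
    set S : Finset ℚ_[p] := (Finset.range (max u.natDegree v.natDegree + 1)).image u.coeff ∪
      (Finset.range (max u.natDegree v.natDegree + 1)).image v.coeff with hS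
    obtain ⟨c, hc, hmax⟩ := S.exists_max_image (fun x => ‖x‖)
      ⟨u.coeff 0, by simp [hS]; exact Or.inl ⟨0, by omega, rfl⟩⟩
    refine ⟨c, ?_, ?_, ?_⟩
    · simp only [hS, Finset.mem_union, Finset.mem_image] at hc
      rcases hc with ⟨i, -, hi⟩ | ⟨i, -, hi⟩
      exacts [⟨i, Or.inl hi⟩, ⟨i, Or.inr hi⟩]
    · intro i
      by_cases hi : i ≤ max u.natDegree v.natDegree
      · exact hmax _ (by
          simp only [hS, Finset.mem_union, Finset.mem_image, Finset.mem_range]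
          exact Or.inl ⟨i, by omega, rfl⟩)
      · rw [coeff_eq_zero_of_natDegree_lt (lt_of_le_of_lt (le_max_left _ _) (not_le.mp hi))]
        simp
    · intro i
      by_cases hi : i ≤ max u.natDegree v.natDegree
      · exact hmax _ (by
          simp only [hS, Finset.mem_union, Finset.mem_image, Finset.mem_range]
          exact Or.inr ⟨i, by omega, rfl⟩)
      · rw [coeff_eq_zero_of_natDegree_lt (lt_of_le_of_lt (le_max_right _ _) (not_le.mp hi))]
        simp
  obtain ⟨c, ⟨i, hi⟩, hcu, hcv⟩ := hcoef
  have hc1 : 1 < ‖c‖ := by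
    by_contra! hle
    obtain ⟨u', hu'⟩ := exists_lift_of_norm_le fun i => (hcu i).trans hle
    obtain ⟨v', hv'⟩ := exists_lift_of_norm_le fun i => (hcv i).trans hle
    exact hcon ⟨u', v', hu', hv'⟩
  have hc0 : c ≠ 0 := by
    rintro rfl
    simp at hc1
    linarith
  have hscale : ∀ f : ℚ_[p][X], (∀ i, ‖f.coeff i‖ ≤ ‖c‖) →
      ∃ g : ℤ_[p][X], g.map (algebraMap ℤ_[p] ℚ_[p]) = C c⁻¹ * f := by
    intro f hf
    refine exists_lift_of_norm_le fun i => ?_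
    rw [coeff_C_mul, norm_mul, norm_inv, inv_mul_le_iff₀ (norm_pos_iff.mpr hc0), mul_one]
    exact hf i
  obtain ⟨U, hU⟩ := hscale u hcu
  obtain ⟨V, hV⟩ := hscale v hcv
  let d : ℤ_[p] := ⟨c⁻¹, by rw [norm_inv]; exact inv_le_one_of_one_le₀ hc1.le⟩
  have hd : algebraMap ℤ_[p] ℚ_[p] d = c⁻¹ := rfl
  -- Since `p` divides `d = c⁻¹`, the scaled norm vanishes modulo `p`. By parity of degrees `U` and
  -- `V` do too, although one of their coefficients is `1`.
  have heq : U ^ 2 - cubic a b * V ^ 2 = C (d ^ 2) * G := by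
    apply map_injective _ (algebraMap_inj (p := p))
    simp only [Polynomial.map_sub, Polynomial.map_mul, Polynomial.map_pow, hU, hV, map_C, map_pow, hd]
    rw [← h]
    ring
  have hd0 : PadicInt.toZMod d = 0 := by
    by_contra hne
    have h1 := PadicInt.isUnit_iff.mp ((isUnit_iff_toZMod d).mpr hne)
    have h2 : ‖d‖ = ‖c‖⁻¹ := norm_inv c
    rw [h2] at h1
    have := inv_lt_one_of_one_lt₀ hc1
    linarith
  have hred := congrArg (Polynomial.map (PadicInt.toZMod : ℤ_[p] →+* ZMod p)) heq
  simp only [Polynomial.map_sub, Polynomial.map_mul, Polynomial.map_pow, map_cubic, map_C, map_pow,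
    hd0] at hred
  simp only [ne_eq, OfNat.ofNat_ne_zero, not_false_eq_true, zero_pow, map_zero, zero_mul,
    sub_eq_zero] at hred
  obtain ⟨h1, h2⟩ := eq_zero_of_sq_eq_cubic_mul_sq hred
  have hone : ∀ (f : ℚ_[p][X]) (g : ℤ_[p][X]), g.map (algebraMap ℤ_[p] ℚ_[p]) = C c⁻¹ * f →
      f.coeff i = c → g.map (PadicInt.toZMod : ℤ_[p] →+* ZMod p) ≠ 0 := by
    intro f g hg hf h0
    have h1 := congrArg (fun q => coeff q i) hg
    simp only [coeff_map, coeff_C_mul, hf, inv_mul_cancel₀ hc0] at h1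
    have h2 : g.coeff i = 1 := algebraMap_inj (by rw [h1, map_one])
    have h3 := congrArg (fun q => coeff q i) h0
    simp [h2] at h3
  rcases hi with hi | hi
  · exact hone u U hU hi h1
  · exact hone v V hV hi h2

/-- A point of odd order `2 m + 3` on a curve over `ℤ_p` gives a torsion function over `ℤ_p`. -/
lemma exists_isTorsionFunction {a b ξ η : ℤ_[p]} {m : ℕ} (hη : IsUnit (2 * η))
    (h : (shortCurve (algebraMap ℤ_[p] ℚ_[p] a) (algebraMap ℤ_[p] ℚ_[p] b)).toAffine.Nonsingular
      (algebraMap ℤ_[p] ℚ_[p] ξ) (algebraMap ℤ_[p] ℚ_[p] η))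
    [DecidableEq ℚ_[p]] (hn : (2 * m + 3) • (Affine.Point.some _ _ h) = 0) :
    ∃ u v, IsTorsionFunction m a b ξ η u v := by
  obtain ⟨u, v, hvm, hvd, hud, hN, hY⟩ := exists_monic_function_of_torsion h hn
  obtain ⟨u, v, rfl, rfl⟩ := exists_lift_of_norm (a := a) (b := b) (u := u) (v := v)
    (G := -(X - C ξ) ^ (2 * m + 3)) (by rw [map_cubic, hN]; simp)
  have hinj := map_injective _ (algebraMap_inj (p := p))
  refine ⟨u, v, monic_of_injective algebraMap_inj hvm, ?_, ?_, ?_, ?_⟩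
  · rw [← hvd, natDegree_map_eq_of_injective algebraMap_inj]
  · rwa [natDegree_map_eq_of_injective algebraMap_inj] at hud
  · apply hinj
    simpa [map_cubic] using hN
  · have heq : η ^ 2 = ξ ^ 3 + a * ξ + b := by
      apply algebraMap_inj (p := p)
      simpa using equation_short_affine.mp h.1
    obtain ⟨Y, h1, h2⟩ := exists_expansion hη heq (2 * m + 2)
    refine ⟨Y, h1, h2, ?_⟩
    rw [← map_dvd_map _ algebraMap_inj ((monic_X_sub_C ξ).pow _)]
    have := hY (Y.map (algebraMap ℤ_[p] ℚ_[p]))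
      (by simpa using map_dvd (mapRingHom (algebraMap ℤ_[p] ℚ_[p])) h1)
      (by simpa [map_cubic] using map_dvd (mapRingHom (algebraMap ℤ_[p] ℚ_[p])) h2)
    simpa using this

end Padic

end TorsionFunctionExistence

/-! ### The bound `#𝔄_p ≤ p³`. -/

section Count

open WeierstrassCurve

lemma Δ_short {R : Type*} [CommRing R] (a b : R) :
    (shortCurve a b).Δ = -16 * (4 * a ^ 3 + 27 * b ^ 2) := by
  simp [shortCurve, WeierstrassCurve.Δ, WeierstrassCurve.b₂, WeierstrassCurve.b₄,
    WeierstrassCurve.b₆, WeierstrassCurve.b₈]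
  ring

lemma disc_ne_zero {F : Type*} [Field F] {a b : F} (h : (shortCurve a b).IsElliptic) :
    4 * a ^ 3 + 27 * b ^ 2 ≠ 0 := by
  intro h0
  have := h.isUnit
  rw [Δ_short, h0, mul_zero] at this
  exact not_isUnit_zero this

variable {p : ℕ} [Fact p.Prime] {a b : ℤ_[p]}

lemma prime_p : Prime (p : ℤ_[p]) := PadicInt.prime_p

lemma not_isUnit_iff_dvd {x : ℤ_[p]} : ¬ IsUnit x ↔ (p : ℤ_[p]) ∣ x := by
  rw [isUnit_iff_toZMod, not_not, toZMod_eq_zero_iff]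

/-- A point that does not reduce to the origin has integral affine coordinates. -/
lemma exists_affine_rep {hE : (shortCurve a b).IsElliptic} {T : PadicPoint a b}
    (hT : T ∉ redKer a b hE 0) : ∃ ξ η, Rep a b T ![ξ, η, 1] := by
  obtain ⟨v, hv⟩ := exists_rep T
  have hu : IsUnit (v 2) := by
    by_contra hz
    apply hT
    rw [not_isUnit_iff_dvd] at hz
    have hx : (p : ℤ_[p]) ∣ v 0 := by
      refine prime_p.dvd_of_dvd_pow (n := 3) ?_
      have := equation_short.mp hv.equation
      have e : v 0 ^ 3 = v 2 * (v 1 ^ 2 - a * v 0 * v 2 - b * v 2 ^ 2) := by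
        linear_combination -this
      rw [e]
      exact hz.mul_right _
    have hy : IsUnit (v 1) := by
      obtain ⟨i, hi⟩ := hv.2
      fin_cases i
      · exact absurd hi (not_isUnit_iff_dvd.mpr hx)
      · exact hi
      · exact absurd hi (not_isUnit_iff_dvd.mpr hz)
    refine ⟨v, hy.unit • ![0, 1, 0], hv, Rep.zero.smul _, fun i => ?_⟩
    fin_cases i <;> simp [Units.smul_def, hx, hz]
  refine ⟨((hu.unit⁻¹ : ℤ_[p]ˣ) : ℤ_[p]) * v 0, ((hu.unit⁻¹ : ℤ_[p]ˣ) : ℤ_[p]) * v 1, ?_⟩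
  convert hv.smul hu.unit⁻¹ using 1
  funext i
  fin_cases i
  · rfl
  · rfl
  · simp [Units.smul_def]

/-- If `p ∣ 2 η` then `T ≡ -T` modulo `p`, so `2 • T` reduces to the origin. As `p` is odd and `p •
T = 0`, so does `T`. -/
lemma isUnit_two_mul_of_torsion {hE : (shortCurve a b).IsElliptic} {m : ℕ} (hp : p = 2 * m + 3)
    {T : PadicPoint a b} (hT : T ∉ redKer a b hE 0) (hpT : p • T = 0) {ξ η : ℤ_[p]}
    (h : Rep a b T ![ξ, η, 1]) : IsUnit (2 * η) := by
  by_contra hn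
  rw [not_isUnit_iff_dvd] at hn
  have hc : Cong 1 T (-T) := by
    refine ⟨_, _, h, h.neg, fun i => ?_⟩
    fin_cases i
    · simp [Projective.neg]
    · simpa [Projective.neg, Projective.negY, shortCurve, ← two_mul] using hn
    · simp [Projective.neg]
  have h2 : 2 • T ∈ redKer a b hE 0 := by
    have := (sub_mem_redKer_iff (hE := hE)).mpr hc
    rwa [sub_neg_eq_add, ← two_nsmul] at this
  apply hT
  have h3 := AddSubgroup.neg_mem _ (AddSubgroup.nsmul_mem _ h2 (m + 1))
  have e : p • T = T + (m + 1) • (2 • T) := by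
    have e1 : p = 1 + 2 * (m + 1) := by omega
    calc p • T = (1 + 2 * (m + 1)) • T := congrArg (· • T) e1
      _ = T + (m + 1) • (2 • T) := by rw [add_nsmul, one_nsmul, mul_nsmul]
  rw [hpT] at e
  rwa [neg_eq_of_add_eq_zero_left e.symm] at h3

lemma exists_isTorsionFunction_of_rep (hE : (shortCurve a b).IsElliptic) {m : ℕ}
    (hp : p = 2 * m + 3) {T : PadicPoint a b} (hT : T ∉ redKer a b hE 0) (hpT : p • T = 0)
    {ξ η : ℤ_[p]} (h : Rep a b T ![ξ, η, 1]) : ∃ u v, IsTorsionFunction m a b ξ η u v := by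
  classical
  have hns := h.nonsingular
  rw [Projective.comp_fin3, map_one] at hns
  have haff := (Projective.nonsingular_some _ _).mp hns
  refine exists_isTorsionFunction (isUnit_two_mul_of_torsion hp hT hpT h) haff ?_
  have hlift : (shortCurve (algebraMap ℤ_[p] ℚ_[p] a)
      (algebraMap ℤ_[p] ℚ_[p] b)).toProjective.NonsingularLift
        ⟦![algebraMap ℤ_[p] ℚ_[p] ξ, algebraMap ℤ_[p] ℚ_[p] η, 1]⟧ := hns
  have hTeq : T = ⟨hlift⟩ := Projective.Point.ext (by
    rw [h.1, Projective.comp_fin3, map_one])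
  have e : Projective.Point.toAffineAddEquiv _ T = Affine.Point.some _ _ haff := by
    rw [hTeq]
    exact Projective.Point.toAffineLift_some hlift
  rw [← e, ← map_nsmul, ← hp, hpT, map_zero]

/-- Reduction modulo `p`, as a homomorphism to the points of a fixed curve over `𝔽_p`. -/
lemma exists_redHom (hE : (shortCurve a b).IsElliptic) {A B : ZMod p}
    (hA : PadicInt.toZMod a = A) (hB : PadicInt.toZMod b = B) :
    ∃ r : PadicPoint a b →+ ResiduePoint A B, r.ker = redKer a b hE 0 ∧
      ∀ T v, Rep a b T v → (r T).point = ⟦(PadicInt.toZMod : ℤ_[p] →+* ZMod p) ∘ v⟧ := by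
  subst hA hB
  exact ⟨redHom hE, ker_redHom hE, fun T v h => redHom_point hE h⟩

/-- Two curves over `ℤ_p` with the same ordinary reduction, both with a point of order `p`, have
points of order `p` with the same reduction. -/
lemma exists_torsion_same_reduction (h3 : 3 ≤ p) {a' b' : ℤ_[p]}
    (hE : (shortCurve a b).IsElliptic) (hE' : (shortCurve a' b').IsElliptic)
    (ha : (PadicInt.toZMod a' : ZMod p) = PadicInt.toZMod a)
    (hb : (PadicInt.toZMod b' : ZMod p) = PadicInt.toZMod b)
    {T : PadicPoint a b} (hT0 : T ≠ 0) (hT : p • T = 0)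
    {T' : PadicPoint a' b'} (hT0' : T' ≠ 0) (hT' : p • T' = 0) :
    ∃ (S : PadicPoint a' b') (ξ η ξ' η' : ℤ_[p]), T ∉ redKer a b hE 0 ∧ S ∉ redKer a' b' hE' 0 ∧
      p • S = 0 ∧ Rep a b T ![ξ, η, 1] ∧ Rep a' b' S ![ξ', η', 1] ∧
      (PadicInt.toZMod ξ' : ZMod p) = PadicInt.toZMod ξ ∧
      (PadicInt.toZMod η' : ZMod p) = PadicInt.toZMod η := by
  have hEp := isElliptic_map (PadicInt.toZMod : ℤ_[p] →+* ZMod p) hE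
  obtain ⟨r, hr, hrp⟩ := exists_redHom hE rfl rfl
  obtain ⟨r', hr', hrp'⟩ := exists_redHom hE' ha hb
  have hTn : T ∉ redKer a b hE 0 := fun h => hT0 (eq_zero_of_mem_redKer h hT)
  have hTn' : T' ∉ redKer a' b' hE' 0 := fun h => hT0' (eq_zero_of_mem_redKer h hT')
  have hx0 : r' T' ≠ 0 := fun h => hTn' (by rwa [← hr', AddMonoidHom.mem_ker])
  -- The `p`-torsion of `E(𝔽_p)` is cyclic, so a multiple of `T'` has the reduction of `T`.
  obtain ⟨k, hk⟩ := exists_nsmul_eq_of_torsion (card_residuePoint_lt h3 _ _) (x := r' T') (y := r T)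
    (by rw [← map_nsmul, hT', map_zero]) hx0 (by rw [← map_nsmul, hT, map_zero])
  rw [← map_nsmul] at hk
  have hS : k • T' ∉ redKer a' b' hE' 0 := by
    rw [← hr', AddMonoidHom.mem_ker, hk, ← AddMonoidHom.mem_ker, hr]
    exact hTn
  obtain ⟨ξ, η, h⟩ := exists_affine_rep hTn
  obtain ⟨ξ', η', h'⟩ := exists_affine_rep hS
  refine ⟨k • T', ξ, η, ξ', η', hTn, hS, by rw [nsmul_left_comm, hT', nsmul_zero], h, h', ?_⟩
  have h1 := hrp _ _ h
  have h2 := hrp' _ _ h'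
  rw [hk, h1] at h2
  obtain ⟨u, hu⟩ := Quotient.exact h2
  have u2 := congrFun hu 2
  have u1 := congrFun hu 1
  have u0 := congrFun hu 0
  simp [Units.smul_def] at u2 u1 u0
  rw [← u0, ← u1, u2]
  simp

open Polynomial in
lemma exists_eq_add_C_mul {f g : ℤ_[p][X]}
    (h : f.map (PadicInt.toZMod : ℤ_[p] →+* ZMod p) = g.map PadicInt.toZMod) :
    ∃ μ, g = f + C (p : ℤ_[p]) * μ := by
  have : C (p : ℤ_[p]) ∣ g - f := by
    rw [C_dvd_iff_dvd_coeff]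
    intro i
    rw [← toZMod_eq_zero_iff, coeff_sub, map_sub, sub_eq_zero, ← coeff_map, ← coeff_map, h]
  obtain ⟨μ, hμ⟩ := this
  exact ⟨μ, by rw [← hμ]; ring⟩

open Polynomial in
/-- Two lifts of a curve over `𝔽_p` that both have a point of order `p` differ, to first order, by a
change of variables. -/
theorem deformation_of_torsion (h5 : 5 ≤ p) {s t : ℤ_[p]}
    (hE : (shortCurve a b).IsElliptic) (hE' : (shortCurve (a + (p : ℤ_[p]) * s) (b + (p : ℤ_[p]) * t)).IsElliptic)
    (hT : ∃ T : PadicPoint a b, T ≠ 0 ∧ p • T = 0)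
    (hT' : ∃ T : PadicPoint (a + (p : ℤ_[p]) * s) (b + (p : ℤ_[p]) * t), T ≠ 0 ∧ p • T = 0) :
    ∃ κ : ZMod p, PadicInt.toZMod s = κ * (2 * PadicInt.toZMod a) ∧
      PadicInt.toZMod t = κ * (3 * PadicInt.toZMod b) := by
  have hodd : Odd p := (Fact.out : p.Prime).odd_of_ne_two (by omega)
  obtain ⟨m, hm⟩ : ∃ m, p = 2 * m + 3 := by
    obtain ⟨k, hk⟩ := hodd
    exact ⟨k - 1, by omega⟩
  obtain ⟨T, hT0, hT⟩ := hT
  obtain ⟨T', hT0', hT'⟩ := hT'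
  have ha : (PadicInt.toZMod (a + p * s) : ZMod p) = PadicInt.toZMod a := by simp
  have hb : (PadicInt.toZMod (b + p * t) : ZMod p) = PadicInt.toZMod b := by simp
  obtain ⟨S, ξ, η, ξ', η', hTn, hSn, hS, hr, hr', hξ, hη⟩ :=
    exists_torsion_same_reduction (by omega) hE hE' ha hb hT0 hT hT0' hT'
  obtain ⟨u, v, h⟩ := exists_isTorsionFunction_of_rep hE hm hTn hT hr
  obtain ⟨u', v', h'⟩ := exists_isTorsionFunction_of_rep hE' hm hSn hS hr'
  have hbar := h.map (PadicInt.toZMod : ℤ_[p] →+* ZMod p)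
  have hbar' := h'.map (PadicInt.toZMod : ℤ_[p] →+* ZMod p)
  rw [ha, hb, hξ, hη] at hbar'
  have h2η := isUnit_two_mul_of_torsion hm hTn hT hr
  rw [isUnit_iff_toZMod, map_mul, map_ofNat] at h2η
  obtain ⟨hu, hv⟩ := hbar.unique h2η hbar'
  obtain ⟨μ, rfl⟩ := exists_eq_add_C_mul hu
  obtain ⟨ν, rfl⟩ := exists_eq_add_C_mul hv
  obtain ⟨δ, rfl⟩ : ∃ δ, ξ' = ξ + p * δ := by
    have : (p : ℤ_[p]) ∣ ξ' - ξ := by rw [← toZMod_eq_zero_iff, map_sub, hξ, sub_self]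
    obtain ⟨δ, hδ⟩ := this
    exact ⟨δ, by rw [← hδ]; ring⟩
  have hp0 : (C (p : ℤ_[p]) : ℤ_[p][X]) ≠ 0 := C_ne_zero.mpr p_ne_zero
  -- Congruence modulo `p` becomes congruence modulo `p²` after taking `p`-th powers. This is why
  -- the displacement `δ` of the point drops out to first order.
  have hpow : (C (p : ℤ_[p]) : ℤ_[p][X]) ^ 2 ∣
      (X - C (ξ + p * δ)) ^ (2 * m + 3) - (X - C ξ) ^ (2 * m + 3) := by
    rw [← hm]
    have h1 : ((p : ℕ) : ℤ_[p][X]) ∣ (X - C (ξ + p * δ)) - (X - C ξ) :=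
      ⟨-C δ, by simp⟩
    have := dvd_sub_pow_of_dvd_sub h1 1
    rw [pow_one] at this
    rwa [C_eq_natCast]
  obtain ⟨H, hH⟩ := hpow
  -- The difference of the two norm equations, sorted by powers of `p`. Dividing by `p` and reducing
  -- leaves the linearized equation for `(μ, ν, s, t)`.
  have hmul : C (p : ℤ_[p]) * (2 * u * μ - (C s * X + C t) * v ^ 2 - 2 * cubic a b * v * ν)
      = C (p : ℤ_[p]) * (C (p : ℤ_[p]) * (-H - μ ^ 2 + cubic a b * ν ^ 2
        + (C s * X + C t) * (2 * v * ν + C (p : ℤ_[p]) * ν ^ 2))) := by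
    have e : cubic (a + p * s) (b + p * t) = cubic a b + C (p : ℤ_[p]) * (C s * X + C t) := by
      simp only [cubic, C_add, C_mul]
      ring
    have k := h'.norm_eq
    rw [e] at k
    linear_combination k - h.norm_eq - hH
  have hred := congrArg (Polynomial.map (PadicInt.toZMod : ℤ_[p] →+* ZMod p))
    (mul_left_cancel₀ hp0 hmul)
  simp [map_cubic] at hred
  refine hbar.deformation hm h5
    (disc_ne_zero (isElliptic_map (PadicInt.toZMod : ℤ_[p] →+* ZMod p) hE))
    (μ := μ.map PadicInt.toZMod) (ν := ν.map PadicInt.toZMod) ?_ ?_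
  · refine natDegree_map_le.trans ?_
    have h1 := natDegree_sub_le_of_le h'.natDegree_left h.natDegree_left
    rw [add_sub_cancel_left, natDegree_C_mul p_ne_zero, max_self] at h1
    exact h1
  · linear_combination hred

lemma mem_frakA_iff (h3 : 3 ≤ p) :
    (PadicInt.toZModPow 2 a, PadicInt.toZModPow 2 b) ∈ frakA p ↔
      (shortCurve a b).IsElliptic ∧ ∃ T : PadicPoint a b, T ≠ 0 ∧ p • T = 0 := by
  constructor
  · rintro ⟨_, hE', hr⟩
    have hE : (shortCurve a b).IsElliptic := ⟨by
      have := hE'.isUnit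
      rw [← shortCurve_map, map_Δ] at this
      exact isUnit_of_map_unit _ _ this⟩
    exact ⟨hE, (pRank_eq_two_iff h3 hE).mp hr⟩
  · rintro ⟨hE, hT⟩
    have hE' := isElliptic_map (PadicInt.toZModPow 2 : ℤ_[p] →+* ZMod (p ^ 2)) hE
    exact ⟨inferInstance, hE', (pRank_eq_two_iff h3 hE).mpr hT⟩

lemma toZModPow_p_mul_eq {x y : ℤ_[p]} (h : (PadicInt.toZMod x : ZMod p) = PadicInt.toZMod y) :
    PadicInt.toZModPow 2 ((p : ℤ_[p]) * x) = PadicInt.toZModPow 2 ((p : ℤ_[p]) * y) := by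
  rw [← sub_eq_zero, ← map_sub, toZModPow_eq_zero_iff, ← mul_sub, pow_two]
  refine mul_dvd_mul_left _ ?_
  rw [← toZMod_eq_zero_iff, map_sub, h, sub_self]

/-- At most `p³` of the `p⁴` pairs modulo `p²` give a group of `p`-rank `2`. -/
theorem ncard_frakA_le (h5 : 5 ≤ p) : (frakA p).ncard ≤ p ^ 3 := by
  classical
  have hfin : (frakA p).Finite := Set.toFinite _
  rw [Set.ncard_eq_toFinset_card _ hfin]
  have hdvd : p ∣ p ^ 2 := dvd_pow_self p two_ne_zero
  let c : ZMod (p ^ 2) →+* ZMod p := ZMod.castHom hdvd (ZMod p)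
  have hc : ∀ x : ℤ_[p], c (PadicInt.toZModPow 2 x) = PadicInt.toZMod x := by
    intro x
    obtain ⟨n, hn⟩ : ∃ n : ℕ, (PadicInt.toZMod x : ZMod p) = n :=
      ⟨_, (ZMod.natCast_zmod_val _).symm⟩
    obtain ⟨z, hz⟩ : (p : ℤ_[p]) ∣ x - n := by
      rw [← toZMod_eq_zero_iff, map_sub, hn, map_natCast, sub_self]
    obtain rfl := sub_eq_iff_eq_add.mp hz
    simp
  -- Count by fibres over the `p²` pairs modulo `p`. Once one member of a fibre is fixed, every
  -- other one is determined by `κ` in `ZMod p`, so a fibre has at most `p` members.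
  have h1 := Finset.card_le_mul_card_image (f := fun x : ZMod (p ^ 2) × ZMod (p ^ 2) => (c x.1, c x.2))
    hfin.toFinset p (by
      intro z hz
      obtain ⟨⟨A, B⟩, hAB, rfl⟩ := Finset.mem_image.mp hz
      rw [Set.Finite.mem_toFinset] at hAB
      obtain ⟨a, rfl⟩ := toZModPow_surjective 2 A
      obtain ⟨b, rfl⟩ := toZModPow_surjective 2 B
      obtain ⟨hE, hT⟩ := (mem_frakA_iff (by omega)).mp hAB
      have hsub : (hfin.toFinset.filter fun x => (c x.1, c x.2)
          = (c (PadicInt.toZModPow 2 a), c (PadicInt.toZModPow 2 b))) ⊆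
          Finset.univ.image (fun κ : ZMod p =>
            (PadicInt.toZModPow 2 a + PadicInt.toZModPow 2 ((p : ℤ_[p]) * ((κ.val : ℤ_[p]) * (2 * a))),
              PadicInt.toZModPow 2 b + PadicInt.toZModPow 2 ((p : ℤ_[p]) * ((κ.val : ℤ_[p]) * (3 * b))))) := by
        rintro ⟨A', B'⟩ hx
        rw [Finset.mem_filter, Set.Finite.mem_toFinset, Prod.mk.injEq] at hx
        obtain ⟨hx, hA, hB⟩ := hx
        obtain ⟨a', rfl⟩ := toZModPow_surjective 2 A'
        obtain ⟨b', rfl⟩ := toZModPow_surjective 2 B'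
        rw [hc, hc, ← sub_eq_zero, ← map_sub, toZMod_eq_zero_iff] at hA hB
        obtain ⟨s, hs⟩ := hA
        obtain ⟨t, ht⟩ := hB
        obtain rfl := sub_eq_iff_eq_add'.mp hs
        obtain rfl := sub_eq_iff_eq_add'.mp ht
        obtain ⟨hE', hT'⟩ := (mem_frakA_iff (by omega)).mp hx
        obtain ⟨κ, h1, h2⟩ := deformation_of_torsion h5 hE hE' hT hT'
        refine Finset.mem_image.mpr ⟨κ, Finset.mem_univ _, ?_⟩
        rw [← map_add, ← map_add, map_add, map_add, map_add _ b (p * t), map_add _ a (p * s),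
          toZModPow_p_mul_eq (x := s) (y := (κ.val : ℤ_[p]) * (2 * a)) (by rw [h1]; simp [map_ofNat]),
          toZModPow_p_mul_eq (x := t) (y := (κ.val : ℤ_[p]) * (3 * b)) (by rw [h2]; simp [map_ofNat])]
      refine (Finset.card_le_card hsub).trans (Finset.card_image_le.trans ?_)
      rw [Finset.card_univ, ZMod.card])
  refine h1.trans ?_
  have h2 := Finset.card_le_univ (Finset.image (fun x : ZMod (p ^ 2) × ZMod (p ^ 2) => (c x.1, c x.2))
    hfin.toFinset)
  rw [Fintype.card_prod, ZMod.card] at h2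
  calc p * _ ≤ p * (p * p) := Nat.mul_le_mul_left p h2
    _ = p ^ 3 := by ring

end Count

/-! ### Local torsion primes are detected modulo `p²`. -/

section GoodReduction

open WeierstrassCurve

variable {p : ℕ} [Fact p.Prime]

lemma curve_baseChange (m : ℤ × ℤ) : (curve m).baseChange ℚ_[p]
    = shortCurve (algebraMap ℤ_[p] ℚ_[p] (m.1 : ℤ_[p])) (algebraMap ℤ_[p] ℚ_[p] (m.2 : ℤ_[p])) := by
  rw [curve, WeierstrassCurve.baseChange, shortCurve_map]
  simp

/-- A unit discriminant has valuation `1`, the largest value an integral model allows, so minimality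
is automatic. -/
lemma hasGoodReduction_of_isElliptic {a b : ℤ_[p]} (hE : (shortCurve a b).IsElliptic) :
    HasGoodReduction ℤ_[p] (shortCurve (algebraMap ℤ_[p] ℚ_[p] a) (algebraMap ℤ_[p] ℚ_[p] b)) := by
  have hint : IsIntegral ℤ_[p]
      (shortCurve (algebraMap ℤ_[p] ℚ_[p] a) (algebraMap ℤ_[p] ℚ_[p] b)) :=
    ⟨shortCurve a b, by rw [WeierstrassCurve.baseChange, shortCurve_map]⟩
  have hval : (IsDiscreteValuationRing.maximalIdeal ℤ_[p]).valuation ℚ_[p]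
      (shortCurve (algebraMap ℤ_[p] ℚ_[p] a) (algebraMap ℤ_[p] ℚ_[p] b)).Δ = 1 := by
    rw [← shortCurve_map, map_Δ,
      IsDedekindDomain.HeightOneSpectrum.valuation_eq_one_iff_notMem]
    exact fun h => (IsLocalRing.mem_maximalIdeal _).mp h hE.isUnit
  have haux : valuation_Δ_aux ℤ_[p]
      (shortCurve (algebraMap ℤ_[p] ℚ_[p] a) (algebraMap ℤ_[p] ℚ_[p] b)) = ⟨1, le_rfl⟩ :=
    Subtype.ext ((valuation_Δ_aux_eq_of_isIntegral ℤ_[p] _).trans hval)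
  refine { val_Δ_maximal := ⟨by simpa only [one_smul] using hint, fun C _ _ => ?_⟩, goodReduction := hval }
  simp only [one_smul, haux]
  exact (valuation_Δ_aux ℤ_[p] _).2

/-- A nonminimal or singular reduction: if `p` divides the discriminant and the curve has good
reduction at `p`, then `p` divides both coefficients. -/
lemma dvd_of_hasGoodReductionAt (h5 : 5 ≤ p) {m : ℤ × ℤ}
    (hE : ¬ (shortCurve (m.1 : ℤ_[p]) (m.2 : ℤ_[p])).IsElliptic)
    (h : HasGoodReductionAt (curve m) p) : (p : ℤ) ∣ m.1 ∧ (p : ℤ) ∣ m.2 := by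
  have hpp : Prime (p : ℤ) := Nat.prime_iff_prime_int.mp (Fact.out : p.Prime)
  obtain ⟨C, hC⟩ := h
  have hint : IsIntegral ℤ_[p] (C • (curve m).baseChange ℚ_[p]) := inferInstance
  obtain ⟨W, hW⟩ := hint.integral
  have hΔ := hC.goodReduction
  rw [hW, WeierstrassCurve.baseChange, map_Δ,
    IsDedekindDomain.HeightOneSpectrum.valuation_eq_one_iff_notMem] at hΔ
  have hu : IsUnit W.Δ := by
    by_contra hn
    exact hΔ ((IsLocalRing.mem_maximalIdeal _).mpr hn)
  have e12 := congrArg WeierstrassCurve.Δ hW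
  have e4 := congrArg WeierstrassCurve.c₄ hW
  have e6 := congrArg WeierstrassCurve.c₆ hW
  rw [variableChange_Δ, curve_baseChange, WeierstrassCurve.baseChange, map_Δ, ← shortCurve_map,
    map_Δ] at e12
  rw [variableChange_c₄, curve_baseChange, WeierstrassCurve.baseChange, map_c₄, ← shortCurve_map,
    map_c₄] at e4
  rw [variableChange_c₆, curve_baseChange, WeierstrassCurve.baseChange, map_c₆, ← shortCurve_map,
    map_c₆] at e6
  set U : ℚ_[p] := ((C.u⁻¹ : ℚ_[p]ˣ) : ℚ_[p])
  have n12 := congrArg norm e12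
  have n4 := congrArg norm e4
  have n6 := congrArg norm e6
  rw [norm_mul, norm_pow] at n12 n4 n6
  have hd : ‖algebraMap ℤ_[p] ℚ_[p] (shortCurve (m.1 : ℤ_[p]) (m.2 : ℤ_[p])).Δ‖ < 1 := by
    have : ¬ IsUnit (shortCurve (m.1 : ℤ_[p]) (m.2 : ℤ_[p])).Δ := fun hn => hE ⟨hn⟩
    exact PadicInt.mem_nonunits.mp this
  have h12 : ‖algebraMap ℤ_[p] ℚ_[p] W.Δ‖ = 1 := PadicInt.isUnit_iff.mp hu
  rw [h12] at n12
  -- The good model has discriminant `U¹² Δ` of norm `1` while `‖Δ‖ < 1`. Integrality of `U⁴ c₄` and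
  -- `U⁶ c₆` then forces `p` to divide `c₄ = -48 a` and `c₆ = -864 b`.
  have hU : 1 < ‖U‖ := by
    by_contra! hle
    have := mul_lt_one_of_nonneg_of_lt_one_right (pow_le_one₀ (norm_nonneg U) hle (n := 12))
      (norm_nonneg _) hd
    linarith
  have key : ∀ (k : ℕ) (x : ℤ_[p]) (y : ℤ_[p]), k ≠ 0 →
      ‖U‖ ^ k * ‖algebraMap ℤ_[p] ℚ_[p] x‖ = ‖algebraMap ℤ_[p] ℚ_[p] y‖ → (p : ℤ_[p]) ∣ x := by
    intro k x y hk he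
    rw [← not_isUnit_iff_dvd]
    intro hx
    have h1 : ‖algebraMap ℤ_[p] ℚ_[p] x‖ = 1 := PadicInt.isUnit_iff.mp hx
    have h2 : ‖algebraMap ℤ_[p] ℚ_[p] y‖ ≤ 1 := y.2
    rw [h1, mul_one] at he
    have := one_lt_pow₀ hU hk
    linarith
  have d4 := key 4 _ _ (by norm_num) n4
  have d6 := key 6 _ _ (by norm_num) n6
  have c4 : (shortCurve (m.1 : ℤ_[p]) (m.2 : ℤ_[p])).c₄ = ((-48 * m.1 : ℤ) : ℤ_[p]) := by
    simp [shortCurve, WeierstrassCurve.c₄, WeierstrassCurve.b₂, WeierstrassCurve.b₄]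
    ring
  have c6 : (shortCurve (m.1 : ℤ_[p]) (m.2 : ℤ_[p])).c₆ = ((-864 * m.2 : ℤ) : ℤ_[p]) := by
    simp [shortCurve, WeierstrassCurve.c₆, WeierstrassCurve.b₂, WeierstrassCurve.b₄,
      WeierstrassCurve.b₆]
    ring
  have hcast : ∀ z : ℤ, (p : ℤ_[p]) ∣ (z : ℤ_[p]) → (p : ℤ) ∣ z := by
    intro z hz
    rwa [← toZMod_eq_zero_iff, map_intCast, ZMod.intCast_zmod_eq_zero_iff_dvd] at hz
  have hsmall : ∀ n : ℕ, n.primeFactors ⊆ {2, 3} → n ≠ 0 → ¬ (p : ℤ) ∣ (n : ℤ) := by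
    intro n hn hn0 hd
    have : p ∈ n.primeFactors :=
      Nat.mem_primeFactors.mpr ⟨Fact.out, by exact_mod_cast hd, hn0⟩
    have := hn this
    simp at this
    omega
  rw [c4] at d4
  rw [c6] at d6
  refine ⟨(hpp.dvd_or_dvd (hcast _ d4)).resolve_left ?_, (hpp.dvd_or_dvd (hcast _ d6)).resolve_left ?_⟩
  · rw [dvd_neg]
    refine hsmall 48 ?_ (by norm_num)
    rw [show 48 = 2 ^ 4 * 3 by norm_num, Nat.primeFactors_mul (by norm_num) (by norm_num),
      Nat.primeFactors_prime_pow (by norm_num) Nat.prime_two, Nat.prime_three.primeFactors]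
    rfl
  · rw [dvd_neg]
    refine hsmall 864 ?_ (by norm_num)
    rw [show 864 = 2 ^ 5 * 3 ^ 3 by norm_num, Nat.primeFactors_mul (by norm_num) (by norm_num),
      Nat.primeFactors_prime_pow (by norm_num) Nat.prime_two,
      Nat.primeFactors_prime_pow (by norm_num) Nat.prime_three]
    rfl

/-- For `p ≥ 5`, whether `p` is a local torsion prime of `E_{a,b}` depends only on `a` and `b` modulo
`p²`, unless `p` divides both. -/
theorem mem_localTorsionPrimes_iff (h5 : 5 ≤ p) {m : ℤ × ℤ}
    (hm : ¬ ((p : ℤ) ∣ m.1 ∧ (p : ℤ) ∣ m.2)) :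
    p ∈ localTorsionPrimes (curve m) ↔
      ((m.1 : ZMod (p ^ 2)), (m.2 : ZMod (p ^ 2))) ∈ frakA p := by
  have h := mem_frakA_iff (p := p) (a := (m.1 : ℤ_[p])) (b := (m.2 : ℤ_[p])) (by omega)
  rw [map_intCast, map_intCast] at h
  rw [h]
  have hiff : p ∈ localTorsionPrimes (curve m) ↔ HasGoodReductionAt (curve m) p ∧
      ∃ T : PadicPoint (m.1 : ℤ_[p]) (m.2 : ℤ_[p]), T ≠ 0 ∧ p • T = 0 := by
    -- The type of points depends on the curve, so the equality of curves is transported through the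
    -- whole existential statement.
    have htransport : ∀ {W W' : WeierstrassCurve ℚ_[p]}, W = W' →
        ((∃ P : W.toProjective.Point, P ≠ 0 ∧ p • P = 0) ↔
          ∃ P : W'.toProjective.Point, P ≠ 0 ∧ p • P = 0) := by
      rintro _ _ rfl
      rfl
    rw [← htransport (curve_baseChange m)]
    exact ⟨fun ⟨_, h⟩ => h, fun h => ⟨inferInstance, h⟩⟩
  rw [hiff]
  refine and_congr_left fun _ => ⟨fun hg => ?_, fun hE => ?_⟩
  · by_contra hE
    exact hm (dvd_of_hasGoodReductionAt h5 hE hg)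
  · refine ⟨1, ?_⟩
    rw [one_smul, curve_baseChange]
    exact hasGoodReduction_of_isElliptic hE

end GoodReduction

/-! ### Pairs of integers in a rectangle with prescribed residues. -/

section Counting

open Finset

/-- The integers of absolute value less than `K`. -/
noncomputable def symInterval (K : ℤ) : Finset ℤ := Ioo (-K) K

lemma mem_symInterval {K a : ℤ} : a ∈ symInterval K ↔ |a| < K := by
  rw [symInterval, mem_Ioo, abs_lt]

lemma card_symInterval {K : ℤ} (hK : 0 < K) : ((symInterval K).card : ℝ) = 2 * K - 1 := by
  have : ((symInterval K).card : ℤ) = 2 * K - 1 := by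
    rw [symInterval, Int.card_Ioo]
    omega
  exact_mod_cast this

lemma symInterval_eq_Ioc (K : ℤ) : symInterval K = Ioc (-K) (K - 1) := by
  ext a
  simp only [symInterval, mem_Ioo, mem_Ioc]
  omega

/-- An interval contains as many elements of each residue class as expected, up to one. -/
lemma abs_card_filter_modEq_sub_le {K : ℤ} (hK : 0 < K) {M : ℤ} (hM : 0 < M) (v : ℤ) :
    |(((symInterval K).filter (· ≡ v [ZMOD M])).card : ℝ) - (symInterval K).card / M| ≤ 1 := by
  have h := Int.Ioc_filter_modEq_card (-K) (K - 1) hM v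
  rw [← symInterval_eq_Ioc] at h
  set x : ℚ := ((K - 1 : ℤ) - v) / (M : ℚ) with hx
  set y : ℚ := ((-K : ℤ) - v) / (M : ℚ) with hy
  have hM' : (0 : ℚ) < M := by exact_mod_cast hM
  have hK' : (1 : ℚ) ≤ K := by exact_mod_cast hK
  have hxy : x - y = (2 * K - 1) / M := by
    rw [hx, hy]
    push_cast
    field_simp
    ring
  have hyx : y ≤ x := by
    have : 0 ≤ x - y := by
      rw [hxy]
      exact div_nonneg (by linarith) hM'.le
    linarith
  rw [max_eq_left (sub_nonneg.mpr (Int.floor_le_floor hyx))] at h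
  have h1 := Int.floor_le x
  have h2 := Int.lt_floor_add_one x
  have h3 := Int.floor_le y
  have h4 := Int.lt_floor_add_one y
  have hc : ((((symInterval K).filter (· ≡ v [ZMOD M])).card : ℤ) : ℚ) = ⌊x⌋ - ⌊y⌋ := by
    rw [h]
    push_cast
    rfl
  have key : |((((symInterval K).filter (· ≡ v [ZMOD M])).card : ℤ) : ℚ) - (2 * K - 1) / M| ≤ 1 := by
    rw [hc, ← hxy, abs_le]
    constructor <;> linarith
  rw [card_symInterval hK]
  exact_mod_cast key

/-- The same for two coprime moduli. -/
lemma abs_card_filter_zmod_sub_le {K : ℤ} (hK : 0 < K) {m k : ℕ} (hm : m ≠ 0) (hk : k ≠ 0)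
    (hmk : m.Coprime k) (x : ZMod m) (y : ZMod k) :
    |(((symInterval K).filter (fun a : ℤ => (a : ZMod m) = x ∧ (a : ZMod k) = y)).card : ℝ)
      - (symInterval K).card / ((m * k : ℕ) : ℝ)| ≤ 1 := by
  obtain ⟨v, hv⟩ := ZMod.intCast_surjective ((ZMod.chineseRemainder hmk).symm (x, y))
  have hiff : ∀ a : ℤ, ((a : ZMod m) = x ∧ (a : ZMod k) = y) ↔ a ≡ v [ZMOD ((m * k : ℕ) : ℤ)] := by
    intro a
    rw [← ZMod.intCast_eq_intCast_iff, hv, RingEquiv.eq_symm_apply, map_intCast, Prod.ext_iff]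
    rfl
  have h := abs_card_filter_modEq_sub_le hK (M := ((m * k : ℕ) : ℤ))
    (by exact_mod_cast Nat.pos_of_ne_zero (mul_ne_zero hm hk)) v
  rw [filter_congr (fun a _ => hiff a)]
  simpa using h

/-- With both factors known up to `1`, each product `g h` differs from `x y` by at most `x + y + 1`.
-/
lemma abs_sum_mul_sub_le {ι : Type*} (S : Finset ι) (g h : ι → ℝ) {x y : ℝ} (hx : 0 ≤ x)
    (hy : 0 ≤ y) (hg : ∀ i ∈ S, |g i - x| ≤ 1) (hh : ∀ i ∈ S, |h i - y| ≤ 1) :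
    |∑ i ∈ S, g i * h i - S.card * (x * y)| ≤ S.card * (x + y + 1) := by
  have h1 : ∑ i ∈ S, g i * h i - S.card * (x * y) = ∑ i ∈ S, (g i * h i - x * y) := by
    rw [sum_sub_distrib, sum_const, nsmul_eq_mul]
  rw [h1, ← nsmul_eq_mul]
  refine (abs_sum_le_sum_abs _ _).trans (sum_le_card_nsmul _ _ _ fun i hi => ?_)
  have e : g i * h i - x * y = (g i - x) * (h i - y) + x * (h i - y) + (g i - x) * y := by ring
  rw [e]
  have a1 := hg i hi
  have a2 := hh i hi
  have b1 : |(g i - x) * (h i - y)| ≤ 1 := by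
    rw [abs_mul]
    exact mul_le_one₀ a1 (abs_nonneg _) a2
  have b2 : |x * (h i - y)| ≤ x := by
    rw [abs_mul, abs_of_nonneg hx]
    exact mul_le_of_le_one_right hx a2
  have b3 : |(g i - x) * y| ≤ y := by
    rw [abs_mul, abs_of_nonneg hy]
    exact mul_le_of_le_one_left hy a1
  have := abs_add_three ((g i - x) * (h i - y)) (x * (h i - y)) ((g i - x) * y)
  linarith

/-- The pairs of integers in a rectangle. -/
noncomputable abbrev rect (K L : ℤ) : Finset (ℤ × ℤ) := symInterval K ×ˢ symInterval L

/-- Reduction of a pair of integers. -/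
def redPair (m : ℕ) (ω : ℤ × ℤ) : ZMod m × ZMod m := (ω.1, ω.2)

open Classical in
/-- The number of pairs in a rectangle that satisfy conditions modulo two coprime moduli. -/
lemma abs_card_filter_redPair_sub_le {K L : ℤ} (hK : 0 < K) (hL : 0 < L) {m k : ℕ} (hm : m ≠ 0)
    (hk : k ≠ 0) (hmk : m.Coprime k) (A : Finset (ZMod m × ZMod m)) (B : Finset (ZMod k × ZMod k)) :
    |(((rect K L).filter fun ω => redPair m ω ∈ A ∧ redPair k ω ∈ B).card : ℝ)
        - (A.card * B.card) * ((symInterval K).card / ((m * k : ℕ) : ℝ)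
          * ((symInterval L).card / ((m * k : ℕ) : ℝ)))| ≤
      (A.card * B.card) * ((symInterval K).card / ((m * k : ℕ) : ℝ)
        + (symInterval L).card / ((m * k : ℕ) : ℝ) + 1) := by
  have hcard : (((rect K L).filter fun ω => redPair m ω ∈ A ∧ redPair k ω ∈ B).card : ℝ)
      = ∑ z ∈ A ×ˢ B,
        (((symInterval K).filter
          (fun a : ℤ => (a : ZMod m) = z.1.1 ∧ (a : ZMod k) = z.2.1)).card : ℝ) *
        (((symInterval L).filter
          (fun a : ℤ => (a : ZMod m) = z.1.2 ∧ (a : ZMod k) = z.2.2)).card : ℝ) := by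
    rw [card_eq_sum_card_fiberwise (f := fun ω => (redPair m ω, redPair k ω)) (t := A ×ˢ B)
      (fun ω hω => by
        have := (mem_filter.mp (mem_coe.mp hω)).2
        exact mem_coe.mpr (mem_product.mpr this))]
    push_cast
    refine sum_congr rfl fun z hz => ?_
    rw [← Nat.cast_mul, ← card_product, ← filter_product]
    refine congrArg (fun s : Finset (ℤ × ℤ) => (s.card : ℝ)) (Finset.ext fun ω => ?_)
    rw [mem_product] at hz
    rw [mem_filter, mem_filter, mem_filter]
    simp only [redPair, Prod.ext_iff]
    constructor
    · rintro ⟨⟨h1, -⟩, ⟨h2, h3⟩, h4, h5⟩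
      exact ⟨h1, ⟨h2, h4⟩, h3, h5⟩
    · rintro ⟨h1, ⟨h2, h4⟩, h3, h5⟩
      refine ⟨⟨h1, ?_, ?_⟩, ⟨h2, h3⟩, h4, h5⟩
      · rw [h2, h3]; exact hz.1
      · rw [h4, h5]; exact hz.2
  rw [hcard]
  have := abs_sum_mul_sub_le (A ×ˢ B) _ _ (x := (symInterval K).card / ((m * k : ℕ) : ℝ))
    (y := (symInterval L).card / ((m * k : ℕ) : ℝ)) (by positivity) (by positivity)
    (fun z _ => abs_card_filter_zmod_sub_le hK hm hk hmk z.1.1 z.2.1)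
    (fun z _ => abs_card_filter_zmod_sub_le hL hm hk hmk z.1.2 z.2.2)
  rw [card_product] at this
  push_cast at this ⊢
  exact this

/-- This makes the counting error relative: it is at most `3 M / Z` times the main term, and the
factor `M / Z` is what survives in the covariances. -/
lemma error_le {n n' M Z : ℝ} (hM : 0 < M) (hMZ : M ≤ Z) (hn : Z ≤ n) (hn' : Z ≤ n') :
    n / M + n' / M + 1 ≤ 3 * (n * n' / M ^ 2) * (M / Z) := by
  have hZ : 0 < Z := hM.trans_le hMZ
  have h1 : n / M ≤ n * n' / M ^ 2 * (M / Z) := by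
    have e : n * n' / M ^ 2 * (M / Z) = n / M * (n' / Z) := by field_simp
    rw [e]
    exact le_mul_of_one_le_right (by apply div_nonneg <;> linarith) ((one_le_div hZ).mpr hn')
  have h2 : n' / M ≤ n * n' / M ^ 2 * (M / Z) := by
    have e : n * n' / M ^ 2 * (M / Z) = n' / M * (n / Z) := by field_simp
    rw [e]
    exact le_mul_of_one_le_right (by apply div_nonneg <;> linarith) ((one_le_div hZ).mpr hn)
  have h3 : 1 ≤ n * n' / M ^ 2 * (M / Z) := by
    have e : n * n' / M ^ 2 * (M / Z) = n / M * (n' / Z) := by field_simp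
    rw [e]
    exact one_le_mul_of_one_le_of_one_le ((one_le_div hM).mpr (hMZ.trans hn))
      ((one_le_div hZ).mpr hn')
  linarith

/-- The proportion of a set of pairs modulo `m`. -/
noncomputable def proportion {m : ℕ} (A : Finset (ZMod m × ZMod m)) : ℝ := A.card / (m : ℝ) ^ 2

open Classical in
lemma abs_card_pair_sub_le {K L : ℤ} (hK : 0 < K) (hL : 0 < L) {m k : ℕ} (hm : m ≠ 0)
    (hk : k ≠ 0) (hmk : m.Coprime k) {Z : ℝ} (hZ : (m : ℝ) * k ≤ Z)
    (hZK : Z ≤ (symInterval K).card) (hZL : Z ≤ (symInterval L).card)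
    (A : Finset (ZMod m × ZMod m)) (B : Finset (ZMod k × ZMod k)) :
    |(((rect K L).filter fun ω => redPair m ω ∈ A ∧ redPair k ω ∈ B).card : ℝ)
        - proportion A * proportion B * (rect K L).card| ≤
      3 * (proportion A * proportion B * (rect K L).card) * (m * k / Z) := by
  have h := abs_card_filter_redPair_sub_le hK hL hm hk hmk A B
  have hm' : (0 : ℝ) < m := by exact_mod_cast Nat.pos_of_ne_zero hm
  have hk' : (0 : ℝ) < k := by exact_mod_cast Nat.pos_of_ne_zero hk
  have he := error_le (mul_pos hm' hk') hZ hZK hZL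
  push_cast at h
  have e1 : proportion A * proportion B * (rect K L).card
      = (A.card * B.card) * ((symInterval K).card / ((m : ℝ) * k)
          * ((symInterval L).card / ((m : ℝ) * k))) := by
    rw [proportion, proportion, card_product]
    push_cast
    field_simp
  rw [e1]
  refine h.trans ((mul_le_mul_of_nonneg_left he (by positivity)).trans (le_of_eq ?_))
  field_simp

open Classical in
lemma abs_card_single_sub_le {K L : ℤ} (hK : 0 < K) (hL : 0 < L) {m : ℕ} (hm : m ≠ 0)
    {Z : ℝ} (hZ : (m : ℝ) ≤ Z)
    (hZK : Z ≤ (symInterval K).card) (hZL : Z ≤ (symInterval L).card)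
    (A : Finset (ZMod m × ZMod m)) :
    |(((rect K L).filter fun ω => redPair m ω ∈ A).card : ℝ) - proportion A * (rect K L).card| ≤
      3 * (proportion A * (rect K L).card) * (m / Z) := by
  have h := abs_card_pair_sub_le hK hL hm one_ne_zero (Nat.coprime_one_right m) (by simpa using hZ)
    hZK hZL A univ
  have h1 : proportion (univ : Finset (ZMod 1 × ZMod 1)) = 1 := by
    simp [proportion]
  simpa [h1] using h

end Counting

/-! ### The second moment of the number of local torsion primes. -/

section SecondMoment

open Finset

/-- The primes up to `Y`. -/
noncomputable def primesUpTo (Y : ℝ) : Finset ℕ := (range (⌊Y⌋₊ + 1)).filter Nat.Prime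

lemma mem_primesUpTo {Y : ℝ} (hY : 0 ≤ Y) {p : ℕ} : p ∈ primesUpTo Y ↔ p.Prime ∧ (p : ℝ) ≤ Y := by
  rw [primesUpTo, mem_filter, mem_range, Nat.lt_succ_iff, Nat.le_floor_iff hY, and_comm]

lemma card_primesUpTo_le {Y : ℝ} (hY : 0 ≤ Y) : ((primesUpTo Y).card : ℝ) ≤ Y := by
  have h : primesUpTo Y ⊆ Ioc 0 ⌊Y⌋₊ := fun p hp => by
    rw [primesUpTo, mem_filter, mem_range] at hp
    exact mem_Ioc.mpr ⟨hp.2.pos, by omega⟩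
  have := card_le_card h
  rw [Nat.card_Ioc, Nat.sub_zero] at this
  exact (Nat.cast_le.mpr this).trans (Nat.floor_le hY)

/-- Summing over all positive integers up to `⌊Y⌋₊ + 1`, the term `1` gives `1` and the rest
telescopes to at most `1`. The extra integer keeps the range nonempty. -/
lemma sum_inv_sq_primesUpTo_le (Y : ℝ) : ∑ p ∈ primesUpTo Y, ((p : ℝ) ^ 2)⁻¹ ≤ 2 := by
  have h : primesUpTo Y ⊆ Ioc 0 (⌊Y⌋₊ + 1) := fun p hp => by
    rw [primesUpTo, mem_filter, mem_range] at hp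
    exact mem_Ioc.mpr ⟨hp.2.pos, by omega⟩
  refine (sum_le_sum_of_subset_of_nonneg h fun _ _ _ => by positivity).trans ?_
  have h1 := sum_Ioc_inv_sq_le_sub (α := ℝ) one_ne_zero (Nat.le_add_left 1 ⌊Y⌋₊)
  have h2 : Ioc 0 (⌊Y⌋₊ + 1) = insert 1 (Ioc 1 (⌊Y⌋₊ + 1)) := by
    ext i
    simp only [mem_Ioc, mem_insert]
    omega
  rw [h2, sum_insert (by simp)]
  have h3 : (0 : ℝ) ≤ ((⌊Y⌋₊ + 1 : ℕ) : ℝ)⁻¹ := by positivity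
  rw [Nat.cast_one, inv_one] at h1
  rw [Nat.cast_one, one_pow, inv_one]
  linarith

lemma finite_frakA (p : ℕ) : (frakA p).Finite := by
  by_cases hp : p.Prime
  · have : NeZero (p ^ 2) := ⟨pow_ne_zero 2 hp.ne_zero⟩
    exact Set.toFinite _
  · refine Set.finite_empty.subset ?_
    rintro m ⟨h, -⟩
    exact hp h.out

/-- The proportion of `𝔄_p` among all pairs. -/
noncomputable def localDensity (p : ℕ) : ℝ := ((frakA p).ncard : ℝ) / (p : ℝ) ^ 4

lemma mainTerm_eq_sum (Y : ℝ) : mainTerm Y = ∑ p ∈ primesUpTo Y, localDensity p := rfl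

lemma localDensity_nonneg (p : ℕ) : 0 ≤ localDensity p := by
  rw [localDensity]
  positivity

lemma proportion_frakA (p : ℕ) : proportion (finite_frakA p).toFinset = localDensity p := by
  rw [proportion, localDensity, Set.ncard_eq_toFinset_card _ (finite_frakA p)]
  push_cast
  ring_nf

lemma localDensity_le_one {p : ℕ} (hp : p.Prime) : localDensity p ≤ 1 := by
  have : NeZero (p ^ 2) := ⟨pow_ne_zero 2 hp.ne_zero⟩
  rw [localDensity, div_le_one (by have := hp.pos; positivity)]
  have h := Set.ncard_le_ncard (Set.subset_univ (frakA p))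
  rw [Set.ncard_univ, Nat.card_prod, Nat.card_zmod] at h
  calc ((frakA p).ncard : ℝ) ≤ ((p ^ 2 * p ^ 2 : ℕ) : ℝ) := by exact_mod_cast h
    _ = (p : ℝ) ^ 4 := by push_cast; ring

/-- For `p ≥ 5` the density is at most `1 / p`; the factor `3` covers `p = 2` and `p = 3` by the
trivial bound. -/
lemma localDensity_mul_sq_le {p : ℕ} (hp : p.Prime) : localDensity p * (p : ℝ) ^ 2 ≤ 3 * p := by
  have hpos : (0 : ℝ) < p := by exact_mod_cast hp.pos
  by_cases h5 : 5 ≤ p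
  · have : Fact p.Prime := ⟨hp⟩
    have h : ((frakA p).ncard : ℝ) ≤ (p : ℝ) ^ 3 := by exact_mod_cast ncard_frakA_le h5
    have h1 : localDensity p * (p : ℝ) ^ 2 ≤ p := by
      rw [localDensity, div_mul_eq_mul_div, div_le_iff₀ (by positivity)]
      calc ((frakA p).ncard : ℝ) * (p : ℝ) ^ 2 ≤ (p : ℝ) ^ 3 * (p : ℝ) ^ 2 := by gcongr
        _ = p * (p : ℝ) ^ 4 := by ring
    linarith
  · have h3 : p ≤ 3 := by
      by_contra hc
      have : p = 4 := by omega
      rw [this] at hp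
      revert hp
      norm_num
    have h3' : (p : ℝ) ≤ 3 := by exact_mod_cast h3
    calc localDensity p * (p : ℝ) ^ 2 ≤ 1 * (p : ℝ) ^ 2 := by
          gcongr
          exact localDensity_le_one hp
      _ = (p : ℝ) * p := by ring
      _ ≤ 3 * p := by gcongr

lemma sum_localDensity_mul_sq_le {Y : ℝ} (hY : 0 ≤ Y) :
    ∑ p ∈ primesUpTo Y, localDensity p * (p : ℝ) ^ 2 ≤ 3 * Y ^ 2 := by
  calc ∑ p ∈ primesUpTo Y, localDensity p * (p : ℝ) ^ 2 ≤ ∑ p ∈ primesUpTo Y, 3 * Y := by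
        refine sum_le_sum fun p hp => ?_
        obtain ⟨h1, h2⟩ := (mem_primesUpTo hY).mp hp
        exact (localDensity_mul_sq_le h1).trans (by gcongr)
    _ = (primesUpTo Y).card * (3 * Y) := by rw [sum_const, nsmul_eq_mul]
    _ ≤ Y * (3 * Y) := by
        gcongr
        exact card_primesUpTo_le hY
    _ = 3 * Y ^ 2 := by ring

open Classical in
/-- The indicator of the pairs whose reduction modulo `p²` lies in `𝔄_p`. -/
noncomputable def hit (p : ℕ) (ω : ℤ × ℤ) : ℝ := if redPair (p ^ 2) ω ∈ frakA p then 1 else 0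

open Classical in
/-- The indicator of the pairs of integers that are both divisible by `p`. -/
noncomputable def degenerate (p : ℕ) (ω : ℤ × ℤ) : ℝ := if redPair p ω = 0 then 1 else 0

open Classical in
lemma sum_hit (R : Finset (ℤ × ℤ)) (p : ℕ) : ∑ ω ∈ R, hit p ω
    = (R.filter fun ω => redPair (p ^ 2) ω ∈ (finite_frakA p).toFinset).card := by
  simp only [hit, sum_boole, Set.Finite.mem_toFinset]

open Classical in
lemma sum_hit_mul_hit (R : Finset (ℤ × ℤ)) (p q : ℕ) : ∑ ω ∈ R, hit p ω * hit q ω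
    = (R.filter fun ω => redPair (p ^ 2) ω ∈ (finite_frakA p).toFinset ∧
        redPair (q ^ 2) ω ∈ (finite_frakA q).toFinset).card := by
  simp only [hit, ite_zero_mul_ite_zero, mul_one, sum_boole, Set.Finite.mem_toFinset]

lemma hit_mul_self (p : ℕ) (ω : ℤ × ℤ) : hit p ω * hit p ω = hit p ω := by
  rw [hit]
  split_ifs <;> simp

section Box

variable {K L : ℤ} {Y : ℝ}

lemma abs_sum_hit_sub_le (hK : 0 < K) (hL : 0 < L) {Z : ℝ} (hZK : Z ≤ (symInterval K).card)
    (hZL : Z ≤ (symInterval L).card) {p : ℕ} (hp : p.Prime) (hZ : (p : ℝ) ^ 2 ≤ Z) :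
    |∑ ω ∈ rect K L, hit p ω - localDensity p * (rect K L).card| ≤
      3 * (localDensity p * (rect K L).card) * ((p : ℝ) ^ 2 / Z) := by
  have := abs_card_single_sub_le hK hL (m := p ^ 2) (pow_ne_zero 2 hp.ne_zero) (Z := Z)
    (by exact_mod_cast hZ) hZK hZL (finite_frakA p).toFinset
  rw [proportion_frakA] at this
  rw [sum_hit]
  exact_mod_cast this

lemma abs_sum_hit_mul_hit_sub_le (hK : 0 < K) (hL : 0 < L) {Z : ℝ}
    (hZK : Z ≤ (symInterval K).card) (hZL : Z ≤ (symInterval L).card) {p q : ℕ} (hp : p.Prime)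
    (hq : q.Prime) (hpq : p ≠ q) (hZ : (p : ℝ) ^ 2 * (q : ℝ) ^ 2 ≤ Z) :
    |∑ ω ∈ rect K L, hit p ω * hit q ω - localDensity p * localDensity q * (rect K L).card| ≤
      3 * (localDensity p * localDensity q * (rect K L).card)
        * ((p : ℝ) ^ 2 * (q : ℝ) ^ 2 / Z) := by
  have := abs_card_pair_sub_le hK hL (m := p ^ 2) (k := q ^ 2) (pow_ne_zero 2 hp.ne_zero)
    (pow_ne_zero 2 hq.ne_zero) (((Nat.coprime_primes hp hq).mpr hpq).pow 2 2) (Z := Z)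
    (by exact_mod_cast hZ) hZK hZL (finite_frakA p).toFinset (finite_frakA q).toFinset
  rw [proportion_frakA, proportion_frakA] at this
  rw [sum_hit_mul_hit]
  exact_mod_cast this

lemma sum_hit_le (hK : 0 < K) (hL : 0 < L) {Z : ℝ} (hZK : Z ≤ (symInterval K).card)
    (hZL : Z ≤ (symInterval L).card) {p : ℕ} (hp : p.Prime) (hZ : (p : ℝ) ^ 2 ≤ Z) :
    ∑ ω ∈ rect K L, hit p ω ≤ 4 * (localDensity p * (rect K L).card) := by
  have h := (abs_le.mp (abs_sum_hit_sub_le hK hL hZK hZL hp hZ)).2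
  have hp0 : (0 : ℝ) < (p : ℝ) ^ 2 := by have := hp.pos; positivity
  have h1 : (p : ℝ) ^ 2 / Z ≤ 1 := (div_le_one (hp0.trans_le hZ)).mpr hZ
  have h0 : 0 ≤ 3 * (localDensity p * (rect K L).card) := by
    have := localDensity_nonneg p
    positivity
  have := mul_le_of_le_one_right h0 h1
  linarith

/-- Since `hit` is an indicator, its centered square is linear in `hit`: the sum of `hit` costs `4`
and the constant `δ_p² ≤ δ_p` costs `1`. -/
lemma sum_centered_sq_le (hK : 0 < K) (hL : 0 < L) {Z : ℝ} (hZK : Z ≤ (symInterval K).card)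
    (hZL : Z ≤ (symInterval L).card) {p : ℕ} (hp : p.Prime) (hZ : (p : ℝ) ^ 2 ≤ Z) :
    ∑ ω ∈ rect K L, (hit p ω - localDensity p) * (hit p ω - localDensity p) ≤
      5 * (localDensity p * (rect K L).card) := by
  have e : ∀ ω, (hit p ω - localDensity p) * (hit p ω - localDensity p)
      = (1 - 2 * localDensity p) * hit p ω + localDensity p ^ 2 := fun ω => by
    linear_combination hit_mul_self p ω
  simp only [e]
  rw [sum_add_distrib, ← mul_sum, sum_const, nsmul_eq_mul]
  have h := sum_hit_le hK hL hZK hZL hp hZ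
  have h0 := localDensity_nonneg p
  have h1 := localDensity_le_one hp
  have hs : 0 ≤ ∑ ω ∈ rect K L, hit p ω := sum_nonneg fun ω _ => by
    rw [hit]
    split_ifs <;> norm_num
  have hN : (0 : ℝ) ≤ (rect K L).card := by positivity
  have h2 : localDensity p ^ 2 * (rect K L).card ≤ localDensity p * (rect K L).card := by
    gcongr
    nlinarith
  nlinarith [mul_nonneg h0 hs]

/-- The main terms of the covariance cancel. Three relative errors of at most `3 p² q² / Z` remain.
-/
lemma sum_centered_mul_le (hK : 0 < K) (hL : 0 < L) {Z : ℝ} (hZK : Z ≤ (symInterval K).card)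
    (hZL : Z ≤ (symInterval L).card) {p q : ℕ} (hp : p.Prime)
    (hq : q.Prime) (hpq : p ≠ q) (hZ : (p : ℝ) ^ 2 * (q : ℝ) ^ 2 ≤ Z) :
    ∑ ω ∈ rect K L, (hit p ω - localDensity p) * (hit q ω - localDensity q) ≤
      9 * (localDensity p * localDensity q * (rect K L).card)
        * ((p : ℝ) ^ 2 * (q : ℝ) ^ 2 / Z) := by
  have e : ∀ ω, (hit p ω - localDensity p) * (hit q ω - localDensity q)
      = hit p ω * hit q ω - localDensity q * hit p ω - localDensity p * hit q ω
        + localDensity p * localDensity q := fun ω => by ring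
  simp only [e]
  rw [sum_add_distrib, sum_sub_distrib, sum_sub_distrib, ← mul_sum, ← mul_sum, sum_const,
    nsmul_eq_mul]
  have hp1 : (1 : ℝ) ≤ (p : ℝ) ^ 2 := one_le_pow₀ (by exact_mod_cast hp.one_lt.le)
  have hq1 : (1 : ℝ) ≤ (q : ℝ) ^ 2 := one_le_pow₀ (by exact_mod_cast hq.one_lt.le)
  have hpZ : (p : ℝ) ^ 2 ≤ (p : ℝ) ^ 2 * (q : ℝ) ^ 2 := le_mul_of_one_le_right (by positivity) hq1
  have hqZ : (q : ℝ) ^ 2 ≤ (p : ℝ) ^ 2 * (q : ℝ) ^ 2 := le_mul_of_one_le_left (by positivity) hp1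
  have hZ0 : 0 < Z := by linarith
  have h1 := (abs_le.mp (abs_sum_hit_mul_hit_sub_le hK hL hZK hZL hp hq hpq hZ)).2
  have h2 := (abs_le.mp (abs_sum_hit_sub_le hK hL hZK hZL hp (hpZ.trans hZ))).1
  have h3 := (abs_le.mp (abs_sum_hit_sub_le hK hL hZK hZL hq (hqZ.trans hZ))).1
  have hδp := localDensity_nonneg p
  have hδq := localDensity_nonneg q
  set N : ℝ := ((rect K L).card : ℝ)
  have hN : 0 ≤ N := by positivity
  have b2 : 3 * (localDensity p * N) * ((p : ℝ) ^ 2 / Z)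
      ≤ 3 * (localDensity p * N) * ((p : ℝ) ^ 2 * (q : ℝ) ^ 2 / Z) := by gcongr
  have b3 : 3 * (localDensity q * N) * ((q : ℝ) ^ 2 / Z)
      ≤ 3 * (localDensity q * N) * ((p : ℝ) ^ 2 * (q : ℝ) ^ 2 / Z) := by gcongr
  have c2 := mul_le_mul_of_nonneg_left ((neg_le_neg b2).trans h2) hδq
  have c3 := mul_le_mul_of_nonneg_left ((neg_le_neg b3).trans h3) hδp
  linarith

/-- The second moment of the number of primes `p ≤ Y` at which a pair reduces into `𝔄_p`. -/
lemma sum_sq_sum_hit_sub_le (hK : 0 < K) (hL : 0 < L) (hY : 1 ≤ Y)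
    (hZK : Y ^ 4 ≤ (symInterval K).card) (hZL : Y ^ 4 ≤ (symInterval L).card) :
    ∑ ω ∈ rect K L, (∑ p ∈ primesUpTo Y, hit p ω - mainTerm Y) ^ 2 ≤
      (rect K L).card * (5 * mainTerm Y + 81) := by
  have hY0 : 0 ≤ Y := by linarith
  set N : ℝ := ((rect K L).card : ℝ)
  have hN : 0 ≤ N := by positivity
  have e : ∀ ω, (∑ p ∈ primesUpTo Y, hit p ω - mainTerm Y) ^ 2
      = ∑ p ∈ primesUpTo Y, ∑ q ∈ primesUpTo Y,
        (hit p ω - localDensity p) * (hit q ω - localDensity q) := fun ω => by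
    rw [mainTerm_eq_sum, ← sum_sub_distrib, sq, sum_mul_sum]
  simp only [e]
  rw [sum_comm]
  have hb : ∀ p ∈ primesUpTo Y,
      ∑ ω ∈ rect K L, ∑ q ∈ primesUpTo Y,
          (hit p ω - localDensity p) * (hit q ω - localDensity q) ≤
        5 * (localDensity p * N) + ∑ q ∈ primesUpTo Y, 9 * N / Y ^ 4 *
          ((localDensity p * (p : ℝ) ^ 2) * (localDensity q * (q : ℝ) ^ 2)) := by
    intro p hp
    obtain ⟨hp1, hp2⟩ := (mem_primesUpTo hY0).mp hp
    have hδp := localDensity_nonneg p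
    rw [sum_comm, ← add_sum_erase _ _ hp]
    refine add_le_add (sum_centered_sq_le hK hL hZK hZL hp1 ?_) ?_
    · calc (p : ℝ) ^ 2 ≤ Y ^ 2 := by gcongr
        _ ≤ Y ^ 4 := pow_le_pow_right₀ hY (by norm_num)
    · refine le_trans ?_ (sum_le_sum_of_subset_of_nonneg (erase_subset p _) fun q _ _ => ?_)
      · refine sum_le_sum fun q hq => ?_
        obtain ⟨hqp, hq⟩ := mem_erase.mp hq
        obtain ⟨hq1, hq2⟩ := (mem_primesUpTo hY0).mp hq
        refine (sum_centered_mul_le hK hL hZK hZL hp1 hq1 (Ne.symm hqp) ?_).trans (le_of_eq ?_)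
        · calc (p : ℝ) ^ 2 * (q : ℝ) ^ 2 ≤ Y ^ 2 * Y ^ 2 := by gcongr
            _ = Y ^ 4 := by ring
        · ring
      · have hδq := localDensity_nonneg q
        positivity
  refine (sum_le_sum hb).trans ?_
  rw [sum_add_distrib, ← mul_sum, ← sum_mul, ← mainTerm_eq_sum]
  simp only [← mul_sum]
  rw [← sum_mul]
  set S := ∑ p ∈ primesUpTo Y, localDensity p * (p : ℝ) ^ 2 with hS
  have hS0 : 0 ≤ S := sum_nonneg fun p _ => mul_nonneg (localDensity_nonneg p) (by positivity)
  have hS1 : S ≤ 3 * Y ^ 2 := sum_localDensity_mul_sq_le hY0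
  -- Here `S ≤ 3 Y²`, which rests on `#𝔄_p ≤ p³`, exactly balances `Y⁴`.
  have h2 : 9 * N / Y ^ 4 * (S * S) ≤ 81 * N := by
    have hY4 : 0 < Y ^ 4 := by positivity
    rw [div_mul_eq_mul_div, div_le_iff₀ hY4]
    calc 9 * N * (S * S) ≤ 9 * N * ((3 * Y ^ 2) * (3 * Y ^ 2)) := by gcongr
      _ = 81 * N * Y ^ 4 := by ring
  linarith

open Classical in
/-- The second moment of the number of primes `p ≤ Y` that divide both integers. -/
lemma sum_sq_sum_degenerate_le (hK : 0 < K) (hL : 0 < L) (hY : 1 ≤ Y)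
    (hZK : Y ^ 4 ≤ (symInterval K).card) (hZL : Y ^ 4 ≤ (symInterval L).card) :
    ∑ ω ∈ rect K L, (∑ p ∈ primesUpTo Y, degenerate p ω) ^ 2 ≤ 24 * (rect K L).card := by
  have hY0 : 0 ≤ Y := by linarith
  have hY24 : Y ^ 2 ≤ Y ^ 4 := pow_le_pow_right₀ hY (by norm_num)
  have hY14 : Y ≤ Y ^ 4 := le_self_pow₀ hY (by norm_num)
  set N : ℝ := ((rect K L).card : ℝ)
  have hN : 0 ≤ N := by positivity
  have hdeg : ∀ p ω, degenerate p ω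
      = if redPair p ω ∈ ({0} : Finset (ZMod p × ZMod p)) then 1 else 0 := fun p ω => by
    simp only [degenerate, mem_singleton]
  have hprop : ∀ p : ℕ, proportion ({0} : Finset (ZMod p × ZMod p)) = ((p : ℝ) ^ 2)⁻¹ := fun p => by
    rw [proportion, card_singleton, Nat.cast_one, one_div]
  have hdiag : ∀ p ∈ primesUpTo Y, ∑ ω ∈ rect K L, degenerate p ω * degenerate p ω ≤
      4 * N * ((p : ℝ) ^ 2)⁻¹ := by
    intro p hp
    obtain ⟨hp1, hp2⟩ := (mem_primesUpTo hY0).mp hp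
    have h := (abs_le.mp (abs_card_single_sub_le hK hL hp1.ne_zero (hp2.trans hY14) hZK hZL
      ({0} : Finset (ZMod p × ZMod p)))).2
    have h1 : (p : ℝ) / Y ^ 4 ≤ 1 := (div_le_one (by positivity)).mpr (hp2.trans hY14)
    simp only [hdeg, ite_zero_mul_ite_zero, mul_one, and_self, sum_boole]
    rw [hprop] at h
    have h0 : 0 ≤ 3 * (((p : ℝ) ^ 2)⁻¹ * N) := by positivity
    have := mul_le_of_le_one_right h0 h1
    linarith
  have hoff : ∀ p ∈ primesUpTo Y, ∀ q ∈ primesUpTo Y, p ≠ q →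
      ∑ ω ∈ rect K L, degenerate p ω * degenerate q ω ≤
      4 * N * (((p : ℝ) ^ 2)⁻¹ * ((q : ℝ) ^ 2)⁻¹) := by
    intro p hp q hq hpq
    obtain ⟨hp1, hp2⟩ := (mem_primesUpTo hY0).mp hp
    obtain ⟨hq1, hq2⟩ := (mem_primesUpTo hY0).mp hq
    have hle : (p : ℝ) * q ≤ Y ^ 4 := by
      calc (p : ℝ) * q ≤ Y * Y := by gcongr
        _ = Y ^ 2 := by ring
        _ ≤ Y ^ 4 := hY24
    have h := (abs_le.mp (abs_card_pair_sub_le hK hL hp1.ne_zero hq1.ne_zero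
      ((Nat.coprime_primes hp1 hq1).mpr hpq) hle hZK hZL
      ({0} : Finset (ZMod p × ZMod p)) ({0} : Finset (ZMod q × ZMod q)))).2
    have h1 : (p : ℝ) * q / Y ^ 4 ≤ 1 := (div_le_one (by positivity)).mpr hle
    simp only [hdeg, ite_zero_mul_ite_zero, mul_one, sum_boole]
    rw [hprop, hprop] at h
    have h0 : 0 ≤ 3 * (((p : ℝ) ^ 2)⁻¹ * ((q : ℝ) ^ 2)⁻¹ * N) := by positivity
    have := mul_le_of_le_one_right h0 h1
    linarith
  have e : ∀ ω, (∑ p ∈ primesUpTo Y, degenerate p ω) ^ 2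
      = ∑ p ∈ primesUpTo Y, ∑ q ∈ primesUpTo Y, degenerate p ω * degenerate q ω := fun ω => by
    rw [sq, sum_mul_sum]
  simp only [e]
  rw [sum_comm]
  have hb : ∀ p ∈ primesUpTo Y,
      ∑ ω ∈ rect K L, ∑ q ∈ primesUpTo Y, degenerate p ω * degenerate q ω ≤
        4 * N * ((p : ℝ) ^ 2)⁻¹
          + ∑ q ∈ primesUpTo Y, 4 * N * (((p : ℝ) ^ 2)⁻¹ * ((q : ℝ) ^ 2)⁻¹) := by
    intro p hp
    rw [sum_comm, ← add_sum_erase _ _ hp]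
    refine add_le_add (hdiag p hp) ?_
    refine le_trans (sum_le_sum fun q hq => ?_)
      (sum_le_sum_of_subset_of_nonneg (erase_subset p _) fun q _ _ => by positivity)
    obtain ⟨hqp, hq⟩ := mem_erase.mp hq
    exact hoff p hp q hq (Ne.symm hqp)
  refine (sum_le_sum hb).trans ?_
  rw [sum_add_distrib]
  simp only [← mul_sum]
  rw [← sum_mul]
  have hS1 := sum_inv_sq_primesUpTo_le Y
  set S := ∑ p ∈ primesUpTo Y, ((p : ℝ) ^ 2)⁻¹
  have hS0 : 0 ≤ S := sum_nonneg fun p _ => by positivity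
  calc 4 * N * S + 4 * N * (S * S) ≤ 4 * N * 2 + 4 * N * (2 * 2) := by gcongr
    _ = 24 * N := by ring

open Classical in
lemma localTorsionCount_eq (E : WeierstrassCurve ℚ) (hY : 0 ≤ Y) : (localTorsionCount E Y : ℝ)
    = ∑ p ∈ primesUpTo Y, if p ∈ localTorsionPrimes E then 1 else 0 := by
  rw [sum_boole, localTorsionCount, ← Set.ncard_coe_finset]
  congr 2
  ext p
  simp only [Set.mem_ofPred_eq, coe_filter, mem_primesUpTo hY]
  constructor
  · rintro ⟨h1, h2⟩
    obtain ⟨h, -⟩ := id h1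
    exact ⟨⟨h.out, h2⟩, h1⟩
  · rintro ⟨⟨-, h2⟩, h1⟩
    exact ⟨h1, h2⟩

/-- The count and the sum of `hit` can disagree only at primes below `5`, crudely bounded by `5` in
number, and at primes dividing both coefficients. -/
lemma abs_localTorsionCount_sub_le (hY : 0 ≤ Y) (ω : ℤ × ℤ) :
    |(localTorsionCount (curve ω) Y : ℝ) - ∑ p ∈ primesUpTo Y, hit p ω| ≤
      5 + ∑ p ∈ primesUpTo Y, degenerate p ω := by
  classical
  rw [localTorsionCount_eq _ hY, ← sum_sub_distrib]
  have h5 : ∑ p ∈ primesUpTo Y, (if p < 5 then (1 : ℝ) else 0) ≤ 5 := by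
    rw [sum_boole]
    have : (primesUpTo Y).filter (· < 5) ⊆ range 5 := fun p hp => mem_range.mpr (mem_filter.mp hp).2
    exact_mod_cast card_le_card this
  refine (abs_sum_le_sum_abs _ _).trans (le_trans ?_ (add_le_add_left h5 _))
  rw [← sum_add_distrib]
  refine sum_le_sum fun p hp => ?_
  have : Fact p.Prime := ⟨((mem_primesUpTo hY).mp hp).1⟩
  have h01 : ∀ P Q : Prop, |(if P then (1 : ℝ) else 0) - (if Q then 1 else 0)| ≤ 1 := by
    intro P Q
    split_ifs <;> norm_num
  by_cases hlt : p < 5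
  · have := h01 (p ∈ localTorsionPrimes (curve ω)) (redPair (p ^ 2) ω ∈ frakA p)
    have h0 : 0 ≤ degenerate p ω := by
      rw [degenerate]
      split_ifs <;> norm_num
    rw [if_pos hlt, hit]
    linarith
  · rw [if_neg hlt, zero_add]
    by_cases hd : redPair p ω = 0
    · rw [degenerate, if_pos hd, hit]
      exact h01 _ _
    · have hm : ¬ ((p : ℤ) ∣ ω.1 ∧ (p : ℤ) ∣ ω.2) := by
        rw [← ZMod.intCast_zmod_eq_zero_iff_dvd, ← ZMod.intCast_zmod_eq_zero_iff_dvd]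
        exact fun h => hd (Prod.ext h.1 h.2)
      have := mem_localTorsionPrimes_iff (not_lt.mp hlt) hm
      rw [degenerate, if_neg hd, hit, redPair]
      simp only [this]
      simp

/-- The second moment of the number of local torsion primes up to `Y`. -/
lemma sum_sq_localTorsionCount_sub_le (hK : 0 < K) (hL : 0 < L) (hY : 1 ≤ Y)
    (hZK : Y ^ 4 ≤ (symInterval K).card) (hZL : Y ^ 4 ≤ (symInterval L).card) :
    ∑ ω ∈ rect K L, ((localTorsionCount (curve ω) Y : ℝ) - mainTerm Y) ^ 2 ≤
      (rect K L).card * (10 * mainTerm Y + 358) := by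
  have h1 := sum_sq_sum_hit_sub_le hK hL hY hZK hZL
  have h2 := sum_sq_sum_degenerate_le hK hL hY hZK hZL
  have hb : ∀ ω ∈ rect K L, ((localTorsionCount (curve ω) Y : ℝ) - mainTerm Y) ^ 2 ≤
      2 * (∑ p ∈ primesUpTo Y, hit p ω - mainTerm Y) ^ 2
        + 4 * (∑ p ∈ primesUpTo Y, degenerate p ω) ^ 2 + 100 := by
    intro ω _
    have h := abs_localTorsionCount_sub_le (Y := Y) (by linarith) ω
    set X : ℝ := (localTorsionCount (curve ω) Y : ℝ)
    set H := ∑ p ∈ primesUpTo Y, hit p ω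
    set W := ∑ p ∈ primesUpTo Y, degenerate p ω
    -- By `(s + t)² ≤ 2 s² + 2 t²`, used twice. Summing, `2 · 81 + 4 · 24 + 100 = 358`.
    have h3 : (X - H) ^ 2 ≤ (5 + W) ^ 2 := sq_le_sq' (abs_le.mp h).1 (abs_le.mp h).2
    nlinarith [sq_nonneg ((X - H) - (H - mainTerm Y)), sq_nonneg (5 - W)]
  refine (sum_le_sum hb).trans ?_
  rw [sum_add_distrib, sum_add_distrib, ← mul_sum, ← mul_sum, sum_const, nsmul_eq_mul]
  linarith

end Box

end SecondMoment

/-! ### Chebyshev's inequality in a box. -/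

section Exceptional

open Finset

lemma exists_localDensity_pos {Y : ℝ} (h : 0 < mainTerm Y) :
    ∃ p ∈ primesUpTo Y, 0 < localDensity p := by
  by_contra! hc
  rw [mainTerm_eq_sum] at h
  exact h.not_ge (sum_nonpos hc)

lemma two_le_of_mainTerm_pos {Y : ℝ} (hY : 0 ≤ Y) (h : 0 < mainTerm Y) : 2 ≤ Y := by
  obtain ⟨p, hp, -⟩ := exists_localDensity_pos h
  obtain ⟨h1, h2⟩ := (mem_primesUpTo hY).mp hp
  have : (2 : ℝ) ≤ p := by exact_mod_cast h1.two_le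
  linarith

/-- The positive values of `P(Y)` are bounded away from zero. -/
lemma exists_le_mainTerm : ∃ ε : ℝ, 0 < ε ∧ ∀ Y : ℝ, 0 < mainTerm Y → ε ≤ mainTerm Y := by
  classical
  by_cases h : ∃ p : ℕ, p.Prime ∧ 0 < localDensity p
  -- `P` is a nondecreasing step function; its first positive value is the density at the least
  -- prime where that is positive. No value of `#𝔄_p` has to be computed.
  · refine ⟨localDensity (Nat.find h), (Nat.find_spec h).2, fun Y hY => ?_⟩
    obtain ⟨q, hq, hq0⟩ := exists_localDensity_pos hY
    rw [primesUpTo, mem_filter, mem_range] at hq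
    have hle := Nat.find_min' h ⟨hq.2, hq0⟩
    rw [mainTerm_eq_sum]
    refine single_le_sum (f := localDensity) (fun p _ => localDensity_nonneg p) ?_
    rw [primesUpTo, mem_filter, mem_range]
    exact ⟨hle.trans_lt hq.1, (Nat.find_spec h).1⟩
  · refine ⟨1, one_pos, fun Y hY => ?_⟩
    obtain ⟨q, hq, hq0⟩ := exists_localDensity_pos hY
    rw [primesUpTo, mem_filter] at hq
    exact absurd ⟨q, hq.2, hq0⟩ h

lemma box_eq_rect (C D : ℝ) : box C D = rect ⌈C⌉ ⌈D⌉ := by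
  ext m
  rw [mem_coe, mem_product, mem_symInterval, mem_symInterval, Int.lt_ceil, Int.lt_ceil]
  push_cast
  rfl

lemma finite_box (C D : ℝ) : (box C D).Finite := by
  rw [box_eq_rect]
  exact finite_toSet _

lemma ncard_box (C D : ℝ) : (box C D).ncard = (rect ⌈C⌉ ⌈D⌉).card := by
  rw [box_eq_rect, Set.ncard_coe_finset]

lemma ncard_box_pos {C D : ℝ} (hC : 0 < C) (hD : 0 < D) : 0 < (box C D).ncard := by
  rw [Set.ncard_pos (finite_box C D)]
  exact ⟨0, by simpa using hC, by simpa using hD⟩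

lemma le_card_symInterval {C : ℝ} (hC : 1 ≤ C) : C ≤ (symInterval ⌈C⌉).card := by
  have h1 : C ≤ ⌈C⌉ := Int.le_ceil C
  rw [card_symInterval (Int.ceil_pos.mpr (by linarith))]
  linarith

/-- Chebyshev's inequality for the number of local torsion primes. -/
lemma ncard_exceptional_mul_le {Y β C D : ℝ} (hY : 1 ≤ Y) (hP : 0 < mainTerm Y) (hβ : 0 < β)
    (hC : Y ^ 4 < C) (hD : Y ^ 4 < D) :
    (exceptional Y β C D).ncard * (β ^ 2 * mainTerm Y) ≤
      (box C D).ncard * (10 * mainTerm Y + 358) := by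
  classical
  have hY4 : 1 ≤ Y ^ 4 := one_le_pow₀ hY
  have hC1 : 1 ≤ C := by linarith
  have hD1 : 1 ≤ D := by linarith
  have h := sum_sq_localTorsionCount_sub_le (K := ⌈C⌉) (L := ⌈D⌉) (Int.ceil_pos.mpr (by linarith))
    (Int.ceil_pos.mpr (by linarith)) hY (hC.le.trans (le_card_symInterval hC1))
    (hD.le.trans (le_card_symInterval hD1))
  have he : exceptional Y β C D
      = ((rect ⌈C⌉ ⌈D⌉).filter fun m => ¬ IsTypical Y β m : Finset (ℤ × ℤ)) := by
    rw [exceptional, box_eq_rect, coe_filter]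
    rfl
  rw [ncard_box, he, Set.ncard_coe_finset]
  refine le_trans ?_ h
  rw [← nsmul_eq_mul]
  refine (card_nsmul_le_sum _ _ _ fun m hm => ?_).trans
    (sum_le_sum_of_subset_of_nonneg (filter_subset _ _) fun _ _ _ => sq_nonneg _)
  have h1 : β * √(mainTerm Y) ≤ |(localTorsionCount (curve m) Y : ℝ) - mainTerm Y| :=
    not_lt.mp (mem_filter.mp hm).2
  calc β ^ 2 * mainTerm Y = (β * √(mainTerm Y)) ^ 2 := by rw [mul_pow, Real.sq_sqrt hP.le]
    _ ≤ |(localTorsionCount (curve m) Y : ℝ) - mainTerm Y| ^ 2 := by gcongr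
    _ = _ := sq_abs _

/-- The lower bound `ε` for `P(Y)` turns the additive constant `358` into a multiple of `P(Y)`, so
the constant does not depend on `Y`. -/
lemma exists_ncard_exceptional_le : ∃ c : ℝ, 0 < c ∧ ∀ Y : ℝ, 0 < Y → 0 < mainTerm Y →
    ∀ β : ℝ, 0 < β → ∀ C D : ℝ, Y ^ 4 < C → Y ^ 4 < D →
      ((exceptional Y β C D).ncard : ℝ) ≤ c / β ^ 2 * (box C D).ncard := by
  obtain ⟨ε, hε, hle⟩ := exists_le_mainTerm
  refine ⟨10 + 358 / ε, by positivity, fun Y hY hP β hβ C D hC hD => ?_⟩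
  have hY1 : 1 ≤ Y := by
    have := two_le_of_mainTerm_pos hY.le hP
    linarith
  have h := ncard_exceptional_mul_le hY1 hP hβ hC hD
  have h1 : 10 * mainTerm Y + 358 ≤ (10 + 358 / ε) * mainTerm Y := by
    have : 358 ≤ 358 / ε * mainTerm Y := by
      rw [div_mul_eq_mul_div, le_div_iff₀ hε]
      have := hle Y hP
      linarith
    linarith
  have h2 : ((exceptional Y β C D).ncard : ℝ) * (β ^ 2 * mainTerm Y)
      ≤ (box C D).ncard * ((10 + 358 / ε) * mainTerm Y) := h.trans (by gcongr)
  rw [div_mul_eq_mul_div, le_div_iff₀ (by positivity)]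
  refine le_of_mul_le_mul_right ?_ hP
  linarith

end Exceptional

/-! ### From boxes to the density of elliptic curves ordered by height. -/

section Density

open Finset

-- For `l ≥ 2` one has `l⁻⁴ ≤ l⁻² / 4`, and the sum of `l⁻²` over `l ≥ 2` is at most `1`.
open Classical in
lemma card_filter_exists_pow_four_dvd_le (T : ℕ) :
    (((Ioc 0 T).filter fun a => ∃ l : ℕ, l.Prime ∧ l ^ 4 ∣ a).card : ℝ) ≤ T / 4 := by
  rcases Nat.eq_zero_or_pos T with rfl | hT
  · simp
  have hsub : ((Ioc 0 T).filter fun a => ∃ l : ℕ, l.Prime ∧ l ^ 4 ∣ a) ⊆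
      (Ioc 1 T).biUnion fun l => (Ioc 0 T).filter (l ^ 4 ∣ ·) := by
    intro a ha
    obtain ⟨h1, l, hl, hla⟩ := mem_filter.mp ha
    obtain ⟨h2, h3⟩ := mem_Ioc.mp h1
    have hlT : l ≤ T := (Nat.le_self_pow (by norm_num) l).trans ((Nat.le_of_dvd h2 hla).trans h3)
    exact mem_biUnion.mpr ⟨l, mem_Ioc.mpr ⟨hl.one_lt, hlT⟩, mem_filter.mpr ⟨h1, hla⟩⟩
  have h1 := (card_le_card hsub).trans card_biUnion_le
  simp only [Nat.Ioc_filter_dvd_card_eq_div] at h1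
  have h2 := sum_Ioc_inv_sq_le_sub (α := ℝ) one_ne_zero hT
  have h3 : (0 : ℝ) ≤ (T : ℝ)⁻¹ := by positivity
  calc _ ≤ ((∑ l ∈ Ioc 1 T, T / l ^ 4 : ℕ) : ℝ) := by exact_mod_cast h1
    _ ≤ ∑ l ∈ Ioc 1 T, (T / 4 : ℝ) * ((l : ℝ) ^ 2)⁻¹ := by
        push_cast
        refine sum_le_sum fun l hl => Nat.cast_div_le.trans ?_
        have hl2 : (2 : ℝ) ≤ l := by exact_mod_cast (mem_Ioc.mp hl).1
        push_cast
        rw [div_mul_eq_mul_div, ← div_eq_mul_inv, div_div]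
        gcongr
        nlinarith [mul_nonneg (sq_nonneg (l : ℝ)) (by nlinarith : (0 : ℝ) ≤ (l : ℝ) ^ 2 - 4)]
    _ = (T / 4 : ℝ) * ∑ l ∈ Ioc 1 T, ((l : ℝ) ^ 2)⁻¹ := by rw [mul_sum]
    _ ≤ (T / 4 : ℝ) * 1 := by
        gcongr
        rw [Nat.cast_one, inv_one] at h2
        linarith
    _ = T / 4 := mul_one _

open Classical in
/-- At most a quarter of the integers in a symmetric interval are nonzero and divisible by the fourth
power of a prime. -/
lemma card_filter_symInterval_le {K : ℤ} (hK : 0 < K) :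
    (((symInterval K).filter fun a : ℤ => a ≠ 0 ∧ ∃ l : ℕ, l.Prime ∧ (l : ℤ) ^ 4 ∣ a).card : ℝ)
      ≤ (symInterval K).card / 4 := by
  obtain ⟨T, hT⟩ := Int.eq_ofNat_of_zero_le (show 0 ≤ K - 1 by omega)
  have h := card_le_mul_card_image_of_maps_to (f := Int.natAbs)
    (s := (symInterval K).filter fun a : ℤ => a ≠ 0 ∧ ∃ l : ℕ, l.Prime ∧ (l : ℤ) ^ 4 ∣ a)
    (t := (Ioc 0 T).filter fun a => ∃ l : ℕ, l.Prime ∧ l ^ 4 ∣ a)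
    (fun a ha => by
      obtain ⟨h1, h2, l, hl, hla⟩ := mem_filter.mp ha
      rw [mem_symInterval, ← Int.natCast_natAbs] at h1
      refine mem_filter.mpr ⟨mem_Ioc.mpr ⟨Int.natAbs_pos.mpr h2, by omega⟩, l, hl, ?_⟩
      rw [← Int.natCast_dvd_natCast, Int.dvd_natAbs]
      exact_mod_cast hla) 2
    (fun b _ => by
      refine (card_le_card (t := {(b : ℤ), -(b : ℤ)}) fun a ha => ?_).trans card_le_two
      have := (mem_filter.mp ha).2
      rw [mem_insert, mem_singleton]
      omega)
  have h1 := card_filter_exists_pow_four_dvd_le T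
  have h2 : ((T : ℕ) : ℝ) = K - 1 := by exact_mod_cast hT.symm
  rw [card_symInterval hK]
  have h3 : (((symInterval K).filter
      fun a : ℤ => a ≠ 0 ∧ ∃ l : ℕ, l.Prime ∧ (l : ℤ) ^ 4 ∣ a).card : ℝ)
      ≤ 2 * (((Ioc 0 T).filter fun a => ∃ l : ℕ, l.Prime ∧ l ^ 4 ∣ a).card : ℝ) := by
    exact_mod_cast h
  linarith

lemma curve_Δ_eq_zero_iff {m : ℤ × ℤ} :
    (curve m).Δ = 0 ↔ 4 * m.1 ^ 3 + 27 * m.2 ^ 2 = 0 := by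
  rw [curve, Δ_short, mul_eq_zero, or_iff_right (by norm_num)]
  exact_mod_cast Iff.rfl

/-- At least a quarter of the pairs in a rectangle are minimal equations of elliptic curves. -/
lemma ncard_rect_le_mul {K L : ℤ} (hK : 3 ≤ K) :
    ((rect K L).card : ℝ) ≤ 4 * (ellipticCurves ∩ rect K L).ncard := by
  classical
  have hG : ellipticCurves ∩ rect K L
      = ((rect K L).filter fun m => m ∈ ellipticCurves : Finset (ℤ × ℤ)) := by
    rw [coe_filter]
    ext m
    exact and_comm
  rw [hG, Set.ncard_coe_finset]
  set S := (symInterval K).filter fun a : ℤ => a ≠ 0 ∧ ∃ l : ℕ, l.Prime ∧ (l : ℤ) ^ 4 ∣ a with hS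
  set Z := (rect K L).filter fun m => (curve m).Δ = 0 with hZ
  -- The condition `l⁶ ∣ b` is dropped: pairs with `a = 0`, with zero discriminant, or with `l⁴ ∣ a
  -- ≠ 0` are all discarded. Their shares are at most `1/5`, `1/5` and `1/4`, less than `3/4`
  -- together.
  have hsub : rect K L ⊆ ((rect K L).filter fun m => m ∈ ellipticCurves)
      ∪ (({0} ×ˢ symInterval L) ∪ (Z ∪ (S ×ˢ symInterval L))) := by
    intro m hm
    obtain ⟨h1, h2⟩ := mem_product.mp hm
    simp only [mem_union, mem_filter, mem_product, mem_singleton, hS, hZ, hm, h1, h2, true_and,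
      and_true]
    by_cases ha : m.1 = 0
    · exact Or.inr (Or.inl ha)
    by_cases hd : (curve m).Δ = 0
    · exact Or.inr (Or.inr (Or.inl hd))
    by_cases hl : ∃ l : ℕ, l.Prime ∧ (l : ℤ) ^ 4 ∣ m.1
    · exact Or.inr (Or.inr (Or.inr ⟨ha, hl⟩))
    · exact Or.inl ⟨hd, fun l hp hdvd => hl ⟨l, hp, hdvd.1⟩⟩
  -- On the singular locus `b` determines `a³`, hence `a`.
  have hZc : Z.card ≤ (symInterval L).card := by
    refine card_le_card_of_injOn Prod.snd
      (fun m hm => (mem_product.mp (mem_filter.mp (mem_coe.mp hm)).1).2) fun m hm m' hm' he => ?_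
    have h1 := curve_Δ_eq_zero_iff.mp (mem_filter.mp (mem_coe.mp hm)).2
    have h2 := curve_Δ_eq_zero_iff.mp (mem_filter.mp (mem_coe.mp hm')).2
    have he' : m.2 = m'.2 := he
    refine Prod.ext ((Odd.strictMono_pow (by decide : Odd 3)).injective ?_) he'
    rw [he'] at h1
    omega
  have hcard := (card_le_card hsub).trans ((card_union_le _ _).trans
    (Nat.add_le_add_left ((card_union_le _ _).trans
      (Nat.add_le_add_left (card_union_le _ _) _)) _))
  rw [card_product {0}, card_product S, card_singleton, one_mul] at hcard
  have hSc : (S.card : ℝ) ≤ (symInterval K).card / 4 := card_filter_symInterval_le (by omega)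
  have hn : (5 : ℝ) ≤ (symInterval K).card := by
    rw [card_symInterval (by omega)]
    have : (3 : ℝ) ≤ K := by exact_mod_cast hK
    linarith
  have hZc' : (Z.card : ℝ) ≤ (symInterval L).card := by exact_mod_cast hZc
  have hcard' : ((rect K L).card : ℝ) ≤ ((rect K L).filter fun m => m ∈ ellipticCurves).card
      + ((symInterval L).card + (Z.card + S.card * (symInterval L).card)) := by
    exact_mod_cast hcard
  have hN : ((rect K L).card : ℝ) = (symInterval K).card * (symInterval L).card := by
    rw [card_product, Nat.cast_mul]
  have h0 : (0 : ℝ) ≤ (symInterval L).card := by positivity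
  have h1 := mul_le_mul_of_nonneg_right hSc h0
  have h2 := mul_le_mul_of_nonneg_right hn h0
  rw [hN] at hcard' ⊢
  linarith

lemma height_lt_iff {x : ℝ} (hx : 0 ≤ x) (m : ℤ × ℤ) :
    (height m : ℝ) < x ↔ m ∈ box (x ^ (3 : ℝ)⁻¹) (x ^ (2 : ℝ)⁻¹) := by
  have h1 := Real.lt_rpow_inv_iff_of_pos (abs_nonneg (m.1 : ℝ)) hx (z := 3) (by norm_num)
  have h2 := Real.lt_rpow_inv_iff_of_pos (abs_nonneg (m.2 : ℝ)) hx (z := 2) (by norm_num)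
  rw [box, Set.mem_ofPred_eq, h1, h2, height]
  push_cast
  rw [max_lt_iff, ← Real.rpow_natCast, ← sq_abs (m.2 : ℝ), ← Real.rpow_natCast]
  norm_num

/-- Curves of height below `x` are the minimal pairs in the box with sides `x^(1/3)` and `x^(1/2)`,
both eventually beyond `Y⁴`. They fill at least a quarter of it, so the exceptional proportion grows
by a factor of at most `4`. -/
lemma le_lowerDensity {Y β c : ℝ} (hβ : 0 < β) (hc : 0 ≤ c)
    (h : ∀ C D : ℝ, Y ^ 4 < C → Y ^ 4 < D →
      ((exceptional Y β C D).ncard : ℝ) ≤ c / β ^ 2 * (box C D).ncard) :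
    1 - 4 * c / β ^ 2 ≤ lowerDensity {m | IsTypical Y β m} := by
  have h3 : Filter.Tendsto (fun x : ℝ => x ^ (3 : ℝ)⁻¹) Filter.atTop Filter.atTop :=
    tendsto_rpow_atTop (by norm_num)
  have h2 : Filter.Tendsto (fun x : ℝ => x ^ (2 : ℝ)⁻¹) Filter.atTop Filter.atTop :=
    tendsto_rpow_atTop (by norm_num)
  have hfin : ∀ x : ℝ, 0 ≤ x → {m ∈ ellipticCurves | (height m : ℝ) < x}.Finite := fun x hx =>
    (finite_box (x ^ (3 : ℝ)⁻¹) (x ^ (2 : ℝ)⁻¹)).subset fun m hm => (height_lt_iff hx m).mp hm.2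
  -- A real `liminf` is meaningful only for a bounded ratio; here the ratio is at most `1`.
  refine Filter.le_liminf_of_le (Filter.IsBoundedUnder.isCoboundedUnder_ge
    (Filter.isBoundedUnder_of_eventually_le (a := 1) ?_)) ?_
  · filter_upwards [Filter.eventually_ge_atTop 0] with x hx
    refine div_le_one_of_le₀ (Nat.cast_le.mpr (Set.ncard_le_ncard ?_ (hfin x hx))) (by positivity)
    exact fun m hm => ⟨hm.1.2, hm.2⟩
  · filter_upwards [Filter.eventually_ge_atTop 0, h3.eventually_gt_atTop (Y ^ 4),
      h2.eventually_gt_atTop (Y ^ 4), h3.eventually_gt_atTop 2, h2.eventually_gt_atTop 0]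
      with x hx hC hD hC2 hD0
    have hex := h _ _ hC hD
    set C := x ^ (3 : ℝ)⁻¹
    set D := x ^ (2 : ℝ)⁻¹
    have hG : {m ∈ ellipticCurves | (height m : ℝ) < x} = ellipticCurves ∩ box C D := by
      ext m
      exact and_congr_right fun _ => height_lt_iff hx m
    have hbox : ((box C D).ncard : ℝ) ≤ 4 * (ellipticCurves ∩ box C D).ncard := by
      rw [ncard_box, box_eq_rect]
      exact ncard_rect_le_mul (Int.lt_ceil.mpr (by exact_mod_cast hC2))
    have hpos : (0 : ℝ) < (box C D).ncard := by
      exact_mod_cast ncard_box_pos (by linarith) hD0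
    have hcov : ellipticCurves ∩ box C D ⊆
        {m ∈ {m | IsTypical Y β m} ∩ ellipticCurves | (height m : ℝ) < x} ∪ exceptional Y β C D := by
      rintro m ⟨hm1, hm2⟩
      by_cases ht : IsTypical Y β m
      · exact Or.inl ⟨⟨ht, hm1⟩, (height_lt_iff hx m).mpr hm2⟩
      · exact Or.inr ⟨hm2, ht⟩
    have hle := (Set.ncard_le_ncard hcov (((hfin x hx).subset fun m hm => ⟨hm.1.2, hm.2⟩).union
      ((finite_box C D).subset fun m hm => hm.1))).trans (Set.ncard_union_le _ _)
    rw [hG, le_div_iff₀ (by linarith)]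
    have hle' : ((ellipticCurves ∩ box C D).ncard : ℝ) ≤
        {m ∈ {m | IsTypical Y β m} ∩ ellipticCurves | (height m : ℝ) < x}.ncard
          + (exceptional Y β C D).ncard := by
      exact_mod_cast hle
    have hcβ : 0 ≤ c / β ^ 2 := by positivity
    have := mul_le_mul_of_nonneg_left hbox hcβ
    have e : 4 * c / β ^ 2 = 4 * (c / β ^ 2) := by ring
    rw [e]
    linarith

end Density

end LocalTorsion

theorem theorem5p3 :
    ∃ c : ℝ, 0 < c ∧ ∀ Y : ℝ, 0 < Y → 0 < LocalTorsion.mainTerm Y → ∀ β : ℝ, 0 < β →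
      1 - c / β ^ 2 ≤ LocalTorsion.lowerDensity {m | LocalTorsion.IsTypical Y β m} ∧
      ∀ C D : ℝ, Y ^ 4 < C → Y ^ 4 < D →
        ((LocalTorsion.exceptional Y β C D).ncard : ℝ) / ((LocalTorsion.box C D).ncard : ℝ)
          < c / β ^ 2 := by
  obtain ⟨c, hc, h⟩ := LocalTorsion.exists_ncard_exceptional_le
  -- The factor `4` serves the density statement and also makes the box inequality strict.
  refine ⟨4 * c, by positivity, fun Y hY hP β hβ => ⟨?_, fun C D hC hD => ?_⟩⟩
  · exact LocalTorsion.le_lowerDensity hβ hc.le (h Y hY hP β hβ)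
  · have hY4 : 0 < Y ^ 4 := by positivity
    have hpos : (0 : ℝ) < (LocalTorsion.box C D).ncard := by
      exact_mod_cast LocalTorsion.ncard_box_pos (hY4.trans hC) (hY4.trans hD)
    rw [div_lt_iff₀ hpos]
    refine (h Y hY hP β hβ C D hC hD).trans_lt ?_
    gcongr
    linarith
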